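/- **Setting.** Let $N\ge 2$, and write $e(s)=e^{i\pi s}$. Multiplicative variables are given through logarithms, and complex powers are taken accordingly: $z=e(\xi)$, $w=e(\eta)$, $q=e(\zeta)$, $p=e(2\tau)$, $z^s=e(s\xi)$, $q^s=e(s\zeta)$, $p^{1/2}=e(\tau)$, with $|q|<1$, $|p|<1$; thus multiplying $z$ by $q^{c}$, resp. by $-p^{1/2}$, is the shift of $\xi$ by $c\zeta$, resp. by $\tau+1$. Functions and operators "of $z$" are functions of $\xi\in\mathbb C$. Put $$(x;a)_\infty=\prod_{n\ge0}(1-xa^n),\quad (x;a,b)_\infty=\prod_{n,m\ge0}(1-xa^nb^m),\quad \Theta_a(x)=(x;a)_\infty(ax^{-1};a)_\infty(a;a)_\infty,$$ $$\vartheta_{\gamma_1,\gamma_2}(\xi,\tau)=\sum_{m\in\mathbb Z}e^{i\pi(m+\gamma_1)^2\tau+2i\pi(m+\gamma_1)(\xi+\gamma_2)}.$$ With $\omega=e^{2i\pi/N}$ let $g=\mathrm{diag}(\omega^i)_{1\le i\le N}$, $g^{1/2}=\mathrm{diag}(\omega^{i/2})_{1\le i\le N}$, $h=(\delta_{i+1,j})$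 (indices mod $N$), $G=g^{1/2}hg^{1/2}$, $I_{(\alpha_1,\alpha_2)}=g^{\alpha_2}h^{\alpha_1}$. Let $$\widetilde R(z)=\frac{z^{2/N-2}}{\kappa(z^2)}\,\frac{\vartheta_{\frac12,\frac12}(\zeta,\tau)}{\vartheta_{\frac12,\frac12}(\xi+\zeta,\tau)}\sum_{\alpha_1,\alpha_2=0}^{N-1}\frac1N\,\frac{\vartheta_{\frac12+\frac{\alpha_1}N,\frac12+\frac{\alpha_2}N}(\xi+\frac{\zeta}{N},\tau)}{\vartheta_{\frac12+\frac{\alpha_1}N,\frac12+\frac{\alpha_2}N}(\frac{\zeta}{N},\tau)}\;I_{\alpha}\otimes I_{\alpha}^{-1},$$ $$\frac1{\kappa(z^2)}=\frac{(q^{2N}z^{-2};p,q^{2N})_\infty(q^2z^2;p,q^{2N})_\infty(pz^{-2};p,q^{2N})_\infty(pq^{2N-2}z^2;p,q^{2N})_\infty}{(q^{2N}z^2;p,q^{2N})_\infty(q^2z^{-2};p,q^{2N})_\infty(pz^2;p,q^{2N})_\infty(pq^{2N-2}z^{-2};p,q^{2N})_\infty},$$ $R(z)=(g^{1/2}\otimes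 g^{1/2})\widetilde R(z)(g^{-1/2}\otimes g^{-1/2})$ and $\widehat R(z)=\tau_N(q^{1/2}z^{-1})R(z)$, where $\tau_N(z)=z^{2/N-2}\,\Theta_{q^{2N}}(qz^2)/\Theta_{q^{2N}}(qz^{-2})$. For $c\in\mathbb C$ let $\widehat R^*$ be $\widehat R$ with $\tau$ replaced by $\tau^*=\tau-c\zeta$, i.e. with $p$ replaced by $p^*=pq^{-2c}$. Assume $|p^*|<1$ and that $q^2$ is an integer power neither of $p$ nor of $p^*$ (so that the formulas for $\widehat R,\widehat R^*$ make sense). A ratio $x$ is called *generic* if $x^2$ is not in the multiplicative group generated by $q^2,p,p^*$. The elliptic algebra $\mathcal A_{q,p}(\widehat{sl}(N)_c)$ is the unital associative $\mathbb C$-algebra generated by the entries of $N\times N$ matrices $L(z)$, together with the entries of their inverses $L(z)^{-1}$, with the relations $$\widehat R_{12}(z/w)\,L_1(z)L_2(w)=L_2(w)L_1(z)\,\widehat R^*_{12}(z/w)\quad(z/w\text{ generic}),\qquad L(z)L(z)^{-1}=L(z)^{-1}L(z)=1,$$ $$\sum_{\sigma\in\mathfrak S_N}\varepsilon(\sigma)\,L_{N,\sigma(N)}(zq^{-1})\cdots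 L_{2,\sigma(2)}(zq^{1-N})L_{1,\sigma(1)}(zq^{-N})=q^{c/2}.$$ Put $L^+(z)=L(q^{c/2}z)$, $L^-(z)=G\,L(-p^{1/2}z)\,G^{-1}$ and $t(z)=\mathrm{Tr}\big(L^+(q^{c/2}z)L^-(z)^{-1}\big)$. For $M\in\mathbb Z$ let $\Sigma_{N,M}$ be the surface $(-p^{1/2})^{NM}=q^{-c-N}$; since $\widehat R$ depends on $z$ through $z^{2/N}$, the equation is understood to hold also for the $2/N$-th powers: $p^{M}=q^{-2(c+N)/N}$ (the same equation when $N=2$). Let $$F(M,x)=q^{2M(N-1)}\prod_{k=0}^{NM-1}\frac{\Theta_{q^{2N}}(x^{-2}p^{-k})\,\Theta_{q^{2N}}(x^2p^{k})}{\Theta_{q^{2N}}(x^{-2}q^2p^{-k})\,\Theta_{q^{2N}}(x^2q^2p^{k})}\quad(M>0),$$ $$F(M,x)=q^{-2|M|(N-1)}\prod_{k=1}^{N|M|}\frac{\Theta_{q^{2N}}(x^{-2}q^2p^{k})\,\Theta_{q^{2N}}(x^2q^2p^{-k})}{\Theta_{q^{2N}}(x^{-2}p^{k})\,\Theta_{q^{2N}}(x^2p^{-k})}\quad(M<0),$$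 $$\mathcal Y_{N,p,q,M}(x)=\prod_{k=1}^{K}\frac{\Theta_{q^{2N}}(x^2p^{-k})^2\,\Theta_{q^{2N}}(x^2q^2p^k)\,\Theta_{q^{2N}}(x^2q^{-2}p^k)}{\Theta_{q^{2N}}(x^2p^k)^2\,\Theta_{q^{2N}}(x^2q^2p^{-k})\,\Theta_{q^{2N}}(x^2q^{-2}p^{-k})},\qquad K=\begin{cases}NM&(M>0)\\N|M|-1&(M<0),\end{cases}$$ and $F(0,x)=\mathcal Y_{N,p,q,0}(x)=1$. **Theorem 3.** Let $M\in\mathbb Z$. On $\Sigma_{N,M}$ one has, in $\mathcal A_{q,p}(\widehat{sl}(N)_c)$, for all $z,w$ with $w/z$ generic, $$t(z)\,L(w)=F(M,w/z)\,L(w)\,t(z)\quad\text{(entrywise)},\qquad t(z)\,t(w)=\mathcal Y_{N,p,q,M}(w/z)\,t(w)\,t(z).$$ Moreover, for all $|p|,|q|<1$ as above (with no condition involving $c$), $\mathcal Y_{N,p,q,M}(xq^N)=\mathcal Y_{N,p,q,M}(x)$ for all $x\ne0$, and $$\mathcal Y_{N,p,q,M}(x)\,\mathcal Y_{N,p,q,M}(xq)\cdots\mathcal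 Y_{N,p,q,M}(xq^{N-1})=1$$ for all $x\neq0$ such that $x^2$ is not of the form $q^{2a}p^b$ with $a,b\in\mathbb Z$. -/

import Mathlib

open scoped Kronecker

noncomputable section

namespace EllipticW

/-! ### Special functions -/

/-- `e s = exp (i π s)`.  Multiplicative variables are written through logarithms:
`z = e ξ`, `w = e η`, `q = e ζ`, `p = e (2 τ)`; complex powers are `z ^ s = e (s ξ)`. -/
def e (s : ℂ) : ℂ := Complex.exp (Complex.I * Real.pi * s)

/-- The simple infinite product `(x; a)_∞`. -/
def poch (x a : ℂ) : ℂ := ∏' n : ℕ, (1 - x * a ^ n)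

/-- The double infinite product `(x; a, b)_∞`. -/
def poch₂ (x a b : ℂ) : ℂ := ∏' n : ℕ × ℕ, (1 - x * a ^ n.1 * b ^ n.2)

/-- `Θ_a(x) = (x; a)_∞ (a x⁻¹; a)_∞ (a; a)_∞`. -/
def Theta (a x : ℂ) : ℂ := poch x a * poch (a * x⁻¹) a * poch a a

/-- Jacobi theta function with characteristics `γ₁, γ₂`. -/
def theta (γ₁ γ₂ : ℂ) (ξ τ : ℂ) : ℂ :=
  ∑' m : ℤ, Complex.exp (Complex.I * Real.pi * ((m : ℂ) + γ₁) ^ 2 * τ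
    + 2 * Complex.I * Real.pi * ((m : ℂ) + γ₁) * (ξ + γ₂))

/-! ### The elliptic `R`-matrix of the `ℤ_N`-vertex model

Matrix indices `1, …, N` are represented by `Fin N`, so that `i : Fin N` stands for `i + 1`. -/

/-- `g = diag (ω, ω², …, ω^N)` with `ω = exp (2 i π / N)`. -/
def gMat (N : ℕ) : Matrix (Fin N) (Fin N) ℂ :=
  Matrix.diagonal fun i => e (2 * ((i : ℕ) + 1) / N)

/-- `g ^ {1/2} = diag (ω^{1/2}, ω^{2/2}, …, ω^{N/2})`. -/
def gHalf (N : ℕ) : Matrix (Fin N) (Fin N) ℂ :=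
  Matrix.diagonal fun i => e (((i : ℕ) + 1) / N)

/-- The cyclic shift `h_{ij} = δ_{i+1,j}`, indices modulo `N`. -/
def hMat (N : ℕ) : Matrix (Fin N) (Fin N) ℂ :=
  Matrix.of fun i j => if (j : ℕ) = ((i : ℕ) + 1) % N then 1 else 0

/-- `I_{(α₁, α₂)} = g ^ α₂ h ^ α₁`. -/
def IMat (N : ℕ) (α : Fin N × Fin N) : Matrix (Fin N) (Fin N) ℂ :=
  gMat N ^ (α.2 : ℕ) * hMat N ^ (α.1 : ℕ)

/-- The coefficients `W_{(α₁, α₂)}(ξ, ζ, τ)`. -/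
def W (N : ℕ) (α : Fin N × Fin N) (ξ ζ τ : ℂ) : ℂ :=
  (1 / N) * (theta (1 / 2 + (α.1 : ℕ) / N) (1 / 2 + (α.2 : ℕ) / N) (ξ + ζ / N) τ
    / theta (1 / 2 + (α.1 : ℕ) / N) (1 / 2 + (α.2 : ℕ) / N) (ζ / N) τ)

/-- The normalization `1 / κ(z²)`, as a function of `y = z²`, `q`, `p`. -/
def kappaInv (N : ℕ) (y q p : ℂ) : ℂ :=
  (poch₂ (q ^ (2 * N) * y⁻¹) p (q ^ (2 * N)) * poch₂ (q ^ 2 * y) p (q ^ (2 * N))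
      * poch₂ (p * y⁻¹) p (q ^ (2 * N)) * poch₂ (p * q ^ (2 * N - 2) * y) p (q ^ (2 * N)))
    / (poch₂ (q ^ (2 * N) * y) p (q ^ (2 * N)) * poch₂ (q ^ 2 * y⁻¹) p (q ^ (2 * N))
      * poch₂ (p * y) p (q ^ (2 * N)) * poch₂ (p * q ^ (2 * N - 2) * y⁻¹) p (q ^ (2 * N)))

/-- The matrix `R̃(z, q, p)`, with `z = e ξ`, `q = e ζ`, `p = e (2 τ)`. -/
def RTilde (N : ℕ) (ξ ζ τ : ℂ) : Matrix (Fin N × Fin N) (Fin N × Fin N) ℂ :=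
  (e ((2 / N - 2) * ξ) * kappaInv N (e (2 * ξ)) (e ζ) (e (2 * τ))
      * (theta (1 / 2) (1 / 2) ζ τ / theta (1 / 2) (1 / 2) (ξ + ζ) τ)) •
    ∑ α : Fin N × Fin N, W N α ξ ζ τ • (IMat N α ⊗ₖ (IMat N α)⁻¹)

/-- The gauge-transformed matrix
`R(z, q, p) = (g^{1/2} ⊗ g^{1/2}) R̃(z, q, p) (g^{-1/2} ⊗ g^{-1/2})`. -/
def RMat (N : ℕ) (ξ ζ τ : ℂ) : Matrix (Fin N × Fin N) (Fin N × Fin N) ℂ :=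
  (gHalf N ⊗ₖ gHalf N) * RTilde N ξ ζ τ * ((gHalf N)⁻¹ ⊗ₖ (gHalf N)⁻¹)

/-- `τ_N(z) = z^{2/N-2} Θ_{q^{2N}}(q z²) / Θ_{q^{2N}}(q z⁻²)`, with `z = e ξ`, `q = e ζ`. -/
def tauN (N : ℕ) (ξ ζ : ℂ) : ℂ :=
  e ((2 / N - 2) * ξ) *
    (Theta (e ζ ^ (2 * N)) (e ζ * e (2 * ξ)) / Theta (e ζ ^ (2 * N)) (e ζ * e (-(2 * ξ))))

/-- `R̂(z, q, p) = τ_N(q^{1/2} z⁻¹) R(z, q, p)`. -/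
def RHat (N : ℕ) (ξ ζ τ : ℂ) : Matrix (Fin N × Fin N) (Fin N × Fin N) ℂ :=
  tauN N (ζ / 2 - ξ) ζ • RMat N ξ ζ τ

/-! ### The elliptic algebra -/

/-- Logarithmic parameter of `p* = p q^{-2c}`: one has `p* = e (2 τ*)`. -/
def tauStar (ζ τ c : ℂ) : ℂ := τ - c * ζ

/-- The ratio `e u` of two spectral parameters is generic: its square is not in the
(countable) multiplicative group generated by `q²`, `p` and `p*`.  All the zeros and poles
of the structure functions are at ratios whose square is in this group. -/
def Generic (ζ τ c u : ℂ) : Prop :=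
  ∀ a b d : ℤ, e (2 * u) ≠ e ζ ^ (2 * a) * e (2 * τ) ^ b * e (2 * tauStar ζ τ c) ^ d

/-- Generators: the entries of `L(z)` and of its inverse, `z = e ξ`. -/
inductive Gen (N : ℕ) : Type
  | L (ξ : ℂ) (i j : Fin N) : Gen N
  | Linv (ξ : ℂ) (i j : Fin N) : Gen N

/-- The matrix of generators `L(z)` over the free algebra. -/
def freeL (N : ℕ) (ξ : ℂ) : Matrix (Fin N) (Fin N) (FreeAlgebra ℂ (Gen N)) :=
  Matrix.of fun i j => FreeAlgebra.ι ℂ (Gen.L ξ i j)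

/-- The matrix of generators `L(z)⁻¹` over the free algebra. -/
def freeLinv (N : ℕ) (ξ : ℂ) : Matrix (Fin N) (Fin N) (FreeAlgebra ℂ (Gen N)) :=
  Matrix.of fun i j => FreeAlgebra.ι ℂ (Gen.Linv ξ i j)

/-- `L₁(z) = L(z) ⊗ 1`. -/
def freeL₁ (N : ℕ) (ξ : ℂ) :
    Matrix (Fin N × Fin N) (Fin N × Fin N) (FreeAlgebra ℂ (Gen N)) := freeL N ξ ⊗ₖ 1

/-- `L₂(z) = 1 ⊗ L(z)`. -/
def freeL₂ (N : ℕ) (ξ : ℂ) :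
    Matrix (Fin N × Fin N) (Fin N × Fin N) (FreeAlgebra ℂ (Gen N)) := 1 ⊗ₖ freeL N ξ

/-- The `q`-determinant `∑_σ ε(σ) ∏_{i=1}^N L_{i,σ(i)}(z q^{i-N-1})`, where the factor with
the largest `i` stands on the left. -/
def qDet (N : ℕ) (ζ ξ : ℂ) : FreeAlgebra ℂ (Gen N) :=
  ∑ σ : Equiv.Perm (Fin N), ((Equiv.Perm.sign σ : ℤ) : FreeAlgebra ℂ (Gen N)) *
    ((List.finRange N).reverse.map
      fun i : Fin N => freeL N (ξ + (((i : ℕ) : ℂ) - N) * ζ) i (σ i)).prod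

/-- The defining relations of the elliptic algebra:
`R̂₁₂(z/w) L₁(z) L₂(w) = L₂(w) L₁(z) R̂*₁₂(z/w)` for generic `z/w`, invertibility of `L(z)`,
and `q-det L(z) = q^{c/2}`. -/
inductive Rel (N : ℕ) (ζ τ c : ℂ) : FreeAlgebra ℂ (Gen N) → FreeAlgebra ℂ (Gen N) → Prop
  | exchange (ξ η : ℂ) (h : Generic ζ τ c (ξ - η)) (a b : Fin N × Fin N) :
      Rel N ζ τ c
        (((RHat N (ξ - η) ζ τ).map (algebraMap ℂ (FreeAlgebra ℂ (Gen N)))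
          * freeL₁ N ξ * freeL₂ N η) a b)
        ((freeL₂ N η * freeL₁ N ξ *
          (RHat N (ξ - η) ζ (tauStar ζ τ c)).map (algebraMap ℂ (FreeAlgebra ℂ (Gen N)))) a b)
  | mul_inv (ξ : ℂ) (i j : Fin N) :
      Rel N ζ τ c ((freeL N ξ * freeLinv N ξ) i j)
        ((1 : Matrix (Fin N) (Fin N) (FreeAlgebra ℂ (Gen N))) i j)
  | inv_mul (ξ : ℂ) (i j : Fin N) :
      Rel N ζ τ c ((freeLinv N ξ * freeL N ξ) i j)
        ((1 : Matrix (Fin N) (Fin N) (FreeAlgebra ℂ (Gen N))) i j)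
  | det (ξ : ℂ) :
      Rel N ζ τ c (qDet N ζ ξ) (algebraMap ℂ (FreeAlgebra ℂ (Gen N)) (e (c / 2 * ζ)))

/-- The elliptic quantum algebra `A_{q,p}(ŝl(N)_c)`. -/
abbrev EllipticAlgebra (N : ℕ) (ζ τ c : ℂ) : Type := RingQuot (Rel N ζ τ c)

/-- The matrix `L(z)` over the elliptic algebra, `z = e ξ`. -/
def L (N : ℕ) (ζ τ c ξ : ℂ) : Matrix (Fin N) (Fin N) (EllipticAlgebra N ζ τ c) :=
  (freeL N ξ).map (RingQuot.mkAlgHom ℂ (Rel N ζ τ c))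

/-- The matrix `L(z)⁻¹` over the elliptic algebra. -/
def Linv (N : ℕ) (ζ τ c ξ : ℂ) : Matrix (Fin N) (Fin N) (EllipticAlgebra N ζ τ c) :=
  (freeLinv N ξ).map (RingQuot.mkAlgHom ℂ (Rel N ζ τ c))

/-- A complex matrix as a matrix over the elliptic algebra. -/
def scal {N : ℕ} (ζ τ c : ℂ) (A : Matrix (Fin N) (Fin N) ℂ) :
    Matrix (Fin N) (Fin N) (EllipticAlgebra N ζ τ c) :=
  A.map (algebraMap ℂ (EllipticAlgebra N ζ τ c))

/-- `G = g^{1/2} h g^{1/2}`. -/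
def GMat (N : ℕ) : Matrix (Fin N) (Fin N) ℂ := gHalf N * hMat N * gHalf N

/-- `L⁺(z) = L(q^{c/2} z)`. -/
def Lplus (N : ℕ) (ζ τ c ξ : ℂ) : Matrix (Fin N) (Fin N) (EllipticAlgebra N ζ τ c) :=
  L N ζ τ c (ξ + c / 2 * ζ)

/-- `L⁻(z) = G L(-p^{1/2} z) G⁻¹`; multiplication of `z` by `-p^{1/2}` is `ξ ↦ ξ + τ + 1`. -/
def Lminus (N : ℕ) (ζ τ c ξ : ℂ) : Matrix (Fin N) (Fin N) (EllipticAlgebra N ζ τ c) :=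
  scal ζ τ c (GMat N) * L N ζ τ c (ξ + τ + 1) * scal ζ τ c (GMat N)⁻¹

/-- `L⁻(z)⁻¹ = G L(-p^{1/2} z)⁻¹ G⁻¹`. -/
def LminusInv (N : ℕ) (ζ τ c ξ : ℂ) : Matrix (Fin N) (Fin N) (EllipticAlgebra N ζ τ c) :=
  scal ζ τ c (GMat N) * Linv N ζ τ c (ξ + τ + 1) * scal ζ τ c (GMat N)⁻¹

/-- `t(z) = Tr (L⁺(q^{c/2} z) L⁻(z)⁻¹)`. -/
def t (N : ℕ) (ζ τ c ξ : ℂ) : EllipticAlgebra N ζ τ c :=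
  Matrix.trace (Lplus N ζ τ c (ξ + c / 2 * ζ) * LminusInv N ζ τ c ξ)

/-! `LminusInv` is the two-sided inverse of `Lminus`. -/

theorem isUnit_GMat (N : ℕ) : IsUnit (GMat N).det := by
  have h1 : IsUnit (gHalf N).det := by
    rw [gHalf, Matrix.det_diagonal, isUnit_iff_ne_zero]
    exact Finset.prod_ne_zero_iff.2 fun i _ => Complex.exp_ne_zero _
  have h2 : IsUnit (hMat N).det := by
    have : hMat N * (hMat N).transpose = 1 := by
      ext i k
      have hN : 0 < N := i.pos
      rw [Matrix.mul_apply, Finset.sum_eq_single ⟨((i : ℕ) + 1) % N, Nat.mod_lt _ hN⟩]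
      · have hi := i.isLt
        have hk := k.isLt
        have : (((i : ℕ) + 1) % N = ((k : ℕ) + 1) % N) ↔ i = k := by
          rw [Fin.ext_iff]
          refine ⟨fun h => ?_, fun h => by rw [h]⟩
          have h' : (i : ℕ) + 1 ≡ (k : ℕ) + 1 [MOD N] := h
          exact Nat.ModEq.eq_of_lt_of_lt (Nat.ModEq.add_right_cancel' 1 h') hi hk
        simp [hMat, Matrix.one_apply, this]
      · intro j _ hj
        have : (j : ℕ) ≠ ((i : ℕ) + 1) % N := fun h => hj (Fin.ext h)
        simp [hMat, this]
      · simp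
    have h := congrArg Matrix.det this
    rw [Matrix.det_mul, Matrix.det_one] at h
    exact IsUnit.of_mul_eq_one _ h
  rw [GMat, Matrix.det_mul, Matrix.det_mul]
  exact (h1.mul h2).mul h1

theorem scal_mul {N : ℕ} (ζ τ c : ℂ) (A B : Matrix (Fin N) (Fin N) ℂ) :
    scal ζ τ c (A * B) = scal ζ τ c A * scal ζ τ c B := Matrix.map_mul

theorem scal_one {N : ℕ} (ζ τ c : ℂ) :
    scal ζ τ c (1 : Matrix (Fin N) (Fin N) ℂ) = 1 := by
  unfold scal; exact Matrix.map_one _ (map_zero _) (map_one _)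

theorem L_mul_Linv (N : ℕ) (ζ τ c ξ : ℂ) : L N ζ τ c ξ * Linv N ζ τ c ξ = 1 := by
  have h : (freeL N ξ * freeLinv N ξ).map (RingQuot.mkAlgHom ℂ (Rel N ζ τ c)) = 1 := by
    ext i j
    rw [Matrix.map_apply, RingQuot.mkAlgHom_rel ℂ (Rel.mul_inv ξ i j)]
    by_cases hij : i = j <;> simp [Matrix.one_apply, hij]
  rwa [Matrix.map_mul] at h

theorem Linv_mul_L (N : ℕ) (ζ τ c ξ : ℂ) : Linv N ζ τ c ξ * L N ζ τ c ξ = 1 := by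
  have h : (freeLinv N ξ * freeL N ξ).map (RingQuot.mkAlgHom ℂ (Rel N ζ τ c)) = 1 := by
    ext i j
    rw [Matrix.map_apply, RingQuot.mkAlgHom_rel ℂ (Rel.inv_mul ξ i j)]
    by_cases hij : i = j <;> simp [Matrix.one_apply, hij]
  rwa [Matrix.map_mul] at h

theorem Lminus_inverse (N : ℕ) (ζ τ c ξ : ℂ) :
    Lminus N ζ τ c ξ * LminusInv N ζ τ c ξ = 1 ∧
      LminusInv N ζ τ c ξ * Lminus N ζ τ c ξ = 1 := by
  have h1 : scal ζ τ c (GMat N)⁻¹ * scal ζ τ c (GMat N) = 1 := by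
    rw [← scal_mul, Matrix.nonsing_inv_mul _ (isUnit_GMat N), scal_one]
  have h2 : scal ζ τ c (GMat N) * scal ζ τ c (GMat N)⁻¹ = 1 := by
    rw [← scal_mul, Matrix.mul_nonsing_inv _ (isUnit_GMat N), scal_one]
  have key : ∀ A B : Matrix (Fin N) (Fin N) (EllipticAlgebra N ζ τ c), A * B = 1 →
      (scal ζ τ c (GMat N) * A * scal ζ τ c (GMat N)⁻¹) *
        (scal ζ τ c (GMat N) * B * scal ζ τ c (GMat N)⁻¹) = 1 := by
    intro A B hAB
    calc _ = scal ζ τ c (GMat N) * A * (scal ζ τ c (GMat N)⁻¹ * scal ζ τ c (GMat N)) * B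
          * scal ζ τ c (GMat N)⁻¹ := by noncomm_ring
      _ = scal ζ τ c (GMat N) * (A * B) * scal ζ τ c (GMat N)⁻¹ := by
          rw [h1]; noncomm_ring
      _ = 1 := by rw [hAB, mul_one, h2]
  exact ⟨key _ _ (L_mul_Linv N ζ τ c _), key _ _ (Linv_mul_L N ζ τ c _)⟩

/-! ### The parameters -/

/-- The formula for `R(z, q, p)` makes sense (no denominator vanishes identically in `z`):
`q²` is not an integer power of `p`. -/
def NonResonant (ζ τ : ℂ) : Prop := ∀ b : ℤ, e ζ ^ 2 ≠ e (2 * τ) ^ b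

/-- The parameters are on the surface `Σ_{N,M}`: `(-p^{1/2})^{NM} = q^{-c-N}`.  The
`R`-matrix depends on `z` through `z ^ {2/N}`, so the equation is also read for the `2/N`-th
powers of both sides, `p^M = q^{-2(c+N)/N}`; for `N = 2` this repeats the first equation. -/
structure OnSurface (N : ℕ) (M : ℤ) (ζ τ c : ℂ) : Prop where
  eqn : (-e τ) ^ ((N : ℤ) * M) = e ((-c - N) * ζ)
  eqn_root : e (2 * τ) ^ M = e (2 / N * (-c - N) * ζ)

/-! ### The structure functions -/

/-- `F(M, x)`; equal to `1` for `M = 0`. -/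
def F (N : ℕ) (M : ℤ) (q p x : ℂ) : ℂ :=
  if 0 < M then
    q ^ (2 * M * ((N : ℤ) - 1)) * ∏ k ∈ Finset.range (N * M.natAbs),
      (Theta (q ^ (2 * N)) (x ^ (-2 : ℤ) * p ^ (-(k : ℤ))) *
          Theta (q ^ (2 * N)) (x ^ 2 * p ^ k)) /
        (Theta (q ^ (2 * N)) (x ^ (-2 : ℤ) * q ^ 2 * p ^ (-(k : ℤ))) *
          Theta (q ^ (2 * N)) (x ^ 2 * q ^ 2 * p ^ k))
  else
    q ^ (-2 * (M.natAbs : ℤ) * ((N : ℤ) - 1)) * ∏ k ∈ Finset.Icc 1 (N * M.natAbs),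
      (Theta (q ^ (2 * N)) (x ^ (-2 : ℤ) * q ^ 2 * p ^ k) *
          Theta (q ^ (2 * N)) (x ^ 2 * q ^ 2 * p ^ (-(k : ℤ)))) /
        (Theta (q ^ (2 * N)) (x ^ (-2 : ℤ) * p ^ k) *
          Theta (q ^ (2 * N)) (x ^ 2 * p ^ (-(k : ℤ))))

/-- `𝒴_{N,p,q,M}(x)`: the product runs over `1 ≤ k ≤ N M` for `M > 0` and over
`1 ≤ k ≤ N |M| - 1` for `M < 0`; it is empty, hence equal to `1`, for `M = 0`. -/
def Y (N : ℕ) (M : ℤ) (q p x : ℂ) : ℂ :=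
  ∏ k ∈ Finset.Icc 1 (if 0 < M then N * M.natAbs else N * M.natAbs - 1),
    (Theta (q ^ (2 * N)) (x ^ 2 * p ^ (-(k : ℤ))) ^ 2 *
        Theta (q ^ (2 * N)) (x ^ 2 * q ^ 2 * p ^ k) *
        Theta (q ^ (2 * N)) (x ^ 2 * q ^ (-2 : ℤ) * p ^ k)) /
      (Theta (q ^ (2 * N)) (x ^ 2 * p ^ k) ^ 2 *
        Theta (q ^ (2 * N)) (x ^ 2 * q ^ 2 * p ^ (-(k : ℤ))) *
        Theta (q ^ (2 * N)) (x ^ 2 * q ^ (-2 : ℤ) * p ^ (-(k : ℤ))))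

end EllipticW

end

open EllipticW

noncomputable section

namespace EllipticW

/-! ### Infinite products -/

/-! Put T = L(q^c z) L⁻(z)⁻¹, so that t(z) = Tr T, and u = z/w. Three properties of R̂ carry the
proof. Conjugation by G turns R̂(-p^{1/2}u) into R̂(u) times a scalar `rho` depending on u²
(`GMat_mul_RHat_add`). R̂ has an explicit inverse (`RHat_mul_RHatInv`). It has a crossing symmetry:
R̂(q^{-N}u) contracted with R̂(u)⁻¹ along the first tensor factor is the identity
(`contract_RHat_RHatInv`).

Since p^{1/2} = q^c p*^{1/2}, quasi-periodicity turns the exchange relation at -p^{1/2}z into a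
relation between L⁻(z) and L(w), with R̂(u) on one side and R̂*(q^c u) on the other
(`exchange_Lminus`). The exchange of L(q^c z) with L(w) involves the same R̂*(q^c u), which
therefore cancels in T: R̂(q^c u) T₁ R̂(u)⁻¹ L₂(w) is a ratio of two values of `rho` times L₂(w) T₁
(`exchange_ratio`). On the surface, q^c u and q^{-N}u differ by NM steps -p^{1/2} and a period of
R̂, and G^N is scalar; so R̂(q^c u) may be replaced by R̂(q^{-N}u) at the cost of a product of
values of `rho`. By crossing, the partial trace of the left side becomes t(z)L(w), while that of the
right side is L(w)t(z). The scalars telescope to `F` (`t_mul_L`).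

Moving t(z) through the two factors of t(w) produces F(q^c w/z)/F(-p^{1/2}w/z), which is 𝒴 after
cancellation (`F_div_F`, `t_mul_t`). Finally 𝒴 is a product of ratios of values of `rho`. The
function `rho` is invariant under multiplication by q^{2N} (`rho_Q_mul`), and its product over N
consecutive multiples by q^{-2} is a constant (`prod_rho`); these give the two identities for 𝒴.

The analytic core is unitarity and crossing. The coefficients of R̂ are quotients of the odd theta
function at translates by N-torsion points, and the Heisenberg relations reduce both properties to
sums over the torsion points of products of two Kronecker functions. Fay's identity splits each
product and the distribution relation sums the pieces (`phi_convolution`). Both identities rest on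
divisibility of entire functions and a Liouville argument (`exists_entire_quotient`,
`eq_exp_of_quasiperiodic`), with the zeros of theta read off its product form. The scalar
normalizations match by the functional equations of κ (`kappaInv_p_mul`, `kappaInv_q_mul`). -/

theorem summable_norm_geometric_mul (x : ℂ) {a : ℂ} (ha : ‖a‖ < 1) :
    Summable fun n : ℕ => ‖-(x * a ^ n)‖ := by
  simp only [norm_neg, norm_mul, norm_pow]
  exact (summable_geometric_of_lt_one (norm_nonneg _) ha).mul_left _

theorem multipliable_poch (x : ℂ) {a : ℂ} (ha : ‖a‖ < 1) :
    Multipliable fun n : ℕ => 1 - x * a ^ n := by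
  simpa [sub_eq_add_neg] using multipliable_one_add_of_summable (summable_norm_geometric_mul x ha)

theorem poch_eq (x : ℂ) {a : ℂ} (ha : ‖a‖ < 1) : poch x a = (1 - x) * poch (x * a) a := by
  have h' : ∀ n : ℕ, 1 - x * a * a ^ n = 1 - x * a ^ (n + 1) := fun n => by ring
  have h := multipliable_poch (x * a) ha
  have h2 : poch (x * a) a = ∏' n : ℕ, (1 - x * a ^ (n + 1)) := tprod_congr h'
  have h3 := tprod_eq_zero_mul' (f := fun n : ℕ => 1 - x * a ^ n) (h.congr h')
  rw [h2, poch, h3]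
  simp

theorem poch_ne_zero {x a : ℂ} (ha : ‖a‖ < 1) (h : ∀ n : ℕ, x * a ^ n ≠ 1) : poch x a ≠ 0 := by
  have := tprod_one_add_ne_zero_of_summable (f := fun n : ℕ => -(x * a ^ n))
    (fun n => by rw [← sub_eq_add_neg]; exact sub_ne_zero.2 (h n).symm)
    (summable_norm_geometric_mul x ha)
  simpa [poch, sub_eq_add_neg] using this

theorem differentiable_poch {a : ℂ} (ha : ‖a‖ < 1) : Differentiable ℂ fun x => poch x a := by
  intro x₀
  have key : HasProdLocallyUniformlyOn (fun (n : ℕ) (x : ℂ) => 1 + -(x * a ^ n))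
      (fun x => ∏' n : ℕ, (1 + -(x * a ^ n))) (Metric.ball (0 : ℂ) (‖x₀‖ + 1)) := by
    refine Summable.hasProdLocallyUniformlyOn_nat_one_add Metric.isOpen_ball
      ((summable_geometric_of_lt_one (norm_nonneg _) ha).mul_left (‖x₀‖ + 1))
      (Filter.Eventually.of_forall fun n x hx => ?_) (fun n => by fun_prop)
    rw [norm_neg, norm_mul, norm_pow]
    have : ‖x‖ ≤ ‖x₀‖ + 1 := by simpa using (mem_ball_zero_iff.1 hx).le
    gcongr
  have hd := key.differentiableOn
    (.of_forall fun _ => by simpa [Finset.prod_fn] using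
      DifferentiableOn.finsetProd (fun _ _ => by fun_prop)) Metric.isOpen_ball
  have := hd.differentiableAt (Metric.isOpen_ball.mem_nhds (x := x₀) (by simp))
  simpa [poch, sub_eq_add_neg] using this

theorem summable_norm_geometric_mul₂ (x : ℂ) {a b : ℂ} (ha : ‖a‖ < 1) (hb : ‖b‖ < 1) :
    Summable fun n : ℕ × ℕ => ‖-(x * a ^ n.1 * b ^ n.2)‖ := by
  simp only [norm_neg, norm_mul, norm_pow, mul_assoc]
  exact ((summable_geometric_of_lt_one (norm_nonneg _) ha).mul_of_nonneg
    (summable_geometric_of_lt_one (norm_nonneg _) hb)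
    (fun _ => by positivity) (fun _ => by positivity)).mul_left _

theorem multipliable_poch₂ (x : ℂ) {a b : ℂ} (ha : ‖a‖ < 1) (hb : ‖b‖ < 1) :
    Multipliable fun n : ℕ × ℕ => 1 - x * a ^ n.1 * b ^ n.2 := by
  simpa [sub_eq_add_neg] using
    multipliable_one_add_of_summable (summable_norm_geometric_mul₂ x ha hb)

theorem poch₂_ne_zero {x a b : ℂ} (ha : ‖a‖ < 1) (hb : ‖b‖ < 1)
    (h : ∀ n m : ℕ, x * a ^ n * b ^ m ≠ 1) : poch₂ x a b ≠ 0 := by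
  have := tprod_one_add_ne_zero_of_summable (f := fun n : ℕ × ℕ => -(x * a ^ n.1 * b ^ n.2))
    (fun n => by rw [← sub_eq_add_neg]; exact sub_ne_zero.2 (h n.1 n.2).symm)
    (summable_norm_geometric_mul₂ x ha hb)
  simpa [poch₂, sub_eq_add_neg] using this

theorem hasProd_poch₂ (x : ℂ) {a b : ℂ} (ha : ‖a‖ < 1) (hb : ‖b‖ < 1) :
    HasProd (fun n : ℕ => poch (x * a ^ n) b) (poch₂ x a b) :=
  HasProd.prod_fiberwise (f := fun n : ℕ × ℕ => 1 - x * a ^ n.1 * b ^ n.2)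
    (multipliable_poch₂ x ha hb).hasProd fun n => (multipliable_poch (x * a ^ n) hb).hasProd

theorem poch₂_eq_left (x : ℂ) {a b : ℂ} (ha : ‖a‖ < 1) (hb : ‖b‖ < 1) :
    poch₂ x a b = poch x b * poch₂ (x * a) a b := by
  have h' : ∀ n : ℕ, poch (x * a * a ^ n) b = poch (x * a ^ (n + 1)) b := fun n => by
    congr 1; ring
  have h := hasProd_poch₂ (x * a) ha hb
  have h3 := tprod_eq_zero_mul' (f := fun n : ℕ => poch (x * a ^ n) b) (h.multipliable.congr h')
  rw [(hasProd_poch₂ x ha hb).tprod_eq, ← tprod_congr h', h.tprod_eq] at h3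
  simpa using h3

theorem poch₂_comm (x a b : ℂ) : poch₂ x a b = poch₂ x b a := by
  rw [poch₂, poch₂, ← (Equiv.prodComm ℕ ℕ).tprod_eq]
  refine tprod_congr fun n => ?_
  simp [mul_assoc, mul_comm (a ^ _)]

theorem poch₂_eq_right (x : ℂ) {a b : ℂ} (ha : ‖a‖ < 1) (hb : ‖b‖ < 1) :
    poch₂ x a b = poch x a * poch₂ (x * b) a b := by
  rw [poch₂_comm, poch₂_eq_left x hb ha, poch₂_comm]

theorem Theta_ne_zero {a x : ℂ} (ha : ‖a‖ < 1) (ha0 : a ≠ 0) (hx : x ≠ 0)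
    (h : ∀ n : ℤ, x ≠ a ^ n) : Theta a x ≠ 0 := by
  refine mul_ne_zero (mul_ne_zero (poch_ne_zero ha fun n hn => ?_) (poch_ne_zero ha fun n hn => ?_))
    (poch_ne_zero ha fun n hn => ?_)
  · refine h (-n) ?_
    rw [zpow_neg, zpow_natCast]
    exact eq_inv_of_mul_eq_one_left hn
  · refine h (n + 1) ?_
    rw [zpow_add_one₀ ha0, zpow_natCast]
    field_simp at hn
    rw [← hn]; ring
  · have : ‖a * a ^ n‖ = 1 := by rw [hn]; simp
    rw [← pow_succ', norm_pow] at this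
    exact absurd this (pow_lt_one₀ (norm_nonneg _) ha (by simp)).ne

theorem Theta_mul_self {a x : ℂ} (ha : ‖a‖ < 1) (ha0 : a ≠ 0) (hx : x ≠ 0) :
    Theta a (a * x) = -x⁻¹ * Theta a x := by
  rw [Theta, Theta, poch_eq x ha]
  have : a * (a * x)⁻¹ = x⁻¹ := by field_simp
  rw [this, poch_eq x⁻¹ ha, mul_comm a x, mul_comm a x⁻¹]
  field_simp
  ring

theorem Theta_inv {a x : ℂ} (ha : ‖a‖ < 1) (hx : x ≠ 0) :
    Theta a x⁻¹ = -x⁻¹ * Theta a x := by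
  rw [Theta, Theta, inv_inv, poch_eq x ha, poch_eq x⁻¹ ha, mul_comm a x, mul_comm a x⁻¹]
  field_simp
  ring

/-! ### Entire functions -/

/-- An entire function vanishing at the zeros of an entire function with simple zeros is
divisible by it. -/
theorem exists_entire_quotient {f D : ℂ → ℂ} (hf : Differentiable ℂ f) (hD : Differentiable ℂ D)
    (h : ∀ a, D a = 0 → deriv D a ≠ 0 ∧ f a = 0) :
    ∃ g : ℂ → ℂ, Differentiable ℂ g ∧ ∀ x, f x = g x * D x := by
  classical
  -- The l'Hôpital value at a zero `a` of `D` makes the quotient agree near `a` with `dslope f a /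
  -- dslope D a`, a ratio of differentiable functions whose denominator does not vanish at `a`.
  refine ⟨fun x => if D x = 0 then deriv f x / deriv D x else f x / D x, fun a => ?_, fun x => ?_⟩
  · by_cases ha : D a = 0
    · obtain ⟨h1, h2⟩ := h a ha
      have hf' : DifferentiableAt ℂ (dslope f a) a :=
        ((Complex.differentiableOn_dslope Filter.univ_mem).2 hf.differentiableOn).differentiableAt
          Filter.univ_mem
      have hD' : DifferentiableAt ℂ (dslope D a) a :=
        ((Complex.differentiableOn_dslope Filter.univ_mem).2 hD.differentiableOn).differentiableAt
          Filter.univ_mem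
      have hne : dslope D a a ≠ 0 := by rwa [dslope_same]
      refine (hf'.div hD' hne).congr_of_eventuallyEq ?_
      filter_upwards [hD'.continuousAt.eventually_ne hne] with x hx
      rcases eq_or_ne x a with rfl | hxa
      · simp [ha]
      · have e1 : dslope D a x = D x / (x - a) := by
          rw [dslope_of_ne _ hxa, slope_def_field, ha, sub_zero]
        have e2 : dslope f a x = f x / (x - a) := by
          rw [dslope_of_ne _ hxa, slope_def_field, h2, sub_zero]
        have hDx : D x ≠ 0 := fun h0 => hx (by rw [e1, h0, zero_div])
        have := sub_ne_zero.2 hxa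
        simp only [hDx, if_false, Pi.div_apply, e1, e2]
        field_simp
    · refine ((hf a).div (hD a) ha).congr_of_eventuallyEq ?_
      filter_upwards [(hD a).continuousAt.eventually_ne ha] with x hx
      simp [hx]
  · by_cases hx : D x = 0
    · simp [hx, (h x hx).2]
    · simp [hx]

/-- Integer and fractional parts of the real coordinates in the basis 1, τ. This reduces boundedness
of a function with lattice-periodic modulus to a compact parallelogram. -/
theorem exists_lattice_translate {τ : ℂ} (hτ : 0 < τ.im) (x : ℂ) :
    ∃ m n : ℤ, ∃ s ∈ Set.Icc (0 : ℝ) 1, ∃ t ∈ Set.Icc (0 : ℝ) 1,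
      x = (s + t * τ) + (m + n * τ) := by
  set b : ℝ := x.im / τ.im with hb
  set a : ℝ := x.re - b * τ.re with ha
  refine ⟨⌊a⌋, ⌊b⌋, Int.fract a, ⟨Int.fract_nonneg _, (Int.fract_lt_one _).le⟩,
    Int.fract b, ⟨Int.fract_nonneg _, (Int.fract_lt_one _).le⟩, ?_⟩
  have hx : x = a + b * τ := by
    apply Complex.ext
    · simp [ha]
    · simp only [Complex.add_im, Complex.ofReal_im, Complex.mul_im, Complex.ofReal_re, zero_mul,
        add_zero, zero_add, hb]
      field_simp
  have h1 : ((⌊a⌋ : ℤ) : ℂ) + (Int.fract a : ℝ) = a := by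
    have := Int.floor_add_fract a
    exact_mod_cast congrArg (fun r : ℝ => (r : ℂ)) this
  have h2 : ((⌊b⌋ : ℤ) : ℂ) + (Int.fract b : ℝ) = b := by
    have := Int.floor_add_fract b
    exact_mod_cast congrArg (fun r : ℝ => (r : ℂ)) this
  rw [hx, ← h1, ← h2]
  ring

theorem mul_add_zsmul_of_mul_add {g : ℂ → ℂ} {w μ : ℂ} (hμ : μ ≠ 0)
    (h : ∀ x, g (x + w) = μ * g x) (n : ℤ) (x : ℂ) : g (x + n * w) = μ ^ n * g x := by
  induction n using Int.induction_on generalizing x with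
  | zero => simp
  | succ n ih =>
    have : x + ((n + 1 : ℤ) : ℂ) * w = (x + (n : ℤ) * w) + w := by push_cast; ring
    rw [this, h, ih, zpow_add_one₀ hμ]; ring
  | pred n ih =>
    have h1 : x + ((-n : ℤ) : ℂ) * w = (x + ((-n - 1 : ℤ) : ℂ) * w) + w := by push_cast; ring
    have h2 := ih x
    rw [h1, h] at h2
    rw [zpow_sub_one₀ hμ]
    field_simp
    rw [mul_comm, h2]

/-- A doubly quasi-periodic entire function with constant multipliers is an exponential. -/
theorem eq_exp_of_quasiperiodic {τ : ℂ} (hτ : 0 < τ.im) {g : ℂ → ℂ} (hg : Differentiable ℂ g)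
    {μ₁ μ₂ : ℂ} (h1 : μ₁ ≠ 0) (h2 : μ₂ ≠ 0) (hg1 : ∀ x, g (x + 1) = μ₁ * g x)
    (hg2 : ∀ x, g (x + τ) = μ₂ * g x) :
    ∃ C k : ℂ, ∀ x, g x = C * Complex.exp (k * x) := by
  -- The exponent `k` is chosen so that dividing `g` by `exp (k x)` leaves multipliers of modulus
  -- one: its real part takes care of the period 1, and its imaginary part of the period `τ`. The
  -- modulus of the quotient is then doubly periodic, so Liouville's theorem applies.
  set r : ℝ := Real.log ‖μ₁‖
  set i : ℝ := (r * τ.re - Real.log ‖μ₂‖) / τ.im with hi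
  set k : ℂ := ⟨r, i⟩ with hk
  have hk1 : ‖Complex.exp (-k)‖ * ‖μ₁‖ = 1 := by
    rw [Complex.norm_exp, ← Real.exp_log (norm_pos_iff.2 h1), ← Real.exp_add]
    simp [hk, r]
  have hk2 : ‖Complex.exp (-(k * τ))‖ * ‖μ₂‖ = 1 := by
    rw [Complex.norm_exp, ← Real.exp_log (norm_pos_iff.2 h2), ← Real.exp_add]
    have : (-(k * τ)).re + Real.log ‖μ₂‖ = 0 := by
      simp only [Complex.neg_re, Complex.mul_re, hk, hi]
      field_simp
      ring
    rw [this, Real.exp_zero]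
  set G : ℂ → ℂ := fun x => g x * Complex.exp (-(k * x)) with hG
  have hGd : Differentiable ℂ G := by fun_prop
  have hG1 : ∀ x, G (x + 1) = (Complex.exp (-k) * μ₁) * G x := fun x => by
    simp only [hG, hg1]
    rw [show -(k * (x + 1)) = -k + -(k * x) by ring, Complex.exp_add]; ring
  have hG2 : ∀ x, G (x + τ) = (Complex.exp (-(k * τ)) * μ₂) * G x := fun x => by
    simp only [hG, hg2]
    rw [show -(k * (x + τ)) = -(k * τ) + -(k * x) by ring, Complex.exp_add]; ring
  have hGn : ∀ (m n : ℤ) (x : ℂ), ‖G (x + (m + n * τ))‖ = ‖G x‖ := fun m n x => by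
    have e1 := mul_add_zsmul_of_mul_add (mul_ne_zero (Complex.exp_ne_zero _) h2) hG2 n (x + m * 1)
    have e2 := mul_add_zsmul_of_mul_add (mul_ne_zero (Complex.exp_ne_zero _) h1) hG1 m x
    rw [show x + (m + n * τ) = x + m * 1 + n * τ by ring, e1, e2, norm_mul, norm_mul, norm_zpow,
      norm_zpow, norm_mul, norm_mul, hk1, hk2]
    simp
  have hb : Bornology.IsBounded (Set.range G) := by
    have hc : IsCompact ((fun p : ℝ × ℝ => G (p.1 + p.2 * τ)) ''
        (Set.Icc (0 : ℝ) 1 ×ˢ Set.Icc (0 : ℝ) 1)) := by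
      refine (isCompact_Icc.prod isCompact_Icc).image ?_
      have := hGd.continuous
      fun_prop
    obtain ⟨R, hR⟩ := hc.isBounded.exists_norm_le
    refine isBounded_iff_forall_norm_le.2 ⟨R, ?_⟩
    rintro _ ⟨x, rfl⟩
    obtain ⟨m, n, s, hs, t, ht, hx⟩ := exists_lattice_translate hτ x
    rw [hx, hGn]
    exact hR _ ⟨(s, t), ⟨hs, ht⟩, rfl⟩
  refine ⟨G 0, k, fun x => ?_⟩
  rw [← hGd.apply_eq_apply_of_bounded hb x 0]
  simp only [hG]
  rw [mul_assoc, ← Complex.exp_add]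
  simp

/-! ### The exponential `e` -/

theorem e_ne_zero (s : ℂ) : e s ≠ 0 := Complex.exp_ne_zero _

theorem e_add (s t : ℂ) : e (s + t) = e s * e t := by
  rw [e, e, e, ← Complex.exp_add, mul_add]

theorem e_neg (s : ℂ) : e (-s) = (e s)⁻¹ := by
  rw [e, e, ← Complex.exp_neg, mul_neg]

theorem e_sub (s t : ℂ) : e (s - t) = e s / e t := by
  rw [sub_eq_add_neg, e_add, e_neg, div_eq_mul_inv]

@[simp] theorem e_zero : e 0 = 1 := by simp [e]

@[simp] theorem e_one : e 1 = -1 := by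
  rw [e, mul_one, mul_comm, Complex.exp_pi_mul_I]

@[simp] theorem e_two : e 2 = 1 := by
  rw [show (2 : ℂ) = 1 + 1 by norm_num, e_add, e_one]; norm_num

theorem e_int_mul (n : ℤ) (s : ℂ) : e (n * s) = e s ^ n := by
  rw [e, e, ← Complex.exp_int_mul]; ring_nf

theorem e_nat_mul (n : ℕ) (s : ℂ) : e (n * s) = e s ^ n := by
  exact_mod_cast e_int_mul n s

theorem e_mul_int (s : ℂ) (n : ℤ) : e (s * n) = e s ^ n := by rw [mul_comm, e_int_mul]

theorem e_two_mul (s : ℂ) : e (2 * s) = e s ^ 2 := e_nat_mul 2 s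

theorem e_two_mul_int (n : ℤ) : e (2 * n) = 1 := by rw [e_mul_int, e_two, one_zpow]

theorem e_eq_one_iff (s : ℂ) : e s = 1 ↔ ∃ n : ℤ, s = 2 * n := by
  rw [e, Complex.exp_eq_one_iff]
  refine exists_congr fun n => ?_
  have : (Real.pi : ℂ) ≠ 0 := by exact_mod_cast Real.pi_ne_zero
  constructor
  · intro h
    have h' : Complex.I * Real.pi * (s - 2 * n) = 0 := by linear_combination h
    simpa [this, sub_eq_zero] using h'
  · rintro rfl; ring

theorem e_eq_e_iff (s t : ℂ) : e s = e t ↔ ∃ n : ℤ, s = t + 2 * n := by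
  rw [← div_eq_one_iff_eq (e_ne_zero t), ← e_sub, e_eq_one_iff]
  simp only [sub_eq_iff_eq_add']

theorem norm_e_lt_one {s : ℂ} (hs : 0 < s.im) : ‖e s‖ < 1 := by
  rw [e, Complex.norm_exp, Real.exp_lt_one_iff]
  have : (Complex.I * Real.pi * s).re = -(Real.pi * s.im) := by simp
  rw [this]
  have := mul_pos Real.pi_pos hs
  linarith

theorem norm_e_two_mul_lt_one {s : ℂ} (hs : 0 < s.im) : ‖e (2 * s)‖ < 1 :=
  norm_e_lt_one (by simpa using hs)

theorem differentiable_e : Differentiable ℂ e := by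
  unfold e; fun_prop

@[fun_prop]
theorem Differentiable.e_comp {f : ℂ → ℂ} (hf : Differentiable ℂ f) :
    Differentiable ℂ fun x => e (f x) := differentiable_e.comp hf

@[fun_prop]
theorem Continuous.e_comp {X : Type*} [TopologicalSpace X] {f : X → ℂ} (hf : Continuous f) :
    Continuous fun x => e (f x) := differentiable_e.continuous.comp hf

/-! ### The theta function with characteristics -/

theorem theta_eq_jacobiTheta₂ (γ₁ γ₂ ξ τ : ℂ) :
    theta γ₁ γ₂ ξ τ = e (γ₁ ^ 2 * τ + 2 * γ₁ * (ξ + γ₂)) * jacobiTheta₂ (ξ + γ₂ + γ₁ * τ) τ := by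
  rw [theta, jacobiTheta₂, ← tsum_mul_left]
  refine tsum_congr fun m => ?_
  rw [jacobiTheta₂_term, e, ← Complex.exp_add]
  ring_nf

theorem theta_add_int_left (γ₁ γ₂ ξ τ : ℂ) (n : ℤ) :
    theta (γ₁ + n) γ₂ ξ τ = theta γ₁ γ₂ ξ τ := by
  rw [theta, theta]
  conv_rhs => rw [← (Equiv.addRight n).tsum_eq]
  refine tsum_congr fun m => ?_
  simp only [Equiv.coe_addRight, Int.cast_add]
  ring_nf

theorem theta_add_int_right (γ₁ γ₂ ξ τ : ℂ) (n : ℤ) :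
    theta γ₁ (γ₂ + n) ξ τ = e (2 * γ₁ * n) * theta γ₁ γ₂ ξ τ := by
  rw [theta, theta, ← tsum_mul_left]
  refine tsum_congr fun m => ?_
  have : e (2 * γ₁ * n) = e (2 * γ₁ * n + 2 * ((m * n : ℤ) : ℂ)) := by
    rw [e_add, e_two_mul_int, mul_one]
  rw [this, e, ← Complex.exp_add]
  push_cast
  ring_nf

/-- Completing the square trades a shift of the characteristics for a translation of the argument.
All coefficients of the `R`-matrix thereby become values of the single odd function `th`. -/
theorem theta_add_char (γ₁ γ₂ a b ξ τ : ℂ) :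
    theta (γ₁ + a) (γ₂ + b) ξ τ =
      e (a ^ 2 * τ + 2 * a * (ξ + γ₂ + b)) * theta γ₁ γ₂ (ξ + (a * τ + b)) τ := by
  rw [theta, theta, ← tsum_mul_left]
  refine tsum_congr fun m => ?_
  rw [e, ← Complex.exp_add]
  ring_nf

/-! ### The odd theta function -/

/-- The odd Jacobi theta function. -/
def th (τ x : ℂ) : ℂ := theta (1 / 2) (1 / 2) x τ

/-- An integer shift of the characteristics is computed twice, as a reindexing of the series and as
a translation of the argument; comparing the two results gives the multiplier. -/
theorem th_add_lattice (τ x : ℂ) (m n : ℤ) :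
    th τ (x + (n * τ + m)) = e (-(n ^ 2 * τ + 2 * n * x) + m + n) * th τ x := by
  have h1 := theta_add_char (1 / 2) (1 / 2) n m x τ
  rw [theta_add_int_left, theta_add_int_right] at h1
  have h2 : e (-(n ^ 2 * τ + 2 * n * (x + 1 / 2 + m))) * e (n ^ 2 * τ + 2 * n * (x + 1 / 2 + m))
      = 1 := by rw [← e_add, neg_add_cancel, e_zero]
  have h3 : e (-(n ^ 2 * τ + 2 * n * x) + m + n)
      = e (-(n ^ 2 * τ + 2 * n * (x + 1 / 2 + m))) * e (2 * (1 / 2) * m) := by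
    rw [← e_add, e_eq_e_iff]
    exact ⟨n + n * m, by push_cast; ring⟩
  rw [th, th, h3, mul_assoc, h1, ← mul_assoc, h2, one_mul]

theorem th_add_one (τ x : ℂ) : th τ (x + 1) = -th τ x := by
  simpa using th_add_lattice τ x 1 0

theorem th_add_tau (τ x : ℂ) : th τ (x + τ) = -e (-(τ + 2 * x)) * th τ x := by
  have := th_add_lattice τ x 0 1
  simpa [e_add] using this

theorem th_neg (τ x : ℂ) : th τ (-x) = -th τ x := by
  rw [th, th, theta_eq_jacobiTheta₂, theta_eq_jacobiTheta₂, ← jacobiTheta₂_neg_left (-x + _ + _),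
    show x + 1 / 2 + 1 / 2 * τ = (-(-x + 1 / 2 + 1 / 2 * τ) + τ) + 1 by ring,
    jacobiTheta₂_add_left, jacobiTheta₂_add_left', ← mul_assoc, ← neg_mul]
  congr 1
  rw [show Complex.exp (-Real.pi * Complex.I * (τ + 2 * -(-x + 1 / 2 + 1 / 2 * τ)))
      = e (-(τ + 2 * -(-x + 1 / 2 + 1 / 2 * τ))) by rw [e]; congr 1; ring,
    ← e_add, ← neg_one_mul (e _), ← e_one, ← e_add, e_eq_e_iff]
  exact ⟨-1, by push_cast; ring⟩

theorem th_zero (τ : ℂ) : th τ 0 = 0 := by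
  have h := th_neg τ 0
  rw [neg_zero] at h
  exact self_eq_neg.1 h

theorem differentiable_th {τ : ℂ} (hτ : 0 < τ.im) : Differentiable ℂ (th τ) := by
  have : th τ = fun x => e ((1 / 2) ^ 2 * τ + 2 * (1 / 2) * (x + 1 / 2)) *
      jacobiTheta₂ (x + 1 / 2 + 1 / 2 * τ) τ := by
    ext x; rw [th, theta_eq_jacobiTheta₂]
  rw [this]
  have hj : Differentiable ℂ fun z => jacobiTheta₂ z τ :=
    fun z => differentiableAt_jacobiTheta₂_fst z hτ
  have hj' : Differentiable ℂ fun x => jacobiTheta₂ (x + 1 / 2 + 1 / 2 * τ) τ :=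
    hj.comp (by fun_prop)
  fun_prop

/-- The integral over [0, 1] is the constant Fourier coefficient, which equals 1: integrating the
series term by term kills every term except `n = 0`. -/
theorem exists_jacobiTheta₂_ne_zero {τ : ℂ} (hτ : 0 < τ.im) : ∃ z, jacobiTheta₂ z τ ≠ 0 := by
  by_contra! h
  have key := intervalIntegral.hasSum_intervalIntegral_of_summable_norm (a := 0) (b := 1) (ι := ℤ)
    (f := fun n => ⟨fun x : ℝ => jacobiTheta₂_term n x τ, by
      unfold jacobiTheta₂_term; fun_prop⟩) (by
      have hs := (summable_jacobiTheta₂_term_iff 0 τ).2 hτ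
      refine (summable_norm_iff.2 hs).of_nonneg_of_le (fun _ => norm_nonneg _) fun n => ?_
      refine (ContinuousMap.norm_le _ (norm_nonneg _)).2 fun x => ?_
      simp [norm_jacobiTheta₂_term])
  simp only [ContinuousMap.coe_mk] at key
  have h0 : (fun x : ℝ => ∑' n : ℤ, jacobiTheta₂_term n x τ) = fun _ => 0 := by
    ext x; exact h x
  rw [h0, intervalIntegral.integral_zero] at key
  have hn : ∀ n : ℤ, n ≠ 0 → ∫ x : ℝ in (0 : ℝ)..1, jacobiTheta₂_term n x τ = 0 := by
    intro n hn
    have hc : (2 * Real.pi * Complex.I * n : ℂ) ≠ 0 := by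
      simp [hn, Real.pi_ne_zero]
    have : ∀ x : ℝ, jacobiTheta₂_term n x τ =
        Complex.exp (Real.pi * Complex.I * n ^ 2 * τ) *
          Complex.exp (2 * Real.pi * Complex.I * n * x) := fun x => by
      rw [jacobiTheta₂_term, ← Complex.exp_add]; ring_nf
    simp_rw [this]
    rw [intervalIntegral.integral_const_mul, integral_exp_mul_complex hc]
    have : Complex.exp (2 * Real.pi * Complex.I * n * (1 : ℝ)) = 1 :=
      Complex.exp_eq_one_iff.2 ⟨n, by push_cast; ring⟩
    rw [this]
    simp
  have h1 := key.unique (hasSum_single 0 hn)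
  simp [jacobiTheta₂_term] at h1

theorem exists_th_ne_zero {τ : ℂ} (hτ : 0 < τ.im) : ∃ x, th τ x ≠ 0 := by
  obtain ⟨z, hz⟩ := exists_jacobiTheta₂_ne_zero hτ
  refine ⟨z - 1 / 2 - 1 / 2 * τ, ?_⟩
  rw [th, theta_eq_jacobiTheta₂]
  refine mul_ne_zero (e_ne_zero _) ?_
  convert hz using 2
  ring

/-! ### The product formula -/

/-- The product form of the odd theta function. -/
def thProd (τ x : ℂ) : ℂ := e (-x) * Theta (e (2 * τ)) (e (2 * x))

theorem thProd_add_one (τ x : ℂ) : thProd τ (x + 1) = -thProd τ x := by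
  rw [thProd, thProd, mul_add, e_add, neg_add, e_add]
  simp [e_neg]

theorem thProd_add_tau {τ : ℂ} (hτ : 0 < τ.im) (x : ℂ) :
    thProd τ (x + τ) = -e (-(τ + 2 * x)) * thProd τ x := by
  rw [thProd, thProd, mul_add, e_add, mul_comm (e (2 * x)), Theta_mul_self
    (norm_e_two_mul_lt_one hτ) (e_ne_zero _) (e_ne_zero _), ← e_neg]
  rw [show -(x + τ) = -x + -τ by ring, show -(τ + 2 * x) = -τ + -(2 * x) by ring, e_add, e_add]
  ring

theorem differentiable_thProd {τ : ℂ} (hτ : 0 < τ.im) : Differentiable ℂ (thProd τ) := by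
  have hd := differentiable_poch (norm_e_two_mul_lt_one hτ)
  have h1 : Differentiable ℂ fun x => poch (e (2 * x)) (e (2 * τ)) :=
    hd.comp (g := fun y => poch y (e (2 * τ))) (f := fun x => e (2 * x)) (by fun_prop)
  have h2 : Differentiable ℂ fun x => poch (e (2 * τ) * (e (2 * x))⁻¹) (e (2 * τ)) := by
    simp_rw [← e_neg]
    exact hd.comp (g := fun y => poch y (e (2 * τ)))
      (f := fun x => e (2 * τ) * e (-(2 * x))) (by fun_prop)
  unfold thProd Theta
  fun_prop

theorem thProd_ne_zero {τ : ℂ} (hτ : 0 < τ.im) {x : ℂ} (hx : ∀ m n : ℤ, x ≠ n * τ + m) :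
    thProd τ x ≠ 0 := by
  refine mul_ne_zero (e_ne_zero _) (Theta_ne_zero (norm_e_two_mul_lt_one hτ) (e_ne_zero _)
    (e_ne_zero _) fun n hn => ?_)
  rw [← e_int_mul, e_eq_e_iff] at hn
  obtain ⟨m, hm⟩ := hn
  refine hx m n ?_
  linear_combination hm / 2

/-- The factor `1 - e (2 * x)` of the product has a simple zero at the origin, and the remaining
factor `H` does not vanish there. -/
theorem hasDerivAt_thProd_zero {τ : ℂ} (hτ : 0 < τ.im) :
    thProd τ 0 = 0 ∧ deriv (thProd τ) 0 ≠ 0 := by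
  have hp := norm_e_two_mul_lt_one hτ
  have hd := differentiable_poch hp
  set H : ℂ → ℂ := fun x => e (-x) * (poch (e (2 * x) * e (2 * τ)) (e (2 * τ)) *
    poch (e (2 * τ) * e (-(2 * x))) (e (2 * τ)) * poch (e (2 * τ)) (e (2 * τ))) with hH
  have heq : thProd τ = fun x => (1 - e (2 * x)) * H x := by
    ext x
    rw [thProd, Theta, poch_eq _ hp, ← e_neg]; ring
  have hHd : Differentiable ℂ H := by
    have h1 : Differentiable ℂ fun x => poch (e (2 * x) * e (2 * τ)) (e (2 * τ)) :=
      hd.comp (g := fun y => poch y (e (2 * τ)))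
        (f := fun x => e (2 * x) * e (2 * τ)) (by fun_prop)
    have h2 : Differentiable ℂ fun x => poch (e (2 * τ) * e (-(2 * x))) (e (2 * τ)) :=
      hd.comp (g := fun y => poch y (e (2 * τ)))
        (f := fun x => e (2 * τ) * e (-(2 * x))) (by fun_prop)
    fun_prop
  have hpp : poch (e (2 * τ)) (e (2 * τ)) ≠ 0 := poch_ne_zero hp fun n hn => by
    have : ‖e (2 * τ) * e (2 * τ) ^ n‖ = 1 := by rw [hn]; simp
    rw [← pow_succ', norm_pow] at this
    exact absurd this (pow_lt_one₀ (norm_nonneg _) hp (by simp)).ne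
  have hH0 : H 0 ≠ 0 := by simp [hH, hpp]
  have he : HasDerivAt (fun x => 1 - e (2 * x)) (-(2 * (Complex.I * Real.pi))) 0 := by
    have h1 : HasDerivAt (fun x : ℂ => Complex.I * Real.pi * (2 * x))
        (Complex.I * Real.pi * (2 * 1)) 0 := ((hasDerivAt_id (0 : ℂ)).const_mul 2).const_mul _
    refine ((h1.cexp).const_sub 1).congr_deriv ?_
    rw [mul_zero, mul_zero, Complex.exp_zero]; ring
  have := he.mul (hHd 0).hasDerivAt
  refine ⟨by simp [heq], ?_⟩
  rw [heq]
  change deriv ((fun x => 1 - e (2 * x)) * H) 0 ≠ 0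
  rw [this.deriv]
  simp [hH0, Real.pi_ne_zero]

/-- At a zero of `f` the product rule loses the term with `c'`, so simplicity of a zero is carried
along a quasi-period. -/
theorem deriv_ne_zero_of_translate {f : ℂ → ℂ} (hf : Differentiable ℂ f) {c : ℂ → ℂ}
    (hc : Differentiable ℂ c) {w : ℂ} (h : ∀ x, f (x + w) = c x * f x) {a : ℂ} (ha : f a = 0)
    (hca : c a ≠ 0) : deriv f (a + w) ≠ 0 ↔ deriv f a ≠ 0 := by
  have h1 : deriv (fun x => f (x + w)) a = deriv f (a + w) := deriv_comp_add_const f w a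
  rw [← h1, funext h]
  change deriv (c * f) a ≠ 0 ↔ _
  rw [((hc a).hasDerivAt.mul (hf a).hasDerivAt).deriv, ha]
  simp [hca]

theorem lattice_induction {τ : ℂ} {P : ℂ → Prop} (h0 : P 0) (h1 : ∀ a, P (a + 1) ↔ P a)
    (h2 : ∀ a, P (a + τ) ↔ P a) (m n : ℤ) : P (n * τ + m) := by
  induction m using Int.induction_on with
  | zero =>
    induction n using Int.induction_on with
    | zero => simpa using h0
    | succ n ih =>
      rw [← h2] at ih
      convert ih using 1; push_cast; ring
    | pred n ih =>
      rw [← h2]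
      convert ih using 1; push_cast; ring
  | succ m ih =>
    rw [← h1] at ih
    convert ih using 1; push_cast; ring
  | pred m ih =>
    rw [← h1]
    convert ih using 1; push_cast; ring

theorem thProd_lattice {τ : ℂ} (hτ : 0 < τ.im) (m n : ℤ) :
    thProd τ (n * τ + m) = 0 ∧ deriv (thProd τ) (n * τ + m) ≠ 0 := by
  have hd := differentiable_thProd hτ
  have h_one : ∀ a, (thProd τ (a + 1) = 0 ∧ deriv (thProd τ) (a + 1) ≠ 0) ↔
      (thProd τ a = 0 ∧ deriv (thProd τ) a ≠ 0) := fun a => by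
    have e1 : thProd τ (a + 1) = 0 ↔ thProd τ a = 0 := by rw [thProd_add_one, neg_eq_zero]
    rw [e1]
    refine and_congr_right fun h => deriv_ne_zero_of_translate hd (c := fun _ => -1) (by fun_prop)
      (fun x => by rw [thProd_add_one]; ring) h (by simp)
  have h_tau : ∀ a, (thProd τ (a + τ) = 0 ∧ deriv (thProd τ) (a + τ) ≠ 0) ↔
      (thProd τ a = 0 ∧ deriv (thProd τ) a ≠ 0) := fun a => by
    have e1 : thProd τ (a + τ) = 0 ↔ thProd τ a = 0 := by
      rw [thProd_add_tau hτ]; simp [e_ne_zero]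
    rw [e1]
    refine and_congr_right fun h => deriv_ne_zero_of_translate hd
      (c := fun x => -e (-(τ + 2 * x))) (by fun_prop)
      (fun x => thProd_add_tau hτ x) h (by simp [e_ne_zero])
  exact lattice_induction (P := fun a => thProd τ a = 0 ∧ deriv (thProd τ) a ≠ 0)
    (hasDerivAt_thProd_zero hτ) h_one h_tau m n

theorem thProd_eq_zero_iff {τ : ℂ} (hτ : 0 < τ.im) (x : ℂ) :
    thProd τ x = 0 ↔ ∃ m n : ℤ, x = n * τ + m := by
  constructor
  · intro h
    by_contra! h'
    exact thProd_ne_zero hτ h' h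
  · rintro ⟨m, n, rfl⟩
    exact (thProd_lattice hτ m n).1

theorem th_lattice (τ : ℂ) (m n : ℤ) : th τ (n * τ + m) = 0 := by
  have := th_add_lattice τ 0 m n
  rwa [th_zero, mul_zero, zero_add] at this

/-! ### Multipliers of quotients, and the zeros of the theta series. -/

theorem eq_of_dense_ne {f g D : ℂ → ℂ} (hf : Continuous f) (hg : Continuous g)
    (hD : Dense {x | D x ≠ 0}) (h : ∀ x, D x ≠ 0 → f x = g x) : f = g :=
  hf.ext_on hD hg fun x hx => h x hx

/-- Away from the zeros of `D` the common multiplier `c` cancels. Density and continuity extend the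
resulting equation to the remaining points. -/
theorem quotient_multiplier {f g D c μ : ℂ → ℂ} (hg : Continuous g) (hμ : Continuous μ)
    (hD : Dense {x | D x ≠ 0}) (hf : ∀ x, f x = g x * D x) {w : ℂ} (hc : ∀ x, c x ≠ 0)
    (hfw : ∀ x, f (x + w) = μ x * c x * f x) (hDw : ∀ x, D (x + w) = c x * D x) (x : ℂ) :
    g (x + w) = μ x * g x := by
  refine congrFun (eq_of_dense_ne (f := fun x => g (x + w)) (g := fun x => μ x * g x)
    (by fun_prop) (by fun_prop) hD fun x hx => ?_) x
  have := hfw x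
  rw [hf, hf, hDw] at this
  exact mul_right_cancel₀ (mul_ne_zero (hc x) hx) (by linear_combination this)

theorem countable_zeros_thProd {τ : ℂ} (hτ : 0 < τ.im) : {x | thProd τ x = 0}.Countable := by
  refine (Set.countable_range fun p : ℤ × ℤ => (p.1 * τ + p.2 : ℂ)).mono fun x hx => ?_
  obtain ⟨m, n, h⟩ := (thProd_eq_zero_iff hτ x).1 hx
  exact ⟨(n, m), h.symm⟩

/-- The Jacobi triple product, up to the constant. -/
theorem exists_th_eq_thProd {τ : ℂ} (hτ : 0 < τ.im) :
    ∃ C : ℂ, C ≠ 0 ∧ ∀ x, th τ x = C * thProd τ x := by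
  have hd := differentiable_thProd hτ
  obtain ⟨g, hg, hgx⟩ := exists_entire_quotient (differentiable_th hτ) hd (fun a ha => by
    obtain ⟨m, n, rfl⟩ := (thProd_eq_zero_iff hτ a).1 ha
    exact ⟨(thProd_lattice hτ m n).2, th_lattice τ m n⟩)
  have hdense : Dense {x | thProd τ x ≠ 0} :=
    (countable_zeros_thProd hτ).dense_compl ℝ
  have hc := hg.continuous
  have h1 : ∀ x, g (x + 1) = 1 * g x := quotient_multiplier hc (μ := fun _ => 1) (c := fun _ => -1)
    continuous_const hdense hgx (by simp) (fun x => by rw [th_add_one]; ring)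
    (fun x => by rw [thProd_add_one]; ring)
  have h2 : ∀ x, g (x + τ) = 1 * g x := quotient_multiplier hc (μ := fun _ => 1)
    (c := fun x => -e (-(τ + 2 * x)))
    continuous_const hdense hgx (by simp [e_ne_zero]) (fun x => by rw [th_add_tau]; ring)
    (fun x => thProd_add_tau hτ x)
  obtain ⟨C, k, hk⟩ := eq_exp_of_quasiperiodic hτ hg one_ne_zero one_ne_zero
    h1 h2
  have hC : C ≠ 0 := by
    rintro rfl
    obtain ⟨x, hx⟩ := exists_th_ne_zero hτ
    exact hx (by rw [hgx, hk]; simp)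
  have hk1 : Complex.exp k = 1 := by
    have := h1 0
    simpa [hk, hC] using this
  have hk2 : Complex.exp (k * τ) = 1 := by
    have := h2 0
    simpa [hk, hC] using this
  obtain ⟨n, hn⟩ := Complex.exp_eq_one_iff.1 hk1
  obtain ⟨m, hm⟩ := Complex.exp_eq_one_iff.1 hk2
  -- Both `k` and `k * τ` lie in `2πiℤ`; as `τ` is not real, this forces `k = 0`.
  have hk0 : k = 0 := by
    have h3 : (2 * Real.pi * Complex.I) ≠ (0 : ℂ) := Complex.two_pi_I_ne_zero
    have h4 : (n : ℂ) * τ = m := by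
      rw [hn] at hm
      exact mul_right_cancel₀ h3 (by linear_combination hm)
    have h5 := congrArg Complex.im h4
    simp [hτ.ne'] at h5
    rw [hn, h5]; simp
  exact ⟨C, hC, fun x => by rw [hgx, hk, hk0]; simp⟩

/-- The series shows directly only that the lattice points are zeros; that there are no others is
visible on the product. -/
theorem th_eq_zero_iff {τ : ℂ} (hτ : 0 < τ.im) (x : ℂ) :
    th τ x = 0 ↔ ∃ m n : ℤ, x = n * τ + m := by
  obtain ⟨C, hC, h⟩ := exists_th_eq_thProd hτ
  rw [h, mul_eq_zero, or_iff_right hC, thProd_eq_zero_iff hτ]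

theorem deriv_th_ne_zero {τ : ℂ} (hτ : 0 < τ.im) {a : ℂ} (ha : th τ a = 0) :
    deriv (th τ) a ≠ 0 := by
  obtain ⟨C, hC, h⟩ := exists_th_eq_thProd hτ
  obtain ⟨m, n, rfl⟩ := (th_eq_zero_iff hτ a).1 ha
  rw [funext h, deriv_const_mul _ (differentiable_thProd hτ _)]
  exact mul_ne_zero hC (thProd_lattice hτ m n).2

/-! ### The three-term identity -/

/-- This is the identity theorem: an entire function vanishing on a nonempty open set is zero. -/
theorem dense_ne_zero {f : ℂ → ℂ} (hf : Differentiable ℂ f) (h : ∃ x, f x ≠ 0) :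
    Dense {x | f x ≠ 0} := by
  obtain ⟨x₀, hx₀⟩ := h
  intro a
  rw [mem_closure_iff_frequently]
  intro hfreq
  simp only [Set.mem_ofPred_eq, not_not] at hfreq
  have ha : AnalyticOnNhd ℂ f Set.univ := fun x _ => hf.analyticAt x
  have := ha.eq_of_eventuallyEq (g := fun _ => 0) (fun x _ => analyticAt_const) (z₀ := a) hfreq
  exact hx₀ (congrFun this x₀)

theorem dense_th_ne_zero {τ : ℂ} (hτ : 0 < τ.im) : Dense {x | th τ x ≠ 0} :=
  dense_ne_zero (differentiable_th hτ) (exists_th_ne_zero hτ)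

theorem dense_th_add_ne_zero {τ : ℂ} (hτ : 0 < τ.im) (c : ℂ) : Dense {x | th τ (x + c) ≠ 0} := by
  have := differentiable_th hτ
  refine dense_ne_zero (by fun_prop) ?_
  obtain ⟨x, hx⟩ := exists_th_ne_zero hτ
  exact ⟨x - c, by simpa using hx⟩

theorem dense_th_mul_ne_zero {τ : ℂ} (hτ : 0 < τ.im) {c : ℂ} (hc : c ≠ 0) :
    Dense {x | th τ (c * x) ≠ 0} := by
  have := differentiable_th hτ
  refine dense_ne_zero (by fun_prop) ?_
  obtain ⟨x, hx⟩ := exists_th_ne_zero hτ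
  exact ⟨c⁻¹ * x, by rwa [mul_inv_cancel_left₀ hc]⟩

theorem th_mul_th_add_lattice (τ x c : ℂ) (m n : ℤ) :
    th τ (x + (n * τ + m) + c) * th τ (x + (n * τ + m) - c) =
      e (-(2 * n ^ 2 * τ + 4 * n * x)) * (th τ (x + c) * th τ (x - c)) := by
  rw [show x + (n * τ + m) + c = (x + c) + (n * τ + m) by ring,
    show x + (n * τ + m) - c = (x - c) + (n * τ + m) by ring, th_add_lattice, th_add_lattice]
  have : e (-(2 * n ^ 2 * τ + 4 * n * x)) = e (-(n ^ 2 * τ + 2 * n * (x + c)) + m + n) *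
      e (-(n ^ 2 * τ + 2 * n * (x - c)) + m + n) := by
    rw [← e_add, e_eq_e_iff]
    exact ⟨-m - n, by push_cast; ring⟩
  rw [this]; ring

/-- As a function of `x`, the left side `f` has the same lattice multipliers as `D x = th τ (x + y)
* th τ (x - y)`, and it vanishes at `y` and `-y`, hence at all zeros of `D`. These are simple
because `th τ (2 * y) ≠ 0`. So `f / D` is an exponential, and it is zero because `f z = 0` while `D
z ≠ 0`. -/
theorem th_three_term_of_ne {τ : ℂ} (hτ : 0 < τ.im) (x y w z : ℂ) (hy : th τ (2 * y) ≠ 0)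
    (hz : th τ (z + y) ≠ 0) (hz' : th τ (z - y) ≠ 0) :
    th τ (x + z) * th τ (x - z) * (th τ (y + w) * th τ (y - w))
      - th τ (x + w) * th τ (x - w) * (th τ (y + z) * th τ (y - z))
      - th τ (x + y) * th τ (x - y) * (th τ (z + w) * th τ (z - w)) = 0 := by
  have hth := differentiable_th hτ
  set f : ℂ → ℂ := fun x => th τ (x + z) * th τ (x - z) * (th τ (y + w) * th τ (y - w))
      - th τ (x + w) * th τ (x - w) * (th τ (y + z) * th τ (y - z))
      - th τ (x + y) * th τ (x - y) * (th τ (z + w) * th τ (z - w)) with hf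
  set D : ℂ → ℂ := fun x => th τ (x + y) * th τ (x - y) with hD
  have hfd : Differentiable ℂ f := by fun_prop
  have hDd : Differentiable ℂ D := by fun_prop
  have hfl : ∀ (m n : ℤ) x, f (x + (n * τ + m)) = e (-(2 * n ^ 2 * τ + 4 * n * x)) * f x :=
    fun m n x => by simp only [hf, th_mul_th_add_lattice]; ring
  have hDl : ∀ (m n : ℤ) x, D (x + (n * τ + m)) = e (-(2 * n ^ 2 * τ + 4 * n * x)) * D x :=
    fun m n x => by simp only [hD, th_mul_th_add_lattice]
  have hfy : f y = 0 := by
    simp only [hf, sub_self, th_zero]; ring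
  have hfy' : f (-y) = 0 := by
    have e1 : th τ (-y + z) = -th τ (y - z) := by rw [← th_neg]; ring_nf
    have e2 : th τ (-y - z) = -th τ (y + z) := by rw [← th_neg]; ring_nf
    have e3 : th τ (-y + w) = -th τ (y - w) := by rw [← th_neg]; ring_nf
    have e4 : th τ (-y - w) = -th τ (y + w) := by rw [← th_neg]; ring_nf
    simp only [hf, neg_add_cancel, th_zero, e1, e2, e3, e4]; ring
  have hDz : D z ≠ 0 := mul_ne_zero hz hz'
  obtain ⟨g, hg, hgf⟩ := exists_entire_quotient hfd hDd (fun a ha => by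
    have hder : deriv D a = deriv (th τ) (a + y) * th τ (a - y)
        + th τ (a + y) * deriv (th τ) (a - y) := by
      have h1 : HasDerivAt (fun x => th τ (x + y)) (deriv (th τ) (a + y)) a :=
        (hth (a + y)).hasDerivAt.comp_add_const a y
      have h2 : HasDerivAt (fun x => th τ (x - y)) (deriv (th τ) (a - y)) a :=
        (hth (a - y)).hasDerivAt.comp_sub_const a y
      exact (h1.mul h2).deriv
    rcases mul_eq_zero.1 ha with h | h
    · obtain ⟨m, n, hmn⟩ := (th_eq_zero_iff hτ _).1 h
      have ha' : a = -y + (n * τ + m) := by linear_combination hmn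
      refine ⟨?_, by rw [ha', hfl, hfy', mul_zero]⟩
      rw [hder, h, zero_mul, add_zero]
      refine mul_ne_zero (deriv_th_ne_zero hτ h) ?_
      rw [ha', show -y + (n * τ + m) - y = -(2 * y) + (n * τ + m) by ring, th_add_lattice, th_neg]
      exact mul_ne_zero (e_ne_zero _) (neg_ne_zero.2 hy)
    · obtain ⟨m, n, hmn⟩ := (th_eq_zero_iff hτ _).1 h
      have ha' : a = y + (n * τ + m) := by linear_combination hmn
      refine ⟨?_, by rw [ha', hfl, hfy, mul_zero]⟩
      rw [hder, h, mul_zero, zero_add]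
      refine mul_ne_zero ?_ (deriv_th_ne_zero hτ h)
      rw [ha', show y + (n * τ + m) + y = (2 * y) + (n * τ + m) by ring, th_add_lattice]
      exact mul_ne_zero (e_ne_zero _) hy)
  have hdense := dense_ne_zero hDd ⟨z, hDz⟩
  have hq : ∀ (m n : ℤ) x, g (x + (n * τ + m)) = 1 * g x := fun m n =>
    quotient_multiplier hg.continuous (μ := fun _ => 1) continuous_const hdense hgf
      (fun _ => e_ne_zero _) (fun x => by rw [hfl, one_mul]) (hDl m n)
  obtain ⟨C, k, hk⟩ := eq_exp_of_quasiperiodic hτ hg one_ne_zero one_ne_zero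
    (fun x => by simpa using hq 1 0 x) (fun x => by simpa using hq 0 1 x)
  have hfz : f z = 0 := by
    have e1 : th τ (z - y) = -th τ (y - z) := by rw [← th_neg]; ring_nf
    simp only [hf, sub_self, th_zero, e1, add_comm z y]; ring
  have hC : C = 0 := by
    have := hgf z
    rw [hfz, hk] at this
    simpa [hDz] using this
  change f x = 0
  rw [hgf, hk, hC]; simp

/-- The Weierstrass three-term identity. -/
theorem th_three_term {τ : ℂ} (hτ : 0 < τ.im) (x y w z : ℂ) :
    th τ (x + z) * th τ (x - z) * (th τ (y + w) * th τ (y - w))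
      - th τ (x + w) * th τ (x - w) * (th τ (y + z) * th τ (y - z))
      - th τ (x + y) * th τ (x - y) * (th τ (z + w) * th τ (z - w)) = 0 := by
  have hth := (differentiable_th hτ).continuous
  -- The nonvanishing conditions are removed by density, first in `z` for a fixed admissible `y`,
  -- and then in `y`.
  have h1 : ∀ y, th τ (2 * y) ≠ 0 → ∀ z,
      th τ (x + z) * th τ (x - z) * (th τ (y + w) * th τ (y - w))
      - th τ (x + w) * th τ (x - w) * (th τ (y + z) * th τ (y - z))
      - th τ (x + y) * th τ (x - y) * (th τ (z + w) * th τ (z - w)) = 0 := fun y hy z => by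
    have hd : Dense ({z | th τ (z + y) ≠ 0} ∩ {z | th τ (z + -y) ≠ 0}) :=
      (dense_th_add_ne_zero hτ y).inter_of_isOpen_left (dense_th_add_ne_zero hτ (-y))
        (isOpen_ne_fun (by fun_prop) continuous_const)
    exact congrFun (Continuous.ext_on hd (f := fun z =>
      th τ (x + z) * th τ (x - z) * (th τ (y + w) * th τ (y - w))
      - th τ (x + w) * th τ (x - w) * (th τ (y + z) * th τ (y - z))
      - th τ (x + y) * th τ (x - y) * (th τ (z + w) * th τ (z - w))) (g := fun _ => 0)
      (by fun_prop) (by fun_prop) fun z hz =>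
        th_three_term_of_ne hτ x y w z hy hz.1 (by simpa [sub_eq_add_neg] using hz.2)) z
  exact congrFun (Continuous.ext_on (dense_th_mul_ne_zero hτ two_ne_zero) (f := fun y =>
      th τ (x + z) * th τ (x - z) * (th τ (y + w) * th τ (y - w))
      - th τ (x + w) * th τ (x - w) * (th τ (y + z) * th τ (y - z))
      - th τ (x + y) * th τ (x - y) * (th τ (z + w) * th τ (z - w))) (g := fun _ => 0)
      (by fun_prop) (by fun_prop) fun y hy => h1 y hy z) y

/-! ### The Kronecker function -/

/-- The Kronecker function `θ(u + v) / (θ(u) θ(v))`. -/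
def phi (τ u v : ℂ) : ℂ := th τ (u + v) / (th τ u * th τ v)

theorem phi_comm (τ u v : ℂ) : phi τ u v = phi τ v u := by
  rw [phi, phi, add_comm, mul_comm (th τ u)]

theorem phi_neg (τ u v : ℂ) : phi τ (-u) (-v) = -phi τ u v := by
  rw [phi, phi, ← neg_add, th_neg, th_neg, th_neg, neg_mul_neg, neg_div]

theorem phi_add_lattice_left (τ u v : ℂ) (m n : ℤ) :
    phi τ (u + (n * τ + m)) v = e (-(2 * n * v)) * phi τ u v := by
  rw [phi, phi, show u + (n * τ + m) + v = (u + v) + (n * τ + m) by ring, th_add_lattice,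
    th_add_lattice, show -(n ^ 2 * τ + 2 * n * (u + v)) + m + n =
      -(2 * n * v) + (-(n ^ 2 * τ + 2 * n * u) + m + n) by ring, e_add, mul_assoc (e _),
    mul_assoc (e (-(n ^ 2 * τ + 2 * n * u) + m + n)), mul_div_assoc, mul_div_mul_left _ _ (e_ne_zero _)]

theorem phi_add_lattice_right (τ u v : ℂ) (m n : ℤ) :
    phi τ u (v + (n * τ + m)) = e (-(2 * n * u)) * phi τ u v := by
  rw [phi_comm, phi_add_lattice_left, phi_comm]

/-- Fay's identity for the Kronecker function. -/
theorem phi_mul_phi {τ : ℂ} (hτ : 0 < τ.im) {u₁ u₂ v₁ v₂ : ℂ} (h1 : th τ u₁ ≠ 0)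
    (h2 : th τ u₂ ≠ 0) (h3 : th τ v₁ ≠ 0) (h4 : th τ v₂ ≠ 0) (h5 : th τ (u₁ - u₂) ≠ 0)
    (h6 : th τ (v₁ + v₂) ≠ 0) :
    phi τ u₁ v₁ * phi τ u₂ v₂ =
      phi τ (u₁ - u₂) v₁ * phi τ u₂ (v₁ + v₂) + phi τ u₁ (v₁ + v₂) * phi τ (u₂ - u₁) v₂ := by
  -- These half-sums solve x + z = u₁ + v₁, x - z = u₂ + v₂, y + w = v₁ + v₂, y - w = u₁ - u₂. The
  -- other eight arguments of the three-term identity are then, up to sign, those that remain after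
  -- clearing denominators.
  have key := th_three_term hτ ((u₁ + v₁ + u₂ + v₂) / 2) ((v₁ + v₂ + u₁ - u₂) / 2)
    ((v₁ + v₂ - u₁ + u₂) / 2) ((u₁ + v₁ - u₂ - v₂) / 2)
  ring_nf at key
  have e1 : th τ (u₂ - u₁) = -th τ (u₁ - u₂) := by rw [← th_neg]; ring_nf
  have e2 : th τ (u₂ - u₁ + v₂) = -th τ (u₁ - u₂ - v₂) := by rw [← th_neg]; ring_nf
  simp only [phi]
  rw [e1, e2]
  field_simp
  ring_nf
  linear_combination key

/-! ### The distribution relation -/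

theorem sum_e_eq_zero {N : ℕ} (hN : N ≠ 0) {m : ℤ} (hm : ¬ (N : ℤ) ∣ m) :
    ∑ k : Fin N, e (2 * ((k : ℕ) * m) / N) = 0 := by
  have hN' : (N : ℂ) ≠ 0 := by exact_mod_cast hN
  set r := e (2 * m / N) with hr
  have h1 : ∀ k : ℕ, e (2 * (k * m) / N) = r ^ k := fun k => by
    rw [hr, ← e_nat_mul]; congr 1; ring
  simp only [h1]
  rw [Fin.sum_univ_eq_sum_range (fun k => r ^ k)]
  have hr1 : r ≠ 1 := by
    intro h
    obtain ⟨n, hn⟩ := (e_eq_one_iff _).1 h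
    apply hm
    refine ⟨n, ?_⟩
    have : (m : ℂ) = N * n := by field_simp at hn; linear_combination hn
    exact_mod_cast this
  have hrN : r ^ N = 1 := by
    rw [← h1, mul_div_assoc, mul_div_cancel_left₀ _ hN', e_two_mul_int]
  have := geom_sum_mul r N
  rw [hrN, sub_self] at this
  exact (mul_eq_zero.1 this).resolve_right (sub_ne_zero.2 hr1)

/-- This is orthogonality of characters of (ℤ/N)²: the sum factors, and at least one factor is a
nontrivial geometric sum. -/
theorem sum_e_torsion_eq_zero {N : ℕ} (hN : N ≠ 0) {m n : ℤ}
    (h : ¬ ((N : ℤ) ∣ m ∧ (N : ℤ) ∣ n)) :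
    ∑ α : Fin N × Fin N, e (2 * ((α.1 : ℕ) * m - (α.2 : ℕ) * n) / N) = 0 := by
  have h1 : ∀ α : Fin N × Fin N, e (2 * ((α.1 : ℕ) * m - (α.2 : ℕ) * n) / N) =
      e (2 * ((α.1 : ℕ) * m) / N) * e (2 * ((α.2 : ℕ) * ((-n : ℤ) : ℂ)) / N) := fun α => by
    rw [← e_add]; congr 1; push_cast; ring
  simp only [h1, Fintype.sum_prod_type, ← Finset.mul_sum, ← Finset.sum_mul]
  rw [not_and_or] at h
  rcases h with h | h
  · rw [sum_e_eq_zero hN h, zero_mul]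
  · rw [sum_e_eq_zero hN (mt (dvd_neg.1) h), mul_zero]

/-- The torsion point `(α₁ τ + α₂) / N`. -/
def torsion (τ : ℂ) (N : ℕ) (α : Fin N × Fin N) : ℂ := ((α.1 : ℕ) * τ + (α.2 : ℕ)) / N

theorem th_add_torsion_ne_zero {τ : ℂ} (hτ : 0 < τ.im) {N : ℕ} (hN : N ≠ 0) {v : ℂ}
    (hv : th τ (N * v) ≠ 0) (α : Fin N × Fin N) : th τ (v + torsion τ N α) ≠ 0 := by
  have hN' : (N : ℂ) ≠ 0 := by exact_mod_cast hN
  intro h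
  obtain ⟨m, n, hmn⟩ := (th_eq_zero_iff hτ _).1 h
  refine hv ((th_eq_zero_iff hτ _).2 ⟨N * m - (α.2 : ℕ), N * n - (α.1 : ℕ), ?_⟩)
  rw [eq_sub_of_add_eq hmn, torsion]
  field_simp
  push_cast
  ring

/-- The multipliers are those of `th τ (x + c)`, whose zeros are the points congruent to `-c`; a
further zero at a point of another class is impossible for a nonzero function. Concretely, `h / th`
would be an exponential with multipliers 1 and `e (-(2 * c))`, which puts `c` in the lattice. -/
theorem eq_zero_of_degree_one {τ : ℂ} (hτ : 0 < τ.im) {h : ℂ → ℂ} (hd : Differentiable ℂ h)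
    {c : ℂ} (hc : th τ c ≠ 0) (h1 : ∀ x, h (x + 1) = -h x)
    (h2 : ∀ x, h (x + τ) = e (-(2 * c)) * -e (-(τ + 2 * x)) * h x) (h0 : h 0 = 0) (x : ℂ) :
    h x = 0 := by
  have hlat : ∀ m n : ℤ, h (n * τ + m) = 0 := lattice_induction (P := fun a => h a = 0) h0
    (fun a => by rw [h1, neg_eq_zero]) (fun a => by rw [h2]; simp [e_ne_zero])
  obtain ⟨g, hg, hgf⟩ := exists_entire_quotient hd (differentiable_th hτ) (fun a ha => by
    obtain ⟨m, n, rfl⟩ := (th_eq_zero_iff hτ a).1 ha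
    exact ⟨deriv_th_ne_zero hτ ha, hlat m n⟩)
  have g1 : ∀ x, g (x + 1) = 1 * g x := quotient_multiplier hg.continuous (μ := fun _ => 1)
    (c := fun _ => -1) continuous_const (dense_th_ne_zero hτ) hgf (by simp)
    (fun x => by rw [h1]; ring) (fun x => by rw [th_add_one]; ring)
  have g2 : ∀ x, g (x + τ) = e (-(2 * c)) * g x := quotient_multiplier hg.continuous
    (μ := fun _ => e (-(2 * c))) (c := fun x => -e (-(τ + 2 * x))) continuous_const
    (dense_th_ne_zero hτ) hgf (by simp [e_ne_zero]) h2 (th_add_tau τ)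
  obtain ⟨C, k, hk⟩ := eq_exp_of_quasiperiodic hτ hg one_ne_zero (e_ne_zero _) g1 g2
  have hC : C = 0 := by
    by_contra hC
    have hk1 : Complex.exp k = 1 := by simpa [hk, hC] using g1 0
    have hk2 : Complex.exp (k * τ) = e (-(2 * c)) := by
      have := g2 0
      simp only [hk, zero_add, mul_zero, Complex.exp_zero, mul_one] at this
      exact mul_left_cancel₀ hC (by linear_combination this)
    obtain ⟨n, hn⟩ := Complex.exp_eq_one_iff.1 hk1
    have h3 : Complex.exp (k * τ) = e (2 * n * τ) := by rw [e, hn]; ring_nf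
    rw [h3, e_eq_e_iff] at hk2
    obtain ⟨m, hm⟩ := hk2
    refine hc ((th_eq_zero_iff hτ c).2 ⟨m, -n, ?_⟩)
    push_cast
    linear_combination hm / 2
  rw [hgf, hk, hC]; simp

/-- The difference of the two sides is divisible by `th τ (N * y)`: at a torsion point outside the
lattice the sum becomes a nontrivial character sum, and at a lattice point `th τ y` vanishes. The
quotient has the multipliers of `eq_zero_of_degree_one` with `c = N * v`, and a derivative
computation shows that it vanishes at 0. -/
theorem th_distribution {τ : ℂ} (hτ : 0 < τ.im) {N : ℕ} (hN : N ≠ 0) {v : ℂ}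
    (hv : th τ (N * v) ≠ 0) (y : ℂ) :
    th τ y * th τ (N * v) * ∑ α : Fin N × Fin N,
      e (2 * (α.1 : ℕ) * y) * (th τ (N * y + v + torsion τ N α) / th τ (v + torsion τ N α))
      = N * th τ (N * y) * th τ (y + N * v) := by
  have hN' : (N : ℂ) ≠ 0 := by exact_mod_cast hN
  have hth := differentiable_th hτ
  have hne := th_add_torsion_ne_zero hτ hN hv
  set S : ℂ → ℂ := fun y => ∑ α : Fin N × Fin N,
      e (2 * (α.1 : ℕ) * y) * (th τ (N * y + v + torsion τ N α) / th τ (v + torsion τ N α)) with hS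
  set f : ℂ → ℂ := fun y => th τ y * th τ (N * v) * S y - N * th τ (N * y) * th τ (y + N * v)
    with hf
  have hSd : Differentiable ℂ S := by
    refine Differentiable.fun_sum fun α _ => ?_
    have : Differentiable ℂ fun y => th τ (N * y + v + torsion τ N α) := by fun_prop
    fun_prop
  have hfd : Differentiable ℂ f := by fun_prop
  set D : ℂ → ℂ := fun y => th τ (N * y) with hD
  have hDd : Differentiable ℂ D := by fun_prop
  have hder : ∀ a, deriv D a = N * deriv (th τ) (N * a) := fun a => by
    have h1 := (hth (N * a)).hasDerivAt.comp a ((hasDerivAt_id a).const_mul (N : ℂ))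
    rw [mul_one] at h1
    rw [mul_comm]
    exact h1.deriv
  -- values of `S` at the torsion points
  have hSl : ∀ (m n : ℤ) (a : ℂ), (N : ℂ) * a = n * τ + m →
      S a = e (-(n ^ 2 * τ + 2 * n * v) + m + n) *
        ∑ α : Fin N × Fin N, e (2 * ((α.1 : ℕ) * m - (α.2 : ℕ) * n) / N) := fun m n a ha => by
    rw [Finset.mul_sum]
    refine Finset.sum_congr rfl fun α _ => ?_
    rw [ha, show n * τ + m + v + torsion τ N α = (v + torsion τ N α) + (n * τ + m) by ring,
      th_add_lattice, mul_div_assoc, div_self (hne α), mul_one, ← e_add, ← e_add]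
    congr 1
    have ha' : a = (n * τ + m) / N := by field_simp; linear_combination ha
    rw [ha', torsion]
    field_simp
    ring
  obtain ⟨h, hh, hhf⟩ := exists_entire_quotient hfd hDd (fun a ha => by
    obtain ⟨m, n, hmn⟩ := (th_eq_zero_iff hτ _).1 ha
    refine ⟨by rw [hder]; exact mul_ne_zero hN' (deriv_th_ne_zero hτ ha), ?_⟩
    have h1 : th τ (N * a) = 0 := ha
    by_cases hdiv : (N : ℤ) ∣ m ∧ (N : ℤ) ∣ n
    · obtain ⟨⟨m', rfl⟩, ⟨n', rfl⟩⟩ := hdiv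
      have : a = n' * τ + m' := by
        refine mul_left_cancel₀ hN' ?_
        rw [hmn]; push_cast; ring
      simp only [hf, h1]
      rw [this, th_lattice]; ring
    · simp only [hf, h1, hSl m n a hmn, sum_e_torsion_eq_zero hN hdiv]; ring)
  have hdense : Dense {x | D x ≠ 0} := dense_th_mul_ne_zero hτ hN'
  have hN1 : ∀ x, D (x + 1) = e N * D x := fun x => by
    have := th_add_lattice τ (N * x) N 0
    simp only [hD]
    rw [mul_add, mul_one]
    simpa using this
  have hNτ : ∀ x, D (x + τ) = e (-(N ^ 2 * τ + 2 * N * (N * x)) + N) * D x := fun x => by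
    have := th_add_lattice τ (N * x) 0 N
    simp only [hD]
    rw [mul_add]
    simpa using this
  have hS1 : ∀ x, S (x + 1) = e N * S x := fun x => by
    simp only [hS]
    rw [Finset.mul_sum]
    refine Finset.sum_congr rfl fun α _ => ?_
    have h1 := th_add_lattice τ (N * x + v + torsion τ N α) N 0
    have h2 : e (2 * (α.1 : ℕ) * (x + 1)) = e (2 * (α.1 : ℕ) * x) := by
      rw [e_eq_e_iff]; exact ⟨(α.1 : ℕ), by push_cast; ring⟩
    rw [h2, show N * (x + 1) + v + torsion τ N α = N * x + v + torsion τ N α + ((0 : ℤ) * τ + (N : ℤ))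
      by push_cast; ring, h1]
    simp
    ring
  have hSτ : ∀ x, S (x + τ) = e (-(2 * (N * v))) * e (-(N ^ 2 * τ + 2 * N * (N * x)) + N) * S x :=
    fun x => by
    simp only [hS]
    rw [Finset.mul_sum]
    refine Finset.sum_congr rfl fun α _ => ?_
    rw [show N * (x + τ) + v + torsion τ N α = N * x + v + torsion τ N α + ((N : ℤ) * τ + (0 : ℤ))
      by push_cast; ring, th_add_lattice, mul_div_assoc, ← mul_assoc, ← mul_assoc, ← e_add,
      ← e_add, ← e_add]
    congr 1
    rw [e_eq_e_iff]
    refine ⟨-(α.2 : ℕ), ?_⟩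
    rw [torsion]
    field_simp
    push_cast
    ring
  have hh1 : ∀ x, h (x + 1) = -1 * h x := quotient_multiplier hh.continuous (μ := fun _ => -1)
    continuous_const hdense hhf (fun _ => e_ne_zero N) (fun x => by
      have e1 : th τ (N * (x + 1)) = e N * th τ (N * x) := hN1 x
      have e2 : th τ (x + 1 + N * v) = -th τ (x + N * v) := by rw [← th_add_one]; ring_nf
      simp only [hf, hS1, e1, e2, th_add_one]; ring) hN1
  have hh2 : ∀ x, h (x + τ) = (e (-(2 * (N * v))) * -e (-(τ + 2 * x))) * h x :=
    quotient_multiplier hh.continuous (μ := fun x => e (-(2 * (N * v))) * -e (-(τ + 2 * x)))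
    (by fun_prop) hdense hhf (fun _ => e_ne_zero _) (fun x => by
      have e1 : th τ (N * (x + τ)) = e (-(N ^ 2 * τ + 2 * N * (N * x)) + N) * th τ (N * x) := hNτ x
      have e2 : th τ (x + τ + N * v) = e (-(2 * (N * v))) * -e (-(τ + 2 * x)) * th τ (x + N * v) := by
        rw [show x + τ + N * v = (x + N * v) + τ by ring, th_add_tau, mul_neg, ← e_add]; ring_nf
      simp only [hf, hSτ, e1, e2, th_add_tau]; ring) hNτ
  -- As `D 0 = 0`, the value `h 0` appears only in the derivative, `deriv f 0 = h 0 * deriv D 0`.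
  -- The left side is zero because all `N ^ 2` summands of `S 0` equal 1.
  have hh0 : h 0 = 0 := by
    have hS0 : S 0 = N ^ 2 := by
      simp only [hS, mul_zero, e_zero, zero_add, one_mul]
      rw [Finset.sum_congr rfl fun α _ => div_self (hne α)]
      simp [sq]
    have hder0 : deriv D 0 = N * deriv (th τ) 0 := by rw [hder, mul_zero]
    have hD0 : D 0 = 0 := by simp only [hD, mul_zero, th_zero]
    have h1 : HasDerivAt f (deriv (th τ) 0 * th τ (N * v) * N ^ 2
        - N * (N * deriv (th τ) 0) * th τ (N * v)) 0 := by
      have a1 := (((hth 0).hasDerivAt.mul_const (th τ (N * v))).mul (hSd 0).hasDerivAt)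
      have a2 : HasDerivAt (fun y => th τ (y + N * v)) (deriv (th τ) (0 + N * v)) 0 :=
        (hth _).hasDerivAt.comp_add_const 0 _
      have a3 := (((hDd 0).hasDerivAt.const_mul (N : ℂ)).mul a2)
      refine (a1.sub a3).congr_deriv ?_
      simp only [hder0, hD0, zero_add, th_zero, hS0]
      ring
    have h2 : HasDerivAt f (deriv h 0 * D 0 + h 0 * deriv D 0) 0 := by
      have : f = h * D := funext hhf
      rw [this]
      exact (hh 0).hasDerivAt.mul (hDd 0).hasDerivAt
    have h3 := h1.unique h2
    rw [hder0, hD0, mul_zero, zero_add] at h3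
    have h4 : h 0 * (N * deriv (th τ) 0) = 0 := by linear_combination -h3
    exact (mul_eq_zero.1 h4).resolve_right
      (mul_ne_zero hN' (deriv_th_ne_zero hτ (th_zero τ)))
  have := eq_zero_of_degree_one hτ hh hv (fun x => by rw [hh1]; ring) hh2 hh0 y
  have h5 := hhf y
  rw [this, zero_mul] at h5
  exact sub_eq_zero.1 h5

theorem phi_distribution {τ : ℂ} (hτ : 0 < τ.im) {N : ℕ} (hN : N ≠ 0) {u v : ℂ}
    (hu : th τ u ≠ 0) (hv : th τ (N * v) ≠ 0) :
    ∑ α : Fin N × Fin N, e (2 * (α.1 : ℕ) * u / N) * phi τ u (v + torsion τ N α)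
      = N * phi τ (u / N) (N * v) := by
  have hN' : (N : ℂ) ≠ 0 := by exact_mod_cast hN
  have hu' : th τ (u / N) ≠ 0 := fun h => by
    obtain ⟨m, n, hmn⟩ := (th_eq_zero_iff hτ _).1 h
    refine hu ((th_eq_zero_iff hτ _).2 ⟨N * m, N * n, ?_⟩)
    rw [div_eq_iff hN'] at hmn
    rw [hmn]; push_cast; ring
  have := th_distribution hτ hN hv (u / N)
  rw [mul_div_cancel₀ u hN'] at this
  have h2 : ∑ α : Fin N × Fin N, e (2 * (α.1 : ℕ) * u / N) * phi τ u (v + torsion τ N α) =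
      (∑ α : Fin N × Fin N, e (2 * (α.1 : ℕ) * (u / N)) *
        (th τ (u + v + torsion τ N α) / th τ (v + torsion τ N α))) / th τ u := by
    rw [Finset.sum_div]
    refine Finset.sum_congr rfl fun α _ => ?_
    have := th_add_torsion_ne_zero hτ hN hv α
    rw [phi, add_assoc]
    field_simp
  rw [h2, phi, mul_div_assoc', div_eq_div_iff hu (mul_ne_zero hu' hv)]
  linear_combination this

/-- The second arguments of the two Kronecker functions add up to `s` for every torsion point. After
Fay's identity the torsion point therefore survives in one factor `phi τ δ _` only, and
`phi_distribution` sums it. -/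
theorem phi_convolution_of_ne {τ : ℂ} (hτ : 0 < τ.im) {N : ℕ} (hN : N ≠ 0) {ξ δ s v : ℂ}
    (h1 : th τ ξ ≠ 0) (h2 : th τ (ξ + δ) ≠ 0) (h3 : th τ δ ≠ 0) (h4 : th τ s ≠ 0)
    (h5 : th τ (N * v) ≠ 0) (h6 : th τ (N * (v - s)) ≠ 0) :
    ∑ α : Fin N × Fin N, e (2 * (α.1 : ℕ) * δ / N) *
      (phi τ (ξ + δ) (v + torsion τ N α) * phi τ ξ (s - v - torsion τ N α)) =
      N * (phi τ ξ s * phi τ (δ / N) (N * v) - phi τ (ξ + δ) s * phi τ (δ / N) (N * (v - s))) := by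
  have key : ∀ α : Fin N × Fin N, e (2 * (α.1 : ℕ) * δ / N) *
      (phi τ (ξ + δ) (v + torsion τ N α) * phi τ ξ (s - v - torsion τ N α)) =
      phi τ ξ s * (e (2 * (α.1 : ℕ) * δ / N) * phi τ δ (v + torsion τ N α))
      - phi τ (ξ + δ) s * (e (2 * (α.1 : ℕ) * δ / N) * phi τ δ (v - s + torsion τ N α)) :=
    fun α => by
    have a1 := th_add_torsion_ne_zero hτ hN h5 α
    have a2 := th_add_torsion_ne_zero hτ hN h6 α
    have a3 : th τ (s - v - torsion τ N α) ≠ 0 := by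
      rw [show s - v - torsion τ N α = -(v - s + torsion τ N α) by ring, th_neg]
      exact neg_ne_zero.2 a2
    have := phi_mul_phi hτ h2 h1 a1 a3 (by simpa using h3) (by
      rwa [show v + torsion τ N α + (s - v - torsion τ N α) = s by ring])
    rw [show v + torsion τ N α + (s - v - torsion τ N α) = s by ring, add_sub_cancel_left,
      sub_add_cancel_left, show s - v - torsion τ N α = -(v - s + torsion τ N α) by ring,
      phi_neg] at this
    rw [show s - v - torsion τ N α = -(v - s + torsion τ N α) by ring, this]
    ring
  rw [Finset.sum_congr rfl fun α _ => key α, Finset.sum_sub_distrib, ← Finset.mul_sum,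
    ← Finset.mul_sum, phi_distribution hτ hN h3 h5, phi_distribution hτ hN h3 h6]
  ring

theorem continuousAt_phi {τ : ℂ} (hτ : 0 < τ.im) {f g : ℂ → ℂ} {a : ℂ} (hf : ContinuousAt f a)
    (hg : ContinuousAt g a) (h1 : th τ (f a) ≠ 0) (h2 : th τ (g a) ≠ 0) :
    ContinuousAt (fun x => phi τ (f x) (g x)) a := by
  have hth := (differentiable_th hτ).continuous
  unfold phi
  exact ContinuousAt.div (hth.continuousAt.comp (hf.add hg))
    ((hth.continuousAt.comp hf).mul (hth.continuousAt.comp hg)) (mul_ne_zero h1 h2)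

theorem eq_of_frequently_eq_of_continuousAt {f g : ℂ → ℂ} {a : ℂ} (hf : ContinuousAt f a)
    (hg : ContinuousAt g a) (h : ∃ᶠ x in nhds a, f x = g x) : f a = g a :=
  tendsto_nhds_unique_of_frequently_eq hf hg h

theorem frequently_th_ne_zero {τ : ℂ} (hτ : 0 < τ.im) (a : ℂ) : ∃ᶠ x in nhds a, th τ x ≠ 0 :=
  mem_closure_iff_frequently.1 (dense_th_ne_zero hτ a)

/-- Continuity in `δ` weakens `th τ δ ≠ 0` to `th τ (δ / N) ≠ 0`. Unitarity needs this weaker form,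
since there `δ` is a lattice point. -/
theorem phi_convolution {τ : ℂ} (hτ : 0 < τ.im) {N : ℕ} (hN : N ≠ 0) {ξ δ s v : ℂ}
    (h1 : th τ ξ ≠ 0) (h2 : th τ (ξ + δ) ≠ 0) (h3 : th τ (δ / N) ≠ 0) (h4 : th τ s ≠ 0)
    (h5 : th τ (N * v) ≠ 0) (h6 : th τ (N * (v - s)) ≠ 0) :
    ∑ α : Fin N × Fin N, e (2 * (α.1 : ℕ) * δ / N) *
      (phi τ (ξ + δ) (v + torsion τ N α) * phi τ ξ (s - v - torsion τ N α)) =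
      N * (phi τ ξ s * phi τ (δ / N) (N * v) - phi τ (ξ + δ) s * phi τ (δ / N) (N * (v - s))) := by
  have hth := (differentiable_th hτ).continuous
  refine eq_of_frequently_eq_of_continuousAt (a := δ) (f := fun δ => ∑ α : Fin N × Fin N,
      e (2 * (α.1 : ℕ) * δ / N) *
      (phi τ (ξ + δ) (v + torsion τ N α) * phi τ ξ (s - v - torsion τ N α)))
      (g := fun δ => N * (phi τ ξ s * phi τ (δ / N) (N * v) -
        phi τ (ξ + δ) s * phi τ (δ / N) (N * (v - s)))) ?_ ?_ ?_
  · refine tendsto_finsetSum _ fun α _ => ?_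
    have c1 := continuousAt_phi hτ (f := fun δ => ξ + δ) (g := fun _ => v + torsion τ N α) (a := δ)
      (by fun_prop) (by fun_prop) h2 (th_add_torsion_ne_zero hτ hN h5 α)
    have c2 : Continuous fun δ => e (2 * (α.1 : ℕ) * δ / N) := by fun_prop
    exact c2.continuousAt.mul (c1.mul continuousAt_const)
  · have c1 := continuousAt_phi hτ (f := fun δ => ξ + δ) (g := fun _ => s) (a := δ)
      (by fun_prop) (by fun_prop) h2 h4
    have c2 := continuousAt_phi hτ (f := fun δ => δ / N) (g := fun _ => N * v) (a := δ)
      (by fun_prop) (by fun_prop) h3 h5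
    have c3 := continuousAt_phi hτ (f := fun δ => δ / N) (g := fun _ => N * (v - s)) (a := δ)
      (by fun_prop) (by fun_prop) h3 h6
    fun_prop
  · have c2 : ContinuousAt (fun δ => th τ (ξ + δ)) δ := by fun_prop
    refine ((frequently_th_ne_zero hτ δ).and_eventually (c2.eventually_ne h2)).mono ?_
    rintro δ' ⟨a1, a2⟩
    exact phi_convolution_of_ne hτ hN h1 a2 a1 h4 h5 h6

/-! ### Convolutions of the coefficients of the `R`-matrix -/

/-- The normalized coefficients of the `R`-matrix, with integer characteristics `a`, `b`. -/
def coeff (τ : ℂ) (N : ℕ) (v x : ℂ) (a b : ℤ) : ℂ :=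
  e (2 * a * x / N) * (th τ (x + v + (a * τ + b) / N) / th τ (v + (a * τ + b) / N))

theorem coeff_eq_phi {τ x : ℂ} (hx : th τ x ≠ 0) (N : ℕ) (v : ℂ) (a b : ℤ) :
    coeff τ N v x a b = th τ x * (e (2 * a * x / N) * phi τ x (v + (a * τ + b) / N)) := by
  rw [coeff, phi, ← add_assoc]
  field_simp

theorem coeff_mul_coeff {τ ξ ξ' : ℂ} {N : ℕ} (h : th τ ξ ≠ 0) (h' : th τ ξ' ≠ 0)
    (v : ℂ) (α : Fin N × Fin N) (a b : ℤ) :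
    coeff τ N v ξ' (α.1 : ℕ) (α.2 : ℕ) * coeff τ N (-v) ξ (a - (α.1 : ℕ)) (b - (α.2 : ℕ)) =
      th τ ξ * th τ ξ' * e (2 * a * ξ / N) * (e (2 * (α.1 : ℕ) * (ξ' - ξ) / N) *
        (phi τ ξ' (v + torsion τ N α) * phi τ ξ ((a * τ + b) / N - v - torsion τ N α))) := by
  rw [coeff_eq_phi h, coeff_eq_phi h', torsion]
  have e1 : e (2 * ((a - (α.1 : ℕ) : ℤ) : ℂ) * ξ / N) * e (2 * ((α.1 : ℕ) : ℤ) * ξ' / N) =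
      e (2 * a * ξ / N) * e (2 * (α.1 : ℕ) * (ξ' - ξ) / N) := by
    rw [← e_add, ← e_add]; congr 1; push_cast; ring
  have e2 : -v + (((a - (α.1 : ℕ) : ℤ) : ℂ) * τ + ((b - (α.2 : ℕ) : ℤ) : ℂ)) / N =
      (a * τ + b) / N - v - ((α.1 : ℕ) * τ + (α.2 : ℕ)) / N := by push_cast; ring
  rw [e2]
  push_cast at e1 ⊢
  linear_combination (th τ ξ * th τ ξ' * phi τ ξ' (v + ((α.1 : ℕ) * τ + (α.2 : ℕ)) / N) *
    phi τ ξ ((a * τ + b) / N - v - ((α.1 : ℕ) * τ + (α.2 : ℕ)) / N)) * e1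

theorem th_div_ne_zero {τ : ℂ} (hτ : 0 < τ.im) {N : ℕ} (hN : N ≠ 0) {a b : ℤ}
    (h : ¬ ((N : ℤ) ∣ a ∧ (N : ℤ) ∣ b)) : th τ ((a * τ + b) / N) ≠ 0 := by
  have hN' : (N : ℂ) ≠ 0 := by exact_mod_cast hN
  intro h0
  obtain ⟨m, n, hmn⟩ := (th_eq_zero_iff hτ _).1 h0
  have h1 : ((a - N * n : ℤ) : ℂ) * τ = ((N * m - b : ℤ) : ℂ) := by
    rw [div_eq_iff hN'] at hmn
    push_cast
    linear_combination hmn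
  have h2 := congrArg Complex.im h1
  have h3 : a - N * n = 0 := by simpa [hτ.ne', -Int.cast_sub] using h2
  rw [h3] at h1
  have h4 : N * m - b = 0 := by
    have : ((N * m - b : ℤ) : ℂ) = 0 := by rw [← h1]; simp
    exact_mod_cast this
  exact h ⟨⟨n, by linarith⟩, ⟨m, by linarith⟩⟩

/-- The phase is absorbed by translating the argument of one Kronecker function by the lattice point
`δ = a * τ + b`. The convolution formula with `s = δ / N` then yields two terms that differ by
lattice multipliers of product one, so they cancel. -/
theorem coeff_unitarity_of_ne {τ : ℂ} (hτ : 0 < τ.im) {N : ℕ} (hN : N ≠ 0) {ξ v : ℂ}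
    (hξ : th τ ξ ≠ 0) (hv : th τ (N * v) ≠ 0) {a b : ℤ} (h : ¬ ((N : ℤ) ∣ a ∧ (N : ℤ) ∣ b)) :
    ∑ α : Fin N × Fin N, e (2 * ((α.1 : ℕ) * b - (α.2 : ℕ) * a) / N) *
      (coeff τ N v ξ (α.1 : ℕ) (α.2 : ℕ) *
        coeff τ N (-v) ξ (a - (α.1 : ℕ)) (b - (α.2 : ℕ))) = 0 := by
  have hN' : (N : ℂ) ≠ 0 := by exact_mod_cast hN
  have hs := th_div_ne_zero hτ hN h
  have key := phi_convolution hτ hN (ξ := ξ) (δ := a * τ + b) (s := (a * τ + b) / N) (v := v) hξ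
    (by rw [th_add_lattice]; exact mul_ne_zero (e_ne_zero _) hξ) hs hs hv (by
      have : N * (v - (a * τ + b) / N) = N * v + (((-a : ℤ) : ℂ) * τ + ((-b : ℤ) : ℂ)) := by
        field_simp; push_cast; ring
      rw [this, th_add_lattice]
      exact mul_ne_zero (e_ne_zero _) hv)
  have h1 : N * (v - (a * τ + b) / N) = N * v + (((-a : ℤ) : ℂ) * τ + ((-b : ℤ) : ℂ)) := by
    field_simp; push_cast; ring
  rw [h1, phi_add_lattice_right, phi_add_lattice_left] at key
  have h2 : e (-(2 * a * ((a * τ + b) / N))) * e (-(2 * ((-a : ℤ) : ℂ) * ((a * τ + b) / N))) = 1 := by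
    rw [← e_add, e_eq_one_iff]; exact ⟨0, by push_cast; ring⟩
  have h3 : ∀ α : Fin N × Fin N, e (2 * ((α.1 : ℕ) * b - (α.2 : ℕ) * a) / N) *
      (coeff τ N v ξ (α.1 : ℕ) (α.2 : ℕ) *
        coeff τ N (-v) ξ (a - (α.1 : ℕ)) (b - (α.2 : ℕ))) =
      th τ ξ * th τ ξ * e (2 * a * ξ / N) * e (2 * a * v) *
      (e (2 * (α.1 : ℕ) * (a * τ + b) / N) *
      (phi τ (ξ + (a * τ + b)) (v + torsion τ N α) *
        phi τ ξ ((a * τ + b) / N - v - torsion τ N α))) := fun α => by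
    rw [coeff_mul_coeff hξ hξ, phi_add_lattice_left, sub_self, mul_zero, zero_div, e_zero]
    have : e (2 * ((α.1 : ℕ) * b - (α.2 : ℕ) * a) / N) = e (2 * a * v) *
        e (2 * (α.1 : ℕ) * (a * τ + b) / N) * e (-(2 * a * (v + torsion τ N α))) := by
      rw [← e_add, ← e_add, torsion]; congr 1; field_simp; ring
    rw [this]
    ring
  rw [Finset.sum_congr rfl fun α _ => h3 α, ← Finset.mul_sum, key]
  linear_combination (-th τ ξ * th τ ξ * e (2 * a * ξ / N) * e (2 * a * v) * N *
    phi τ ξ ((a * τ + b) / N) * phi τ ((a * τ + b) / N) (N * v)) * h2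

theorem coeff_unitarity_zero {τ : ℂ} (hτ : 0 < τ.im) {N : ℕ} (hN : N ≠ 0) {ξ v : ℂ}
    (hξ : th τ ξ ≠ 0) (hv : th τ (N * v) ≠ 0) :
    ∑ α : Fin N × Fin N, coeff τ N v ξ (α.1 : ℕ) (α.2 : ℕ) *
        coeff τ N (-v) ξ (0 - (α.1 : ℕ)) (0 - (α.2 : ℕ)) =
      N ^ 2 * (th τ (ξ + N * v) * th τ (ξ - N * v) / -th τ (N * v) ^ 2) := by
  have hN' : (N : ℂ) ≠ 0 := by exact_mod_cast hN
  have hth := (differentiable_th hτ).continuous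
  have hnv : th τ (-(N * v)) ≠ 0 := by rw [th_neg]; exact neg_ne_zero.2 hv
  -- For `γ = 0` the convolution formula is singular, so it is used at `δ = N * ε`, `s = ε`. Its
  -- difference of two singular terms is written as a telescoping sum of `N` differences, each of
  -- which Fay's identity, read backwards, turns into a product regular at `ε = 0`.
  have tele : ∀ ε : ℂ, th τ ε ≠ 0 → (∀ k : Fin (N + 1), th τ (ξ + (k : ℕ) * ε) ≠ 0) →
      (∀ k : Fin (N + 1), th τ (N * v - (k : ℕ) * ε) ≠ 0) →
      ∑ α : Fin N × Fin N, e (2 * (α.1 : ℕ) * (N * ε) / N) *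
      (phi τ (ξ + N * ε) (v + torsion τ N α) * phi τ ξ (ε - v - torsion τ N α)) =
      N * ∑ k ∈ Finset.range N, phi τ (ξ + (k + 1 : ℕ) * ε) (N * v - k * ε) *
        phi τ (ξ + k * ε) (ε - N * v + k * ε) := by
    intro ε h1 h2 h3
    have hεN : (N * ε) / N = ε := by field_simp
    rw [phi_convolution hτ hN hξ (by simpa using h2 ⟨N, by omega⟩) (by rwa [hεN]) h1 hv
      (by rw [mul_sub]; simpa using h3 ⟨N, by omega⟩), hεN]
    have h4 : ∀ k ∈ Finset.range N, phi τ (ξ + (k + 1 : ℕ) * ε) (N * v - k * ε) *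
        phi τ (ξ + k * ε) (ε - N * v + k * ε) =
        phi τ (ξ + k * ε) ε * phi τ ε (N * v - k * ε) -
        phi τ (ξ + (k + 1 : ℕ) * ε) ε * phi τ ε (N * v - (k + 1 : ℕ) * ε) := by
      intro k hk
      rw [Finset.mem_range] at hk
      have b1 : ξ + (k + 1 : ℕ) * ε - (ξ + k * ε) = ε := by push_cast; ring
      have b2 : N * v - k * ε + (ε - N * v + k * ε) = ε := by ring
      have b3 : ε - N * v + k * ε = -(N * v - (k + 1 : ℕ) * ε) := by push_cast; ring
      have b4 : ξ + k * ε - (ξ + (k + 1 : ℕ) * ε) = -ε := by push_cast; ring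
      have := phi_mul_phi hτ (u₁ := ξ + (k + 1 : ℕ) * ε) (u₂ := ξ + k * ε)
        (v₁ := N * v - k * ε) (v₂ := ε - N * v + k * ε) (h2 ⟨k + 1, by omega⟩)
        (h2 ⟨k, by omega⟩) (h3 ⟨k, by omega⟩) (by
          rw [b3, th_neg]; exact neg_ne_zero.2 (h3 ⟨k + 1, by omega⟩)) (by rwa [b1])
        (by rwa [b2])
      rw [this, b1, b2, b4, b3, phi_neg]
      ring
    rw [Finset.sum_congr rfl h4, Finset.sum_range_sub']
    simp [mul_sub]
  have lim := eq_of_frequently_eq_of_continuousAt (a := 0)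
    (f := fun ε => ∑ α : Fin N × Fin N, e (2 * (α.1 : ℕ) * (N * ε) / N) *
      (phi τ (ξ + N * ε) (v + torsion τ N α) * phi τ ξ (ε - v - torsion τ N α)))
    (g := fun ε => N * ∑ k ∈ Finset.range N, phi τ (ξ + (k + 1 : ℕ) * ε) (N * v - k * ε) *
        phi τ (ξ + k * ε) (ε - N * v + k * ε)) ?_ ?_ ?_
  · simp only [mul_zero, add_zero, zero_div, e_zero, one_mul, zero_sub, sub_zero, Finset.sum_const,
      Finset.card_range, nsmul_eq_mul] at lim
    have h3 : ∀ α : Fin N × Fin N, coeff τ N v ξ (α.1 : ℕ) (α.2 : ℕ) *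
        coeff τ N (-v) ξ (0 - (α.1 : ℕ)) (0 - (α.2 : ℕ)) = th τ ξ * th τ ξ *
        (phi τ ξ (v + torsion τ N α) * phi τ ξ (-v - torsion τ N α)) := fun α => by
      rw [coeff_mul_coeff hξ hξ]
      simp
    rw [Finset.sum_congr rfl fun α _ => h3 α, ← Finset.mul_sum, lim, phi, phi, th_neg,
      ← sub_eq_add_neg]
    field_simp
  · refine tendsto_finsetSum _ fun α _ => ?_
    have c1 := continuousAt_phi hτ (f := fun ε => ξ + N * ε) (g := fun _ => v + torsion τ N α)
      (a := 0) (by fun_prop) (by fun_prop) (by simpa using hξ) (th_add_torsion_ne_zero hτ hN hv α)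
    have c2 := continuousAt_phi hτ (f := fun _ => ξ) (g := fun ε => ε - v - torsion τ N α)
      (a := 0) (by fun_prop) (by fun_prop) hξ (by
        rw [show 0 - v - torsion τ N α = -(v + torsion τ N α) by ring, th_neg]
        exact neg_ne_zero.2 (th_add_torsion_ne_zero hτ hN hv α))
    have c3 : Continuous fun ε => e (2 * (α.1 : ℕ) * (N * ε) / N) := by fun_prop
    exact c3.continuousAt.mul (c1.mul c2)
  · refine tendsto_const_nhds.mul (tendsto_finsetSum _ fun k _ => ?_)
    have c1 := continuousAt_phi hτ (f := fun ε => ξ + (k + 1 : ℕ) * ε) (g := fun ε => N * v - k * ε)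
      (a := 0) (by fun_prop) (by fun_prop) (by simpa using hξ) (by simpa using hv)
    have c2 := continuousAt_phi hτ (f := fun ε => ξ + k * ε) (g := fun ε => ε - N * v + k * ε)
      (a := 0) (by fun_prop) (by fun_prop) (by simpa using hξ) (by simpa using hnv)
    exact c1.mul c2
  · have ev1 : ∀ᶠ ε in nhds (0 : ℂ), ∀ k : Fin (N + 1), th τ (ξ + (k : ℕ) * ε) ≠ 0 := by
      refine Filter.eventually_all.2 fun k => ?_
      have : ContinuousAt (fun ε => th τ (ξ + (k : ℕ) * ε)) 0 := by fun_prop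
      exact this.eventually_ne (by simpa using hξ)
    have ev2 : ∀ᶠ ε in nhds (0 : ℂ), ∀ k : Fin (N + 1), th τ (N * v - (k : ℕ) * ε) ≠ 0 := by
      refine Filter.eventually_all.2 fun k => ?_
      have : ContinuousAt (fun ε => th τ (N * v - (k : ℕ) * ε)) 0 := by fun_prop
      exact this.eventually_ne (by simpa using hv)
    refine ((frequently_th_ne_zero hτ 0).and_eventually (ev1.and ev2)).mono ?_
    rintro ε ⟨h1, h2, h3⟩
    exact tele ε h1 h2 h3

theorem phi_neg_self (τ x : ℂ) : phi τ (-x) x = 0 := by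
  rw [phi, neg_add_cancel, th_zero, zero_div]

/-- With `δ = -(N * (N * v))` one has `δ / N = -(N * v)`, and both terms of the convolution formula
contain `phi τ (-(N * v)) (N * v) = 0`, the second one after a lattice shift. This is the origin of
the crossing shift by `q^{-N}`. -/
theorem coeff_crossing_of_ne {τ : ℂ} (hτ : 0 < τ.im) {N : ℕ} (hN : N ≠ 0) {ξ v : ℂ}
    (hξ : th τ ξ ≠ 0) (hξ' : th τ (ξ - N * (N * v)) ≠ 0) (hv : th τ (N * v) ≠ 0) {a b : ℤ}
    (h : ¬ ((N : ℤ) ∣ a ∧ (N : ℤ) ∣ b)) :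
    ∑ α : Fin N × Fin N, coeff τ N v (ξ - N * (N * v)) (α.1 : ℕ) (α.2 : ℕ) *
        coeff τ N (-v) ξ (a - (α.1 : ℕ)) (b - (α.2 : ℕ)) = 0 := by
  have hN' : (N : ℂ) ≠ 0 := by exact_mod_cast hN
  have hs := th_div_ne_zero hτ hN h
  have hnv : th τ (-(N * v)) ≠ 0 := by rw [th_neg]; exact neg_ne_zero.2 hv
  have h1 : N * (v - (a * τ + b) / N) = N * v + (((-a : ℤ) : ℂ) * τ + ((-b : ℤ) : ℂ)) := by
    field_simp; push_cast; ring
  have h2 : -(N * (N * v)) / N = -(N * v) := by field_simp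
  have key := phi_convolution hτ hN (ξ := ξ) (δ := -(N * (N * v))) (s := (a * τ + b) / N) (v := v)
    hξ (by rwa [← sub_eq_add_neg]) (by rwa [h2]) hs hv (by
      rw [h1, th_add_lattice]
      exact mul_ne_zero (e_ne_zero _) hv)
  rw [h1, phi_add_lattice_right, h2, phi_neg_self] at key
  rw [Finset.sum_congr rfl fun α _ => coeff_mul_coeff hξ hξ' v α a b, ← Finset.mul_sum,
    show ξ - N * (N * v) - ξ = -(N * (N * v)) by ring, sub_eq_add_neg ξ, key]
  ring

theorem coeff_crossing_zero {τ : ℂ} (hτ : 0 < τ.im) {N : ℕ} (hN : N ≠ 0) {ξ v : ℂ}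
    (hξ : th τ ξ ≠ 0) (hξ' : th τ (ξ - N * (N * v)) ≠ 0) (hv : th τ (N * v) ≠ 0) :
    ∑ α : Fin N × Fin N, coeff τ N v (ξ - N * (N * v)) (α.1 : ℕ) (α.2 : ℕ) *
        coeff τ N (-v) ξ (0 - (α.1 : ℕ)) (0 - (α.2 : ℕ)) =
      N ^ 2 * (th τ ξ * th τ (ξ - N * (N * v)) / -th τ (N * v) ^ 2) := by
  have hN' : (N : ℂ) ≠ 0 := by exact_mod_cast hN
  have hthd := differentiable_th hτ
  have hth := hthd.continuous
  have hnv : th τ (-(N * v)) ≠ 0 := by rw [th_neg]; exact neg_ne_zero.2 hv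
  set ξ' := ξ - N * (N * v) with hξ'_def
  have hadd : ξ + -(N * (N * v)) = ξ' := by rw [hξ'_def, sub_eq_add_neg]
  have h2 : -(N * (N * v)) / N = -(N * v) := by field_simp
  have hds : ∀ x, th τ x = x * dslope (th τ) 0 x := fun x => by
    have := sub_smul_dslope (th τ) 0 x
    rw [th_zero] at this
    simpa using this.symm
  have hdc : ContinuousAt (dslope (th τ) 0) 0 := continuousAt_dslope_same.2 (hthd 0)
  -- For `s = ε` only the second term of the convolution formula remains, a pole times a zero as `ε`
  -- tends to 0. Writing `th τ x = x * dslope (th τ) 0 x` and multiplying by `dslope (th τ) 0 ε`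
  -- makes both sides continuous at 0.
  have eq1 : ∀ ε : ℂ, th τ ε ≠ 0 → th τ (ξ' + ε) ≠ 0 → th τ (N * v - N * ε) ≠ 0 →
      (∑ α : Fin N × Fin N, e (2 * (α.1 : ℕ) * -(N * (N * v)) / N) *
      (phi τ ξ' (v + torsion τ N α) * phi τ ξ (ε - v - torsion τ N α))) *
      dslope (th τ) 0 ε = N * (N * dslope (th τ) 0 (N * ε)) *
        (th τ (ξ' + ε) / (th τ ξ' * (-th τ (N * v) * th τ (N * v - N * ε)))) := by
    intro ε h1 h3 h4
    have key := phi_convolution hτ hN (ξ := ξ) (δ := -(N * (N * v))) (s := ε) (v := v)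
      hξ (by rwa [hadd]) (by rwa [h2]) h1 hv (by rwa [mul_sub])
    rw [hadd] at key
    have h5 : phi τ (-(N * v)) (N * (v - ε)) = -th τ (N * ε) /
        (-th τ (N * v) * th τ (N * v - N * ε)) := by
      rw [phi, ← th_neg, ← th_neg]; ring_nf
    have h8 : phi τ ξ' ε = th τ (ξ' + ε) / (th τ ξ' * th τ ε) := rfl
    rw [key, h2, phi_neg_self, h5, hds (N * ε), h8]
    have hε : ε ≠ 0 := fun h => h1 (by rw [h, th_zero])
    have hd0 : dslope (th τ) 0 ε ≠ 0 := fun h => h1 (by rw [hds, h, mul_zero])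
    rw [hds ε]
    field_simp
    ring
  have lim := eq_of_frequently_eq_of_continuousAt (a := 0)
    (f := fun ε => (∑ α : Fin N × Fin N, e (2 * (α.1 : ℕ) * -(N * (N * v)) / N) *
      (phi τ ξ' (v + torsion τ N α) * phi τ ξ (ε - v - torsion τ N α))) * dslope (th τ) 0 ε)
    (g := fun ε => N * (N * dslope (th τ) 0 (N * ε)) *
        (th τ (ξ' + ε) / (th τ ξ' * (-th τ (N * v) * th τ (N * v - N * ε))))) ?_ ?_ ?_
  · simp only [mul_zero, add_zero, zero_sub, sub_zero, dslope_same] at lim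
    have hd0 := deriv_th_ne_zero hτ (th_zero τ)
    rw [Finset.sum_congr rfl fun α _ => coeff_mul_coeff hξ hξ' v α 0 0, ← Finset.mul_sum]
    have h6 : ξ' - ξ = -(N * (N * v)) := by rw [hξ'_def]; ring
    simp only [h6, Int.cast_zero, zero_mul, mul_zero, add_zero, zero_div, e_zero, mul_one, zero_sub]
    have h7 : (∑ α : Fin N × Fin N, e (2 * (α.1 : ℕ) * -(N * (N * v)) / N) *
      (phi τ ξ' (v + torsion τ N α) * phi τ ξ (-v - torsion τ N α))) =
      N * N * (th τ ξ' / (th τ ξ' * (-th τ (N * v) * th τ (N * v)))) :=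
      mul_right_cancel₀ hd0 (by rw [lim]; ring)
    rw [h7]
    field_simp
  · refine Filter.Tendsto.mul (tendsto_finsetSum _ fun α _ => ?_) hdc
    have c2 := continuousAt_phi hτ (f := fun _ => ξ) (g := fun ε => ε - v - torsion τ N α)
      (a := 0) (by fun_prop) (by fun_prop) hξ (by
        rw [show 0 - v - torsion τ N α = -(v + torsion τ N α) by ring, th_neg]
        exact neg_ne_zero.2 (th_add_torsion_ne_zero hτ hN hv α))
    exact tendsto_const_nhds.mul (tendsto_const_nhds.mul c2)
  · have c1 : ContinuousAt (fun ε => dslope (th τ) 0 (N * ε)) 0 :=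
      ContinuousAt.comp (f := fun ε : ℂ => (N : ℂ) * ε) (g := dslope (th τ) 0)
        (by simpa using hdc) (by fun_prop)
    have c2 : ContinuousAt (fun ε => th τ (ξ' + ε) /
        (th τ ξ' * (-th τ (N * v) * th τ (N * v - N * ε)))) 0 := by
      refine ContinuousAt.div (by fun_prop) (by fun_prop) ?_
      simp [hv, hξ']
    exact (continuousAt_const.mul (continuousAt_const.mul c1)).mul c2
  · have ev1 : ∀ᶠ ε in nhds (0 : ℂ), th τ (ξ' + ε) ≠ 0 := by
      have : ContinuousAt (fun ε => th τ (ξ' + ε)) 0 := by fun_prop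
      exact this.eventually_ne (by simpa using hξ')
    have ev2 : ∀ᶠ ε in nhds (0 : ℂ), th τ (N * v - N * ε) ≠ 0 := by
      have : ContinuousAt (fun ε => th τ (N * v - N * ε)) 0 := by fun_prop
      exact this.eventually_ne (by simpa using hv)
    refine ((frequently_th_ne_zero hτ 0).and_eventually (ev1.and ev2)).mono ?_
    rintro ε ⟨h1, h2, h3⟩
    exact eq1 ε h1 h2 h3

/-! ### The Heisenberg relations -/

theorem e_natCast_div_mod {N : ℕ} (hN : N ≠ 0) (s : ℕ) :
    e (2 * ((s % N : ℕ) : ℂ) / N) = e (2 * s / N) := by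
  have hN' : (N : ℂ) ≠ 0 := by exact_mod_cast hN
  obtain ⟨k, hk⟩ : ∃ k, s = N * k + s % N := ⟨s / N, (Nat.div_add_mod s N).symm⟩
  rw [eq_comm, e_eq_e_iff]
  refine ⟨k, ?_⟩
  have h : (s : ℂ) = N * k + (s % N : ℕ) := by exact_mod_cast hk
  rw [h]
  push_cast
  field_simp
  ring

theorem hMat_mul_gMat (N : ℕ) :
    hMat N * gMat N = e (2 / N) • (gMat N * hMat N) := by
  ext i j
  have hN : N ≠ 0 := i.pos.ne'
  rw [gMat, Matrix.mul_diagonal, Matrix.smul_apply, Matrix.diagonal_mul, hMat, Matrix.of_apply]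
  split_ifs with h
  · rw [one_mul, mul_one, smul_eq_mul, ← e_add, h]
    have h1 := e_natCast_div_mod hN ((i : ℕ) + 1)
    have h2 : (2 * ((((i : ℕ) + 1) % N : ℕ) + 1) / N : ℂ) =
      2 * (((((i : ℕ) + 1) % N : ℕ)) : ℂ) / N + 2 / N := by ring
    rw [h2, e_add, h1, ← e_add]
    congr 1
    push_cast
    ring
  · simp

theorem gMat_pow (N n : ℕ) :
    gMat N ^ n = Matrix.diagonal fun i : Fin N => e (2 * ((i : ℕ) + 1) / N) ^ n := by
  rw [gMat, Matrix.diagonal_pow]; rfl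

theorem gMat_pow_self (N : ℕ) : gMat N ^ N = 1 := by
  rw [gMat_pow, ← Matrix.diagonal_one]
  congr 1
  ext i
  have hN : (N : ℂ) ≠ 0 := by exact_mod_cast i.pos.ne'
  rw [← e_nat_mul, e_eq_one_iff]
  refine ⟨(i : ℕ) + 1, ?_⟩
  field_simp
  push_cast
  ring

theorem hMat_pow_apply (N n : ℕ) (i j : Fin N) :
    (hMat N ^ n) i j = if (j : ℕ) = ((i : ℕ) + n) % N then 1 else 0 := by
  induction n generalizing i with
  | zero => simp [Matrix.one_apply, Nat.mod_eq_of_lt i.isLt, Fin.ext_iff, eq_comm]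
  | succ n ih =>
    have hN : 0 < N := i.pos
    rw [pow_succ', Matrix.mul_apply, Finset.sum_eq_single ⟨((i : ℕ) + 1) % N, Nat.mod_lt _ hN⟩]
    · rw [ih]
      simp [hMat, add_assoc, add_comm 1 n]
    · intro k _ hk
      have : (k : ℕ) ≠ ((i : ℕ) + 1) % N := fun h => hk (Fin.ext h)
      simp [hMat, this]
    · simp

theorem hMat_pow_self (N : ℕ) : hMat N ^ N = 1 := by
  ext i j
  rw [hMat_pow_apply]
  simp [Matrix.one_apply, Nat.mod_eq_of_lt i.isLt, Fin.ext_iff, eq_comm]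

theorem hMat_pow_mul_gMat (N n : ℕ) :
    hMat N ^ n * gMat N = e (2 * n / N) • (gMat N * hMat N ^ n) := by
  induction n with
  | zero => simp
  | succ n ih =>
    rw [pow_succ, mul_assoc, hMat_mul_gMat, Matrix.mul_smul, ← mul_assoc, ih, Matrix.smul_mul,
      smul_smul, mul_assoc, ← e_add]
    congr 2
    push_cast
    ring

theorem hMat_pow_mul_gMat_pow (N n m : ℕ) :
    hMat N ^ n * gMat N ^ m = e (2 * (n * m) / N) • (gMat N ^ m * hMat N ^ n) := by
  induction m with
  | zero => simp
  | succ m ih =>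
    rw [pow_succ, ← mul_assoc, ih, Matrix.smul_mul, mul_assoc, hMat_pow_mul_gMat, Matrix.mul_smul,
      smul_smul, mul_assoc (gMat N ^ m), ← e_add]
    congr 2
    push_cast
    ring

theorem isUnit_gMat (N : ℕ) : IsUnit (gMat N) := by
  rcases Nat.eq_zero_or_pos N with rfl | hN
  · exact ⟨1, by ext i; exact i.elim0⟩
  · exact IsUnit.of_pow_eq_one (gMat_pow_self N) hN.ne'

theorem isUnit_hMat (N : ℕ) : IsUnit (hMat N) := by
  rcases Nat.eq_zero_or_pos N with rfl | hN
  · exact ⟨1, by ext i; exact i.elim0⟩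
  · exact IsUnit.of_pow_eq_one (hMat_pow_self N) hN.ne'

theorem isUnit_gHalf (N : ℕ) : IsUnit (gHalf N) := by
  rw [Matrix.isUnit_iff_isUnit_det, gHalf, Matrix.det_diagonal, isUnit_iff_ne_zero]
  exact Finset.prod_ne_zero_iff.2 fun i _ => e_ne_zero _

theorem gHalf_mul_gHalf (N : ℕ) : gHalf N * gHalf N = gMat N := by
  rw [gHalf, gMat, Matrix.diagonal_mul_diagonal]
  congr 1
  ext i
  rw [← e_add]
  congr 1
  ring

theorem isUnit_IMat (N : ℕ) (α : Fin N × Fin N) : IsUnit (IMat N α) :=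
  ((isUnit_gMat N).pow _).mul ((isUnit_hMat N).pow _)

theorem IMat_mul_IMat (N : ℕ) (α β : Fin N × Fin N) :
    IMat N α * IMat N β = e (2 * ((α.1 : ℕ) * (β.2 : ℕ)) / N) • IMat N (α + β) := by
  have h1 : gMat N ^ ((α.2 + β.2 : Fin N) : ℕ) = gMat N ^ ((α.2 : ℕ) + (β.2 : ℕ)) := by
    rw [Fin.val_add]
    exact (pow_eq_pow_mod _ (gMat_pow_self N)).symm
  have h2 : hMat N ^ ((α.1 + β.1 : Fin N) : ℕ) = hMat N ^ ((α.1 : ℕ) + (β.1 : ℕ)) := by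
    rw [Fin.val_add]
    exact (pow_eq_pow_mod _ (hMat_pow_self N)).symm
  rw [IMat, IMat, IMat, Prod.fst_add, Prod.snd_add, h1, h2, pow_add, pow_add,
    show gMat N ^ (α.2 : ℕ) * hMat N ^ (α.1 : ℕ) * (gMat N ^ (β.2 : ℕ) * hMat N ^ (β.1 : ℕ)) =
      gMat N ^ (α.2 : ℕ) * (hMat N ^ (α.1 : ℕ) * gMat N ^ (β.2 : ℕ)) * hMat N ^ (β.1 : ℕ) by
      simp only [mul_assoc],
    hMat_pow_mul_gMat_pow, Matrix.mul_smul, Matrix.smul_mul]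
  simp only [mul_assoc]

theorem inv_smul_of_isUnit {n : Type*} [Fintype n] [DecidableEq n] {A : Matrix n n ℂ}
    (hA : IsUnit A) {k : ℂ} (hk : k ≠ 0) : (k • A)⁻¹ = k⁻¹ • A⁻¹ := by
  refine Matrix.inv_eq_right_inv ?_
  rw [Matrix.smul_mul, Matrix.mul_smul, smul_smul, mul_inv_cancel₀ hk, one_smul,
    Matrix.mul_nonsing_inv _ ((Matrix.isUnit_iff_isUnit_det A).1 hA)]

theorem IMat_inv_mul_IMat_inv (N : ℕ) (α β : Fin N × Fin N) :
    (IMat N α)⁻¹ * (IMat N β)⁻¹ =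
      e (-(2 * ((β.1 : ℕ) * (α.2 : ℕ)) / N)) • (IMat N (α + β))⁻¹ := by
  rw [← Matrix.mul_inv_rev, IMat_mul_IMat, inv_smul_of_isUnit (isUnit_IMat N _) (e_ne_zero _),
    e_neg, add_comm]

theorem IMat_zero (N : ℕ) [NeZero N] : IMat N 0 = 1 := by simp [IMat]

/-- The cocycles of the two tensor factors combine to the symplectic form of `α` and `β`. In
`contract_IMat` they cancel instead, which is why unitarity has a phase in its convolution and
crossing has none. -/
theorem IMat_kronecker_mul (N : ℕ) (α β : Fin N × Fin N) :
    (IMat N α ⊗ₖ (IMat N α)⁻¹) * (IMat N β ⊗ₖ (IMat N β)⁻¹) =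
      e (2 * ((α.1 : ℕ) * (β.2 : ℕ) - (α.2 : ℕ) * (β.1 : ℕ)) / N) •
        (IMat N (α + β) ⊗ₖ (IMat N (α + β))⁻¹) := by
  rw [← Matrix.mul_kronecker_mul, IMat_mul_IMat, IMat_inv_mul_IMat_inv, Matrix.smul_kronecker,
    Matrix.kronecker_smul, smul_smul, ← e_add]
  congr 2
  ring

/-! ### Contraction along the first tensor factor -/

/-- The contraction of two matrices of the tensor square: the product in the second factor, and
the product of the transposes in the first one. -/
def contract {n R : Type*} [Fintype n] [NonUnitalNonAssocSemiring R]
    (X Y : Matrix (n × n) (n × n) R) : Matrix (n × n) (n × n) R :=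
  Matrix.of fun i j => ∑ a, ∑ l, X (a, i.2) (i.1, l) * Y (j.1, l) (a, j.2)

theorem contract_sum_sum {n ι κ : Type*} [Fintype n] (s : Finset ι) (t : Finset κ)
    (x : ι → ℂ) (y : κ → ℂ) (X : ι → Matrix (n × n) (n × n) ℂ) (Y : κ → Matrix (n × n) (n × n) ℂ) :
    contract (∑ i ∈ s, x i • X i) (∑ k ∈ t, y k • Y k) =
      ∑ i ∈ s, ∑ k ∈ t, (x i * y k) • contract (X i) (Y k) := by
  ext p q
  simp only [contract, Matrix.of_apply, Matrix.sum_apply, Matrix.smul_apply, smul_eq_mul,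
    Finset.sum_mul_sum]
  have h1 : ∀ a : n, ∑ l : n, ∑ i ∈ s, ∑ j ∈ t, x i * X i (a, p.2) (p.1, l) *
      (y j * Y j (q.1, l) (a, q.2)) = ∑ i ∈ s, ∑ j ∈ t, ∑ l : n,
      x i * y j * (X i (a, p.2) (p.1, l) * Y j (q.1, l) (a, q.2)) := fun a => by
    rw [Finset.sum_comm]
    refine Finset.sum_congr rfl fun i _ => ?_
    rw [Finset.sum_comm]
    exact Finset.sum_congr rfl fun j _ => Finset.sum_congr rfl fun l _ => by ring
  rw [Finset.sum_congr rfl fun a _ => h1 a, Finset.sum_comm]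
  simp only [Finset.mul_sum]
  exact Finset.sum_congr rfl fun i _ => Finset.sum_comm

theorem contract_smul_smul {n : Type*} [Fintype n] (x y : ℂ) (X Y : Matrix (n × n) (n × n) ℂ) :
    contract (x • X) (y • Y) = (x * y) • contract X Y := by
  have := contract_sum_sum (Finset.univ (α := Unit)) (Finset.univ (α := Unit)) (fun _ => x)
    (fun _ => y) (fun _ => X) (fun _ => Y)
  simpa using this

theorem contract_kronecker {n : Type*} [Fintype n] (A B C D : Matrix n n ℂ) :
    contract (A ⊗ₖ B) (C ⊗ₖ D) = (C * A).transpose ⊗ₖ (B * D) := by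
  ext p q
  simp only [contract, Matrix.of_apply, Matrix.kroneckerMap_apply, Matrix.transpose_apply,
    Matrix.mul_apply, Finset.sum_mul_sum]
  exact Finset.sum_congr rfl fun a _ => Finset.sum_congr rfl fun l _ => by ring

/-- Contraction is compatible with conjugation by `A ⊗ A` for diagonal `A`. -/
theorem contract_conj_diagonal {n : Type*} [Fintype n] [DecidableEq n] {d : n → ℂ}
    (hd : ∀ i, d i ≠ 0) (X Y : Matrix (n × n) (n × n) ℂ) {k : ℂ} (h : contract X Y = k • 1) :
    contract ((Matrix.diagonal d ⊗ₖ Matrix.diagonal d) * X *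
        (Matrix.diagonal (fun i => (d i)⁻¹) ⊗ₖ Matrix.diagonal fun i => (d i)⁻¹))
      ((Matrix.diagonal d ⊗ₖ Matrix.diagonal d) * Y *
        (Matrix.diagonal (fun i => (d i)⁻¹) ⊗ₖ Matrix.diagonal fun i => (d i)⁻¹)) = k • 1 := by
  ext p q
  have h1 := congrFun (congrFun h p) q
  simp only [contract, Matrix.of_apply] at h1
  simp only [contract, Matrix.of_apply, Matrix.diagonal_kronecker_diagonal, Matrix.mul_diagonal,
    Matrix.diagonal_mul]
  -- The diagonal entries at the summation indices `a`, `l` cancel. What is left depends on `p` and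
  -- `q` only and equals 1 when `p = q`.
  have h2 : ∀ a l, d a * d p.2 * X (a, p.2) (p.1, l) * ((d p.1)⁻¹ * (d l)⁻¹) *
      (d q.1 * d l * Y (q.1, l) (a, q.2) * ((d a)⁻¹ * (d q.2)⁻¹)) =
      d p.2 * (d p.1)⁻¹ * d q.1 * (d q.2)⁻¹ * (X (a, p.2) (p.1, l) * Y (q.1, l) (a, q.2)) := by
    intro a l
    have := hd a
    have := hd l
    field_simp
  simp only [h2, ← Finset.mul_sum, h1]
  simp only [Matrix.smul_apply, Matrix.one_apply, smul_eq_mul]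
  split_ifs with hpq
  · have := hd p.1
    have := hd p.2
    subst hpq
    field_simp
  · simp

/-! ### The `R`-matrix without normalization -/

/-- The exponentials from `theta_add_char` in numerator and denominator cancel except for their
dependence on `ξ`. -/
theorem W_eq_coeff {N : ℕ} (α : Fin N × Fin N) (ξ ζ τ : ℂ) :
    W N α ξ ζ τ = 1 / N * coeff τ N (ζ / N) ξ (α.1 : ℕ) (α.2 : ℕ) := by
  have hN : (N : ℂ) ≠ 0 := by exact_mod_cast α.1.pos.ne'
  rw [W, theta_add_char, theta_add_char, coeff]
  congr 1
  have h1 : ((α.1 : ℕ) / N * τ + (α.2 : ℕ) / N : ℂ) =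
      ((((α.1 : ℕ) : ℤ) : ℂ) * τ + (((α.2 : ℕ) : ℤ) : ℂ)) / N := by push_cast; ring
  have h2 : (((α.1 : ℕ) : ℂ) / N) ^ 2 * τ + 2 * ((α.1 : ℕ) / N) *
      (ξ + ζ / N + 1 / 2 + (α.2 : ℕ) / N) = 2 * (((α.1 : ℕ) : ℤ) : ℂ) * ξ / N +
      ((((α.1 : ℕ) : ℂ) / N) ^ 2 * τ + 2 * ((α.1 : ℕ) / N) * (ζ / N + 1 / 2 + (α.2 : ℕ) / N)) := by
    push_cast; ring
  rw [h1, h2, e_add, mul_assoc, mul_div_assoc, mul_div_mul_left _ _ (e_ne_zero _)]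
  rfl

/-- Periodicity modulo `N` in both characteristics makes subtraction in `Fin N` and in ℤ
interchangeable, so the integer convolution sums apply to the group (ℤ/N)². -/
theorem coeff_add_mul {N : ℕ} (hN : N ≠ 0) (τ v x : ℂ) (a b k l : ℤ) :
    coeff τ N v x (a + N * k) (b + N * l) = coeff τ N v x a b := by
  have hN' : (N : ℂ) ≠ 0 := by exact_mod_cast hN
  have h1 : (((a + N * k : ℤ) : ℂ) * τ + ((b + N * l : ℤ) : ℂ)) / N =
      (a * τ + b) / N + (k * τ + l) := by push_cast; field_simp; ring
  rw [coeff, coeff, h1, ← add_assoc (x + v), ← add_assoc v, th_add_lattice, th_add_lattice,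
    show e (2 * ((a + N * k : ℤ) : ℂ) * x / N) = e (2 * a * x / N) * e (2 * k * x) by
      rw [← e_add]; congr 1; push_cast; field_simp,
    show -((k : ℂ) ^ 2 * τ + 2 * k * (x + v + (a * τ + b) / N)) + l + k =
      -(2 * k * x) + (-((k : ℂ) ^ 2 * τ + 2 * k * (v + (a * τ + b) / N)) + l + k) by ring,
    e_add (-(2 * k * x)), mul_assoc (e (-(2 * k * x))), mul_div_assoc (e (-(2 * k * x))),
    mul_div_mul_left _ _ (e_ne_zero _), e_neg, mul_assoc (e (2 * a * x / N)),
    mul_inv_cancel_left₀ (e_ne_zero _)]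

theorem exists_fin_sub_eq {N : ℕ} (a b : Fin N) :
    ∃ k : ℤ, (((a - b : Fin N) : ℕ) : ℤ) = ((a : ℕ) : ℤ) - ((b : ℕ) : ℤ) + N * k := by
  have hb := b.isLt
  refine ⟨1 - ((N - (b : ℕ) + (a : ℕ)) / N : ℕ), ?_⟩
  have h : ((a - b : Fin N) : ℕ) = (N - (b : ℕ) + (a : ℕ)) % N := rfl
  have h2 := Nat.div_add_mod (N - (b : ℕ) + (a : ℕ)) N
  rw [← h] at h2
  have h3 : ((N * ((N - (b : ℕ) + (a : ℕ)) / N) + ((a - b : Fin N) : ℕ) : ℕ) : ℤ) =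
      N - (b : ℕ) + (a : ℕ) := by rw [h2]; omega
  rw [Nat.cast_add, Nat.cast_mul] at h3
  linear_combination h3

theorem coeff_fin_sub {N : ℕ} (τ v x : ℂ) (γ α : Fin N × Fin N) :
    coeff τ N v x ((γ - α).1 : ℕ) ((γ - α).2 : ℕ) =
      coeff τ N v x (((γ.1 : ℕ) : ℤ) - (α.1 : ℕ)) (((γ.2 : ℕ) : ℤ) - (α.2 : ℕ)) := by
  obtain ⟨k, hk⟩ := exists_fin_sub_eq γ.1 α.1
  obtain ⟨l, hl⟩ := exists_fin_sub_eq γ.2 α.2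
  rw [Prod.fst_sub, Prod.snd_sub, hk, hl, coeff_add_mul γ.1.pos.ne']

theorem e_fin_sub {N : ℕ} (γ α : Fin N × Fin N) :
    e (2 * ((α.1 : ℕ) * ((γ - α).2 : ℕ) - (α.2 : ℕ) * ((γ - α).1 : ℕ)) / N) =
      e (2 * ((α.1 : ℕ) * (((γ.2 : ℕ) : ℤ) : ℂ) - (α.2 : ℕ) * (((γ.1 : ℕ) : ℤ) : ℂ)) / N) := by
  have hN' : (N : ℂ) ≠ 0 := by exact_mod_cast γ.1.pos.ne'
  obtain ⟨k, hk⟩ := exists_fin_sub_eq γ.1 α.1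
  obtain ⟨l, hl⟩ := exists_fin_sub_eq γ.2 α.2
  have hk' : (((γ.1 - α.1 : Fin N) : ℕ) : ℂ) = (γ.1 : ℕ) - (α.1 : ℕ) + N * k := by exact_mod_cast hk
  have hl' : (((γ.2 - α.2 : Fin N) : ℕ) : ℂ) = (γ.2 : ℕ) - (α.2 : ℕ) + N * l := by exact_mod_cast hl
  rw [Prod.fst_sub, Prod.snd_sub, hk', hl', e_eq_e_iff]
  refine ⟨(α.1 : ℕ) * l - (α.2 : ℕ) * k, ?_⟩
  push_cast
  field_simp
  ring

theorem not_dvd_of_ne_zero {N : ℕ} [NeZero N] {γ : Fin N × Fin N} (h : γ ≠ 0) :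
    ¬ ((N : ℤ) ∣ ((γ.1 : ℕ) : ℤ) ∧ (N : ℤ) ∣ ((γ.2 : ℕ) : ℤ)) := by
  rintro ⟨h1, h2⟩
  refine h (Prod.ext (Fin.ext ?_) (Fin.ext ?_))
  · exact Nat.eq_zero_of_dvd_of_lt (Int.natCast_dvd_natCast.1 h1) γ.1.isLt
  · exact Nat.eq_zero_of_dvd_of_lt (Int.natCast_dvd_natCast.1 h2) γ.2.isLt

/-- The `R`-matrix in the symmetric gauge, without its scalar prefactor. -/
def rSym (N : ℕ) (ξ ζ τ : ℂ) : Matrix (Fin N × Fin N) (Fin N × Fin N) ℂ :=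
  ∑ α : Fin N × Fin N, W N α ξ ζ τ • (IMat N α ⊗ₖ (IMat N α)⁻¹)

/-- Collecting the terms with `α + β = γ` gives the phased convolution of coefficients in front of
the matrix indexed by `γ`, so only `γ = 0` contributes. Replacing `ζ` by `-ζ` thus produces the
inverse up to a scalar. -/
theorem rSym_mul_rSym {τ : ℂ} (hτ : 0 < τ.im) {N : ℕ} (hN : N ≠ 0) {ξ ζ : ℂ}
    (hξ : th τ ξ ≠ 0) (hζ : th τ ζ ≠ 0) :
    rSym N ξ ζ τ * rSym N ξ (-ζ) τ =
      (th τ (ξ + ζ) * th τ (ξ - ζ) / -th τ ζ ^ 2) • (1 : Matrix _ _ ℂ) := by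
  have : NeZero N := ⟨hN⟩
  have hN' : (N : ℂ) ≠ 0 := by exact_mod_cast hN
  have hNv : (N : ℂ) * (ζ / N) = ζ := mul_div_cancel₀ _ hN'
  have hζ' : th τ (N * (ζ / N)) ≠ 0 := by rwa [hNv]
  have h1 : rSym N ξ ζ τ * rSym N ξ (-ζ) τ = ∑ γ : Fin N × Fin N,
      (1 / (N : ℂ) ^ 2 * ∑ α : Fin N × Fin N,
        e (2 * ((α.1 : ℕ) * (((γ.2 : ℕ) : ℤ) : ℂ) - (α.2 : ℕ) * (((γ.1 : ℕ) : ℤ) : ℂ)) / N) *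
        (coeff τ N (ζ / N) ξ (α.1 : ℕ) (α.2 : ℕ) * coeff τ N (-(ζ / N)) ξ
          (((γ.1 : ℕ) : ℤ) - (α.1 : ℕ)) (((γ.2 : ℕ) : ℤ) - (α.2 : ℕ)))) •
        (IMat N γ ⊗ₖ (IMat N γ)⁻¹) := by
    rw [rSym, rSym, Finset.sum_mul_sum]
    simp only [Finset.mul_sum, Finset.sum_smul]
    refine Eq.trans ?_ Finset.sum_comm
    refine Finset.sum_congr rfl fun α _ => ?_
    rw [← (Equiv.subRight α).sum_comp]
    refine Finset.sum_congr rfl fun γ _ => ?_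
    rw [Equiv.subRight_apply, Matrix.smul_mul, Matrix.mul_smul, IMat_kronecker_mul, smul_smul,
      smul_smul, add_sub_cancel, W_eq_coeff, W_eq_coeff, coeff_fin_sub, e_fin_sub, neg_div]
    congr 1
    ring
  rw [h1, Finset.sum_eq_single 0]
  · have := coeff_unitarity_zero hτ hN hξ hζ'
    rw [hNv] at this
    simp only [Prod.fst_zero, Prod.snd_zero, Fin.val_zero, Nat.cast_zero, Int.cast_zero, mul_zero,
      sub_zero, zero_div, e_zero, one_mul, this, IMat_zero, inv_one, Matrix.one_kronecker_one]
    congr 1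
    field_simp
  · intro γ _ hγ
    rw [coeff_unitarity_of_ne hτ hN hξ hζ' (not_dvd_of_ne_zero hγ), mul_zero, zero_smul]
  · simp

theorem contract_IMat {N : ℕ} (α β : Fin N × Fin N) :
    contract (IMat N α ⊗ₖ (IMat N α)⁻¹) (IMat N β ⊗ₖ (IMat N β)⁻¹) =
      (IMat N (α + β)).transpose ⊗ₖ (IMat N (α + β))⁻¹ := by
  rw [contract_kronecker, IMat_mul_IMat, IMat_inv_mul_IMat_inv, Matrix.transpose_smul,
    Matrix.smul_kronecker, Matrix.kronecker_smul, smul_smul, e_neg,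
    mul_inv_cancel₀ (e_ne_zero _), one_smul, add_comm β α]

theorem contract_rSym_rSym {τ : ℂ} (hτ : 0 < τ.im) {N : ℕ} (hN : N ≠ 0) {ξ ζ : ℂ}
    (hξ : th τ ξ ≠ 0) (hξ' : th τ (ξ - N * ζ) ≠ 0) (hζ : th τ ζ ≠ 0) :
    contract (rSym N (ξ - N * ζ) ζ τ) (rSym N ξ (-ζ) τ) =
      (th τ ξ * th τ (ξ - N * ζ) / -th τ ζ ^ 2) • (1 : Matrix _ _ ℂ) := by
  have : NeZero N := ⟨hN⟩
  have hN' : (N : ℂ) ≠ 0 := by exact_mod_cast hN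
  have hNv : (N : ℂ) * (ζ / N) = ζ := mul_div_cancel₀ _ hN'
  have hζ' : th τ (N * (ζ / N)) ≠ 0 := by rwa [hNv]
  have hξ'' : th τ (ξ - N * (N * (ζ / N))) ≠ 0 := by rwa [hNv]
  have h1 : contract (rSym N (ξ - N * ζ) ζ τ) (rSym N ξ (-ζ) τ) = ∑ γ : Fin N × Fin N,
      (1 / (N : ℂ) ^ 2 * ∑ α : Fin N × Fin N,
        coeff τ N (ζ / N) (ξ - N * (N * (ζ / N))) (α.1 : ℕ) (α.2 : ℕ) * coeff τ N (-(ζ / N)) ξ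
          (((γ.1 : ℕ) : ℤ) - (α.1 : ℕ)) (((γ.2 : ℕ) : ℤ) - (α.2 : ℕ))) •
        ((IMat N γ).transpose ⊗ₖ (IMat N γ)⁻¹) := by
    rw [rSym, rSym, contract_sum_sum]
    simp only [Finset.mul_sum, Finset.sum_smul]
    refine Eq.trans ?_ Finset.sum_comm
    refine Finset.sum_congr rfl fun α _ => ?_
    rw [← (Equiv.subRight α).sum_comp]
    refine Finset.sum_congr rfl fun γ _ => ?_
    rw [Equiv.subRight_apply, contract_IMat, add_sub_cancel, W_eq_coeff, W_eq_coeff,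
      coeff_fin_sub, neg_div, hNv]
    congr 1
    ring
  rw [h1, Finset.sum_eq_single 0]
  · have := coeff_crossing_zero hτ hN hξ hξ'' hζ'
    rw [hNv] at this
    simp only [Prod.fst_zero, Prod.snd_zero, Fin.val_zero, Nat.cast_zero, hNv, this, IMat_zero,
      inv_one, Matrix.transpose_one, Matrix.one_kronecker_one]
    congr 1
    field_simp
  · intro γ _ hγ
    rw [coeff_crossing_of_ne hτ hN hξ hξ'' hζ' (not_dvd_of_ne_zero hγ), mul_zero, zero_smul]
  · simp

/-! ### Quasi-periodicity of the `R`-matrix in the symmetric gauge. -/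

theorem gMat_mul_IMat (N : ℕ) (α : Fin N × Fin N) :
    e (2 * (α.1 : ℕ) / N) • (gMat N * IMat N α) = IMat N α * gMat N := by
  rw [IMat, mul_assoc, hMat_pow_mul_gMat, Matrix.mul_smul, ← mul_assoc, ← mul_assoc,
    (Commute.refl (gMat N)).pow_right (α.2 : ℕ) |>.eq]

theorem hMat_mul_IMat (N : ℕ) (α : Fin N × Fin N) :
    hMat N * IMat N α = e (2 * (α.2 : ℕ) / N) • (IMat N α * hMat N) := by
  have := hMat_pow_mul_gMat_pow N 1 (α.2 : ℕ)
  rw [pow_one, Nat.cast_one, one_mul] at this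
  rw [IMat, ← mul_assoc, this, Matrix.smul_mul, mul_assoc, mul_assoc,
    (Commute.refl (hMat N)).pow_right (α.1 : ℕ) |>.eq]

theorem W_add_one {N : ℕ} (α : Fin N × Fin N) (ξ ζ τ : ℂ) :
    W N α (ξ + 1) ζ τ = -e (2 * (α.1 : ℕ) / N) * W N α ξ ζ τ := by
  rw [W_eq_coeff, W_eq_coeff, coeff, coeff, mul_add, mul_one, add_div, e_add,
    show ξ + 1 + ζ / N + ((((α.1 : ℕ) : ℤ) : ℂ) * τ + (((α.2 : ℕ) : ℤ) : ℂ)) / N =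
      ξ + ζ / N + ((((α.1 : ℕ) : ℤ) : ℂ) * τ + (((α.2 : ℕ) : ℤ) : ℂ)) / N + 1 by ring, th_add_one]
  push_cast
  ring

theorem W_add_tau {N : ℕ} (α : Fin N × Fin N) (ξ ζ τ : ℂ) :
    e (2 * (α.2 : ℕ) / N) * W N α (ξ + τ) ζ τ = -e (-(τ + 2 * ξ + 2 * ζ / N)) * W N α ξ ζ τ := by
  have hN' : (N : ℂ) ≠ 0 := by exact_mod_cast α.1.pos.ne'
  rw [W_eq_coeff, W_eq_coeff, coeff, coeff, mul_add, add_div, e_add,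
    show ξ + τ + ζ / N + ((((α.1 : ℕ) : ℤ) : ℂ) * τ + (((α.2 : ℕ) : ℤ) : ℂ)) / N =
      ξ + ζ / N + ((((α.1 : ℕ) : ℤ) : ℂ) * τ + (((α.2 : ℕ) : ℤ) : ℂ)) / N + τ by ring, th_add_tau]
  have : e (-(τ + 2 * ξ + 2 * ζ / N)) = e (2 * (α.2 : ℕ) / N) *
      e (2 * (((α.1 : ℕ) : ℤ) : ℂ) * τ / N) *
      e (-(τ + 2 * (ξ + ζ / N + ((((α.1 : ℕ) : ℤ) : ℂ) * τ + (((α.2 : ℕ) : ℤ) : ℂ)) / N))) := by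
    rw [← e_add, ← e_add]; congr 1; push_cast; ring
  rw [this]
  ring

/-- Conjugation by `g` scales the matrix indexed by `α` by a root of unity, which `W_add_one`
compensates up to a sign independent of `α`. The shift by `τ` is handled by `h` in the same way. -/
theorem gMat_mul_rSym_add_one (N : ℕ) (ξ ζ τ : ℂ) :
    (gMat N ⊗ₖ (1 : Matrix (Fin N) (Fin N) ℂ)) * rSym N (ξ + 1) ζ τ =
      -(rSym N ξ ζ τ * (gMat N ⊗ₖ (1 : Matrix (Fin N) (Fin N) ℂ))) := by
  rw [rSym, rSym, Finset.mul_sum, Finset.sum_mul, ← Finset.sum_neg_distrib]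
  refine Finset.sum_congr rfl fun α _ => ?_
  rw [Matrix.mul_smul, Matrix.smul_mul, ← Matrix.mul_kronecker_mul, ← Matrix.mul_kronecker_mul,
    ← gMat_mul_IMat, Matrix.smul_kronecker, smul_smul, W_add_one, one_mul, mul_one, ← neg_smul]
  congr 1
  ring

theorem hMat_mul_rSym_add_tau (N : ℕ) (ξ ζ τ : ℂ) :
    (hMat N ⊗ₖ (1 : Matrix (Fin N) (Fin N) ℂ)) * rSym N (ξ + τ) ζ τ =
      -e (-(τ + 2 * ξ + 2 * ζ / N)) •
        (rSym N ξ ζ τ * (hMat N ⊗ₖ (1 : Matrix (Fin N) (Fin N) ℂ))) := by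
  rw [rSym, rSym, Finset.mul_sum, Finset.sum_mul, Finset.smul_sum]
  refine Finset.sum_congr rfl fun α _ => ?_
  rw [Matrix.mul_smul, Matrix.smul_mul, ← Matrix.mul_kronecker_mul, ← Matrix.mul_kronecker_mul,
    hMat_mul_IMat, Matrix.smul_kronecker, smul_smul, smul_smul, one_mul, mul_one, ← W_add_tau,
    mul_comm]

/-! ### Regular arguments and the normalization factor -/

/-- `y` is not in the multiplicative group generated by `q²` and `p`. -/
def Regular (q p y : ℂ) : Prop := ∀ a b : ℤ, y ≠ q ^ (2 * a) * p ^ b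

theorem Regular.mul {q p y : ℂ} (hq : q ≠ 0) (hp : p ≠ 0) (h : Regular q p y) (a b : ℤ) :
    Regular q p (q ^ (2 * a) * p ^ b * y) := fun a' b' h' => by
  refine h (a' - a) (b' - b) ?_
  rw [mul_sub, zpow_sub₀ hq, zpow_sub₀ hp]
  field_simp
  linear_combination h'

theorem Regular.inv {q p y : ℂ} (h : Regular q p y) : Regular q p y⁻¹ := fun a b h' => by
  refine h (-a) (-b) ?_
  rw [← inv_inv y, h', mul_neg, zpow_neg, zpow_neg, mul_inv]

theorem Regular.q_pow_mul {q p y : ℂ} (hq : q ≠ 0) (hp : p ≠ 0) (h : Regular q p y) (n : ℕ) :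
    Regular q p (q ^ (2 * n) * y) := by
  have := h.mul hq hp n 0
  rw [zpow_zero, mul_one] at this
  exact_mod_cast this

theorem Regular.q_sq_mul {q p y : ℂ} (hq : q ≠ 0) (hp : p ≠ 0) (h : Regular q p y) :
    Regular q p (q ^ 2 * y) := h.q_pow_mul hq hp 1

theorem Regular.p_mul {q p y : ℂ} (hq : q ≠ 0) (hp : p ≠ 0) (h : Regular q p y) :
    Regular q p (p * y) := by
  have := h.mul hq hp 0 1
  rwa [mul_zero, zpow_zero, one_mul, zpow_one] at this

theorem Regular.p_zpow_mul {q p y : ℂ} (hq : q ≠ 0) (hp : p ≠ 0) (h : Regular q p y) (b : ℤ) :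
    Regular q p (p ^ b * y) := by
  have := h.mul hq hp 0 b
  rwa [mul_zero, zpow_zero, one_mul] at this

theorem Regular.poch₂_ne_zero {q p y : ℂ} (hq1 : ‖q‖ < 1) (hp1 : ‖p‖ < 1)
    {N : ℕ} (hN : N ≠ 0) (h : Regular q p y) : poch₂ y p (q ^ (2 * N)) ≠ 0 := by
  refine EllipticW.poch₂_ne_zero hp1 ?_ fun n m hnm => ?_
  · rw [norm_pow]
    exact pow_lt_one₀ (norm_nonneg _) hq1 (by omega)
  · refine h (-(N * m)) (-n) ?_
    rw [mul_neg, zpow_neg, zpow_neg, ← mul_inv]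
    refine eq_inv_of_mul_eq_one_left ?_
    rw [← hnm, ← pow_mul]
    have : q ^ (2 * ((N : ℤ) * m)) = q ^ (2 * N * m) := by
      rw [← zpow_natCast]; congr 1; push_cast; ring
    rw [this, zpow_natCast]
    ring

theorem Regular.Theta_q_ne_zero {q p y : ℂ} (hq : q ≠ 0) (hq1 : ‖q‖ < 1)
    {N : ℕ} (hN : N ≠ 0) (hy : y ≠ 0) (h : Regular q p y) : Theta (q ^ (2 * N)) y ≠ 0 := by
  refine Theta_ne_zero ?_ (pow_ne_zero _ hq) hy fun n hn => ?_
  · rw [norm_pow]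
    exact pow_lt_one₀ (norm_nonneg _) hq1 (by omega)
  · refine h (N * n) 0 ?_
    rw [hn, zpow_zero, mul_one, ← zpow_natCast, ← zpow_mul]
    congr 1
    push_cast
    ring

theorem norm_pow_two_mul_lt_one {q : ℂ} (hq1 : ‖q‖ < 1) {N : ℕ} (hN : N ≠ 0) :
    ‖q ^ (2 * N)‖ < 1 := by
  rw [norm_pow]
  exact pow_lt_one₀ (norm_nonneg _) hq1 (by omega)

/-- The shift `y ↦ p y` strips one simple product off each double product or adds one to it; the
eight simple products regroup into four theta functions of base `q^{2N}`. -/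
theorem kappaInv_p_mul {q p y : ℂ} (hq : q ≠ 0) (hp : p ≠ 0) (hq1 : ‖q‖ < 1) (hp1 : ‖p‖ < 1)
    {N : ℕ} (hN : N ≠ 0) (hy : y ≠ 0) (h : Regular q p y) :
    kappaInv N (p * y) q p * (Theta (q ^ (2 * N)) (q ^ 2 * y) *
      Theta (q ^ (2 * N)) (q ^ 2 * (p * y)⁻¹)) =
      Theta (q ^ (2 * N)) (p * y) * Theta (q ^ (2 * N)) y⁻¹ * kappaInv N y q p := by
  have hQ1 := norm_pow_two_mul_lt_one hq1 hN
  have hQ' : q ^ (2 * N) = q ^ (2 * N - 2) * q ^ 2 := by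
    rw [← pow_add]; congr 1; omega
  have hNN : 2 * N - 2 = 2 * (N - 1) := by omega
  have hpy := h.p_mul hq hp
  have n1 := (h.inv.q_pow_mul hq hp N).poch₂_ne_zero hq1 hp1 hN
  have n2 := (hpy.q_sq_mul hq hp).poch₂_ne_zero hq1 hp1 hN
  have n3 := (h.inv.p_mul hq hp).poch₂_ne_zero hq1 hp1 hN
  have n4 := ((hpy.q_pow_mul hq hp (N - 1)).p_mul hq hp).poch₂_ne_zero hq1 hp1 hN
  have n5 := (h.q_pow_mul hq hp N).poch₂_ne_zero hq1 hp1 hN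
  have n6 := (hpy.inv.q_sq_mul hq hp).poch₂_ne_zero hq1 hp1 hN
  have n7 := (h.p_mul hq hp).poch₂_ne_zero hq1 hp1 hN
  have n8 := ((hpy.inv.q_pow_mul hq hp (N - 1)).p_mul hq hp).poch₂_ne_zero hq1 hp1 hN
  rw [← hNN, ← mul_assoc] at n4 n8
  have a1 := poch₂_eq_left (q ^ (2 * N) * (p * y)⁻¹) hp1 hQ1
  have a2 := poch₂_eq_left (q ^ 2 * y) hp1 hQ1
  have a3 := poch₂_eq_left (p * (p * y)⁻¹) hp1 hQ1
  have a4 := poch₂_eq_left (p * q ^ (2 * N - 2) * y) hp1 hQ1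
  have a5 := poch₂_eq_left (q ^ (2 * N) * y) hp1 hQ1
  have a6 := poch₂_eq_left (q ^ 2 * (p * y)⁻¹) hp1 hQ1
  have a7 := poch₂_eq_left (p * y) hp1 hQ1
  have a8 := poch₂_eq_left (p * q ^ (2 * N - 2) * (p * y)⁻¹) hp1 hQ1
  rw [show q ^ (2 * N) * (p * y)⁻¹ * p = q ^ (2 * N) * y⁻¹ by field_simp] at a1
  rw [show q ^ 2 * y * p = q ^ 2 * (p * y) by ring] at a2
  rw [show p * (p * y)⁻¹ * p = p * y⁻¹ by field_simp] at a3
  rw [show p * q ^ (2 * N - 2) * y * p = p * q ^ (2 * N - 2) * (p * y) by ring] at a4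
  rw [show q ^ (2 * N) * y * p = q ^ (2 * N) * (p * y) by ring] at a5
  rw [show q ^ 2 * (p * y)⁻¹ * p = q ^ 2 * y⁻¹ by field_simp] at a6
  rw [show p * y * p = p * (p * y) by ring] at a7
  rw [show p * q ^ (2 * N - 2) * (p * y)⁻¹ * p = p * q ^ (2 * N - 2) * y⁻¹ by field_simp] at a8
  have t1 : q ^ (2 * N) * (q ^ 2 * y)⁻¹ = p * q ^ (2 * N - 2) * (p * y)⁻¹ := by
    rw [hQ']; field_simp
  have t2 : q ^ (2 * N) * (q ^ 2 * (p * y)⁻¹)⁻¹ = p * q ^ (2 * N - 2) * y := by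
    rw [hQ']; field_simp
  have t3 : q ^ (2 * N) * (y⁻¹)⁻¹ = q ^ (2 * N) * y := by rw [inv_inv]
  have t4 : p * (p * y)⁻¹ = y⁻¹ := by field_simp
  rw [t4] at a3
  rw [kappaInv, kappaInv, Theta, Theta, Theta, Theta, t1, t2, t3, t4]
  rw [a5] at n5
  rw [a6] at n6
  rw [a7] at n7
  rw [a8] at n8
  rw [a1, a2, a3, a4, a5, a6, a7, a8]
  have m5 := left_ne_zero_of_mul n5
  have m6 := left_ne_zero_of_mul n6
  have m7 := left_ne_zero_of_mul n7
  have m8 := left_ne_zero_of_mul n8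
  have l5 := right_ne_zero_of_mul n5
  have l6 := right_ne_zero_of_mul n6
  have l7 := right_ne_zero_of_mul n7
  have l8 := right_ne_zero_of_mul n8
  -- Once the infinite products are opaque symbols, only an identity of rational functions remains.
  generalize poch₂ (q ^ (2 * N) * y⁻¹) p (q ^ (2 * N)) = x1 at *
  generalize poch₂ (q ^ 2 * (p * y)) p (q ^ (2 * N)) = x2 at *
  generalize poch₂ (p * y⁻¹) p (q ^ (2 * N)) = x3 at *
  generalize poch₂ (p * q ^ (2 * N - 2) * (p * y)) p (q ^ (2 * N)) = x4 at *
  generalize poch₂ (q ^ (2 * N) * (p * y)) p (q ^ (2 * N)) = x5 at *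
  generalize poch₂ (q ^ 2 * y⁻¹) p (q ^ (2 * N)) = x6 at *
  generalize poch₂ (p * (p * y)) p (q ^ (2 * N)) = x7 at *
  generalize poch₂ (p * q ^ (2 * N - 2) * y⁻¹) p (q ^ (2 * N)) = x8 at *
  generalize poch (q ^ (2 * N) * y) (q ^ (2 * N)) = P5 at *
  generalize poch (q ^ 2 * (p * y)⁻¹) (q ^ (2 * N)) = P6 at *
  generalize poch (p * y) (q ^ (2 * N)) = P7 at *
  generalize poch (p * q ^ (2 * N - 2) * (p * y)⁻¹) (q ^ (2 * N)) = P8 at *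
  clear a1 a2 a3 a4 a5 a6 a7 a8 t1 t2 t3 t4
  field_simp

/-- The same bookkeeping in the other base: the shift by `q^{2N}` leaves theta functions of base
`p`, which the triple product converts into `th` in `prefactor_crossing`. -/
theorem kappaInv_q_mul {q p y : ℂ} (hq : q ≠ 0) (hp : p ≠ 0) (hq1 : ‖q‖ < 1) (hp1 : ‖p‖ < 1)
    {N : ℕ} (hN : N ≠ 0) (hy : y ≠ 0) (h : Regular q p y) :
    kappaInv N y q p * (Theta p y⁻¹ * Theta p (q ^ (2 * N) * y)) =
      Theta p (q ^ 2 * y) * Theta p (q ^ 2 * (q ^ (2 * N) * y)⁻¹) *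
        kappaInv N (q ^ (2 * N) * y) q p := by
  have hQ1 := norm_pow_two_mul_lt_one hq1 hN
  have hQ0 : q ^ (2 * N) ≠ 0 := pow_ne_zero _ hq
  have hQ' : q ^ (2 * N) = q ^ (2 * N - 2) * q ^ 2 := by
    rw [← pow_add]; congr 1; omega
  have hNN : 2 * N - 2 = 2 * (N - 1) := by omega
  have hQy := h.q_pow_mul hq hp N
  have n5 := (h.q_pow_mul hq hp N).poch₂_ne_zero hq1 hp1 hN
  have n6 := (hQy.inv.q_sq_mul hq hp).poch₂_ne_zero hq1 hp1 hN
  have n7 := (h.p_mul hq hp).poch₂_ne_zero hq1 hp1 hN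
  have n8 := ((hQy.inv.q_pow_mul hq hp (N - 1)).p_mul hq hp).poch₂_ne_zero hq1 hp1 hN
  rw [← hNN, ← mul_assoc] at n8
  have a1 := poch₂_eq_right (q ^ (2 * N) * (q ^ (2 * N) * y)⁻¹) hp1 hQ1
  have a2 := poch₂_eq_right (q ^ 2 * y) hp1 hQ1
  have a3 := poch₂_eq_right (p * (q ^ (2 * N) * y)⁻¹) hp1 hQ1
  have a4 := poch₂_eq_right (p * q ^ (2 * N - 2) * y) hp1 hQ1
  have a5 := poch₂_eq_right (q ^ (2 * N) * y) hp1 hQ1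
  have a6 := poch₂_eq_right (q ^ 2 * (q ^ (2 * N) * y)⁻¹) hp1 hQ1
  have a7 := poch₂_eq_right (p * y) hp1 hQ1
  have a8 := poch₂_eq_right (p * q ^ (2 * N - 2) * (q ^ (2 * N) * y)⁻¹) hp1 hQ1
  have t4 : q ^ (2 * N) * (q ^ (2 * N) * y)⁻¹ = y⁻¹ := by field_simp
  rw [t4, mul_comm y⁻¹] at a1
  rw [show q ^ 2 * y * q ^ (2 * N) = q ^ 2 * (q ^ (2 * N) * y) by ring] at a2
  rw [show p * (q ^ (2 * N) * y)⁻¹ * q ^ (2 * N) = p * y⁻¹ by field_simp] at a3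
  rw [show p * q ^ (2 * N - 2) * y * q ^ (2 * N) = p * q ^ (2 * N - 2) * (q ^ (2 * N) * y) by
    ring] at a4
  rw [show q ^ (2 * N) * y * q ^ (2 * N) = q ^ (2 * N) * (q ^ (2 * N) * y) by ring] at a5
  rw [show q ^ 2 * (q ^ (2 * N) * y)⁻¹ * q ^ (2 * N) = q ^ 2 * y⁻¹ by field_simp] at a6
  rw [show p * y * q ^ (2 * N) = p * (q ^ (2 * N) * y) by ring] at a7
  rw [show p * q ^ (2 * N - 2) * (q ^ (2 * N) * y)⁻¹ * q ^ (2 * N) = p * q ^ (2 * N - 2) * y⁻¹ by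
    field_simp] at a8
  have t1 : p * (q ^ 2 * y)⁻¹ = p * q ^ (2 * N - 2) * (q ^ (2 * N) * y)⁻¹ := by
    rw [hQ']
    have : q ^ (2 * N - 2) ≠ 0 := pow_ne_zero _ hq
    field_simp
  have t2 : p * (q ^ 2 * (q ^ (2 * N) * y)⁻¹)⁻¹ = p * q ^ (2 * N - 2) * y := by
    rw [hQ']; field_simp
  have t3 : p * (y⁻¹)⁻¹ = p * y := by rw [inv_inv]
  rw [kappaInv, kappaInv, Theta, Theta, Theta, Theta, t1, t2, t3, t4]
  rw [a5] at n5
  rw [a6] at n6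
  rw [a7] at n7
  rw [a8] at n8
  rw [a1, a2, a3, a4, a5, a6, a7, a8]
  have m5 := left_ne_zero_of_mul n5
  have m6 := left_ne_zero_of_mul n6
  have m7 := left_ne_zero_of_mul n7
  have m8 := left_ne_zero_of_mul n8
  have l5 := right_ne_zero_of_mul n5
  have l6 := right_ne_zero_of_mul n6
  have l7 := right_ne_zero_of_mul n7
  have l8 := right_ne_zero_of_mul n8
  generalize poch₂ (q ^ (2 * N) * y⁻¹) p (q ^ (2 * N)) = x1 at *
  generalize poch₂ (q ^ 2 * (q ^ (2 * N) * y)) p (q ^ (2 * N)) = x2 at *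
  generalize poch₂ (p * y⁻¹) p (q ^ (2 * N)) = x3 at *
  generalize poch₂ (p * q ^ (2 * N - 2) * (q ^ (2 * N) * y)) p (q ^ (2 * N)) = x4 at *
  generalize poch₂ (q ^ (2 * N) * (q ^ (2 * N) * y)) p (q ^ (2 * N)) = x5 at *
  generalize poch₂ (q ^ 2 * y⁻¹) p (q ^ (2 * N)) = x6 at *
  generalize poch₂ (p * (q ^ (2 * N) * y)) p (q ^ (2 * N)) = x7 at *
  generalize poch₂ (p * q ^ (2 * N - 2) * y⁻¹) p (q ^ (2 * N)) = x8 at *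
  generalize poch (q ^ (2 * N) * y) p = P5 at *
  generalize poch (q ^ 2 * (q ^ (2 * N) * y)⁻¹) p = P6 at *
  generalize poch (p * y) p = P7 at *
  generalize poch (p * q ^ (2 * N - 2) * (q ^ (2 * N) * y)⁻¹) p = P8 at *
  clear a1 a2 a3 a4 a5 a6 a7 a8 t1 t2 t3 t4
  field_simp

theorem kappaInv_ne_zero {q p y : ℂ} (hq : q ≠ 0) (hp : p ≠ 0) (hq1 : ‖q‖ < 1) (hp1 : ‖p‖ < 1)
    {N : ℕ} (hN : N ≠ 0) (h : Regular q p y) : kappaInv N y q p ≠ 0 := by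
  have hNN : 2 * N - 2 = 2 * (N - 1) := by omega
  have key : ∀ {x : ℂ}, Regular q p x → poch₂ x p (q ^ (2 * N)) ≠ 0 :=
    fun hx => hx.poch₂_ne_zero hq1 hp1 hN
  have h4 := (h.q_pow_mul hq hp (N - 1)).p_mul hq hp
  have h8 := (h.inv.q_pow_mul hq hp (N - 1)).p_mul hq hp
  rw [← hNN, ← mul_assoc] at h4 h8
  refine div_ne_zero (mul_ne_zero (mul_ne_zero (mul_ne_zero ?_ ?_) ?_) (key h4))
    (mul_ne_zero (mul_ne_zero (mul_ne_zero ?_ ?_) ?_) (key h8))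
  · exact key (h.inv.q_pow_mul hq hp N)
  · exact key (h.q_sq_mul hq hp)
  · exact key (h.inv.p_mul hq hp)
  · exact key (h.q_pow_mul hq hp N)
  · exact key (h.inv.q_sq_mul hq hp)
  · exact key (h.p_mul hq hp)

/-! ### The normalization of the `R`-matrix -/

theorem e_two_mul_add_tau_add_one (ξ τ : ℂ) : e (2 * (ξ + τ + 1)) = e (2 * τ) * e (2 * ξ) := by
  rw [← e_add, show 2 * (ξ + τ + 1) = 2 * τ + 2 * ξ + 2 by ring, e_add _ 2, e_two, mul_one]

theorem e_two_mul_natCast_mul (N : ℕ) (ζ : ℂ) : e (2 * (N * ζ)) = e ζ ^ (2 * N) := by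
  rw [← e_nat_mul]; push_cast; ring_nf

theorem e_two_mul_add_natCast_mul (N : ℕ) (ξ ζ : ℂ) :
    e (2 * (ξ + N * ζ)) = e ζ ^ (2 * N) * e (2 * ξ) := by
  rw [mul_add, e_add, e_two_mul_natCast_mul, mul_comm]

theorem Regular.th_ne_zero {τ ξ ζ : ℂ} (hτ : 0 < τ.im)
    (h : Regular (e ζ) (e (2 * τ)) (e (2 * ξ))) : th τ ξ ≠ 0 := fun h0 => by
  obtain ⟨m, n, hmn⟩ := (th_eq_zero_iff hτ ξ).1 h0
  refine h 0 n ?_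
  rw [hmn, mul_zero, zpow_zero, one_mul, mul_add, e_add, e_two_mul_int, mul_one,
    show 2 * (n * τ) = n * (2 * τ) by ring, e_int_mul]

theorem Regular.add_natCast_mul {τ ξ ζ : ℂ} (n : ℕ)
    (h : Regular (e ζ) (e (2 * τ)) (e (2 * ξ))) :
    Regular (e ζ) (e (2 * τ)) (e (2 * (ξ + n * ζ))) := by
  rw [e_two_mul_add_natCast_mul]
  exact h.q_pow_mul (e_ne_zero _) (e_ne_zero _) n

theorem Regular.sub_natCast_mul {τ ξ ζ : ℂ} (n : ℕ)
    (h : Regular (e ζ) (e (2 * τ)) (e (2 * ξ))) :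
    Regular (e ζ) (e (2 * τ)) (e (2 * (ξ - n * ζ))) := by
  have := h.mul (e_ne_zero _) (e_ne_zero _) (-n) 0
  have h2 : e (2 * (ξ - n * ζ)) = e ζ ^ (2 * (-n : ℤ)) * e (2 * τ) ^ (0 : ℤ) * e (2 * ξ) := by
    rw [← e_int_mul, zpow_zero, mul_one, ← e_add]
    congr 1
    push_cast
    ring
  rwa [h2]

theorem th_ne_zero_of_nonResonant {τ ζ : ℂ} (hτ : 0 < τ.im) (h : NonResonant ζ τ) :
    th τ ζ ≠ 0 := fun h0 => by
  obtain ⟨m, n, hmn⟩ := (th_eq_zero_iff hτ ζ).1 h0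
  refine h n ?_
  rw [← e_two_mul, hmn, mul_add, e_add, e_two_mul_int, mul_one,
    show 2 * (n * τ) = n * (2 * τ) by ring, e_int_mul]

/-- The scalar prefactor of `R̂`. -/
def prefactor (N : ℕ) (ξ ζ τ : ℂ) : ℂ :=
  e ((1 / N - 1) * ζ) * (Theta (e ζ ^ (2 * N)) (e ζ ^ 2 * (e (2 * ξ))⁻¹) /
    Theta (e ζ ^ (2 * N)) (e (2 * ξ))) * kappaInv N (e (2 * ξ)) (e ζ) (e (2 * τ)) *
    (th τ ζ / th τ (ξ + ζ))

theorem prefactor_eq (N : ℕ) (ξ ζ τ : ℂ) :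
    tauN N (ζ / 2 - ξ) ζ * (e ((2 / N - 2) * ξ) * kappaInv N (e (2 * ξ)) (e ζ) (e (2 * τ))
      * (theta (1 / 2) (1 / 2) ζ τ / theta (1 / 2) (1 / 2) (ξ + ζ) τ)) = prefactor N ξ ζ τ := by
  have h1 : e ζ * e (2 * (ζ / 2 - ξ)) = e ζ ^ 2 * (e (2 * ξ))⁻¹ := by
    rw [← e_neg, ← e_two_mul, ← e_add, ← e_add]; congr 1; ring
  have h2 : e ζ * e (-(2 * (ζ / 2 - ξ))) = e (2 * ξ) := by
    rw [← e_add]; congr 1; ring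
  have h3 : e ((1 / N - 1) * ζ) = e ((2 / N - 2) * (ζ / 2 - ξ)) * e ((2 / N - 2) * ξ) := by
    rw [← e_add]; congr 1; ring
  rw [tauN, h1, h2, prefactor, h3, th, th]
  ring

/-- The exchange factor of `R̂` under the shift by `-p^{1/2}`, as a function of `y = z²`. -/
def rho (N : ℕ) (ζ y : ℂ) : ℂ :=
  e ((2 - 2 / N) * ζ) * (Theta (e ζ ^ (2 * N)) y * Theta (e ζ ^ (2 * N)) y⁻¹ /
    (Theta (e ζ ^ (2 * N)) (e ζ ^ 2 * y) * Theta (e ζ ^ (2 * N)) (e ζ ^ 2 * y⁻¹)))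

section

variable {N : ℕ} {ξ ζ τ : ℂ}

theorem rho_ne_zero (hN : N ≠ 0) (hζ : 0 < ζ.im) {y : ℂ} (hy : y ≠ 0)
    (h : Regular (e ζ) (e (2 * τ)) y) : rho N ζ y ≠ 0 := by
  have key : ∀ {x : ℂ}, x ≠ 0 → Regular (e ζ) (e (2 * τ)) x → Theta (e ζ ^ (2 * N)) x ≠ 0 :=
    fun hx0 hx => hx.Theta_q_ne_zero (e_ne_zero _) (norm_e_lt_one hζ) hN hx0
  have hq := e_ne_zero ζ
  have hp := e_ne_zero (2 * τ)
  have hq2 : e ζ ^ 2 ≠ 0 := pow_ne_zero _ hq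
  have hyi : y⁻¹ ≠ 0 := inv_ne_zero hy
  exact mul_ne_zero (e_ne_zero _) (div_ne_zero (mul_ne_zero (key hy h) (key hyi h.inv))
    (mul_ne_zero (key (mul_ne_zero hq2 hy) (h.q_sq_mul hq hp))
      (key (mul_ne_zero hq2 hyi) (h.inv.q_sq_mul hq hp))))

theorem prefactor_ne_zero (hN : N ≠ 0) (hζ : 0 < ζ.im) (hτ : 0 < τ.im) (hr : NonResonant ζ τ)
    (h : Regular (e ζ) (e (2 * τ)) (e (2 * ξ))) : prefactor N ξ ζ τ ≠ 0 := by
  have hq := e_ne_zero ζ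
  have hp := e_ne_zero (2 * τ)
  have h1 := h.add_natCast_mul 1
  rw [Nat.cast_one, one_mul] at h1
  refine mul_ne_zero (mul_ne_zero (mul_ne_zero (e_ne_zero _) (div_ne_zero ?_ ?_)) ?_)
    (div_ne_zero (th_ne_zero_of_nonResonant hτ hr) (h1.th_ne_zero hτ))
  · exact (h.inv.q_sq_mul hq hp).Theta_q_ne_zero hq (norm_e_lt_one hζ) hN
      (mul_ne_zero (pow_ne_zero _ hq) (inv_ne_zero (e_ne_zero _)))
  · exact h.Theta_q_ne_zero hq (norm_e_lt_one hζ) hN (e_ne_zero _)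
  · exact kappaInv_ne_zero hq hp (norm_e_lt_one hζ) (norm_e_two_mul_lt_one hτ) hN h

theorem prefactor_add_one (N : ℕ) (ξ ζ τ : ℂ) :
    prefactor N (ξ + 1) ζ τ = -prefactor N ξ ζ τ := by
  rw [prefactor, prefactor, mul_add, mul_one, e_add _ 2, e_two, mul_one,
    show ξ + 1 + ζ = ξ + ζ + 1 by ring, th_add_one, div_neg, mul_neg]

theorem prefactor_add_tau_add_one (hN : N ≠ 0) (hζ : 0 < ζ.im) (hτ : 0 < τ.im)
    (h : Regular (e ζ) (e (2 * τ)) (e (2 * ξ))) :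
    prefactor N (ξ + τ + 1) ζ τ * e (-(τ + 2 * ξ + 2 * ζ / N)) =
      rho N ζ (e (2 * ξ)) * prefactor N ξ ζ τ := by
  have hq := e_ne_zero ζ
  have hp := e_ne_zero (2 * τ)
  have hq1 := norm_e_lt_one hζ
  have hp1 := norm_e_two_mul_lt_one hτ
  have hy := e_ne_zero (2 * ξ)
  have hq2 : e ζ ^ 2 ≠ 0 := pow_ne_zero _ hq
  have hpy := h.p_mul hq hp
  have key : ∀ {x : ℂ}, x ≠ 0 → Regular (e ζ) (e (2 * τ)) x → Theta (e ζ ^ (2 * N)) x ≠ 0 :=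
    fun hx0 hx => hx.Theta_q_ne_zero hq hq1 hN hx0
  have hk := kappaInv_p_mul hq hp hq1 hp1 hN hy h
  have h1 := h.add_natCast_mul 1
  rw [Nat.cast_one, one_mul] at h1
  have hth := h1.th_ne_zero hτ
  have h2 : th τ (ξ + τ + 1 + ζ) = e (-(τ + 2 * (ξ + ζ))) * th τ (ξ + ζ) := by
    have := th_add_lattice τ (ξ + ζ) 1 1
    rw [show ξ + τ + 1 + ζ = ξ + ζ + (((1 : ℤ) : ℂ) * τ + ((1 : ℤ) : ℂ)) by push_cast; ring, this,
      show -((((1 : ℤ) : ℂ)) ^ 2 * τ + 2 * ((1 : ℤ) : ℂ) * (ξ + ζ)) + ((1 : ℤ) : ℂ) +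
        ((1 : ℤ) : ℂ) = -(τ + 2 * (ξ + ζ)) + 2 by push_cast; ring, e_add _ 2, e_two, mul_one]
  -- The multiplier of the matrix part and that of `th τ (ξ + ζ)` differ by the constant in front of
  -- `rho`.
  have h3 : e (-(τ + 2 * ξ + 2 * ζ / N)) = e ((2 - 2 / N) * ζ) * e (-(τ + 2 * (ξ + ζ))) := by
    rw [← e_add]; congr 1; ring
  have n1 := key hy h
  have n2 := key (mul_ne_zero hq2 hy) (h.q_sq_mul hq hp)
  have n3 := key (mul_ne_zero hq2 (inv_ne_zero hy)) (h.inv.q_sq_mul hq hp)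
  have n4 := key (mul_ne_zero hp hy) hpy
  have n5 := e_ne_zero (-(τ + 2 * (ξ + ζ)))
  rw [prefactor, prefactor, rho, e_two_mul_add_tau_add_one, h2, h3]
  generalize Theta (e ζ ^ (2 * N)) (e ζ ^ 2 * (e (2 * τ) * e (2 * ξ))⁻¹) = t1 at *
  generalize Theta (e ζ ^ (2 * N)) (e (2 * τ) * e (2 * ξ)) = t2 at *
  generalize Theta (e ζ ^ (2 * N)) (e ζ ^ 2 * e (2 * ξ)) = t3 at *
  generalize Theta (e ζ ^ (2 * N)) (e ζ ^ 2 * (e (2 * ξ))⁻¹) = t4 at *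
  generalize Theta (e ζ ^ (2 * N)) (e (2 * ξ))⁻¹ = t5 at *
  generalize Theta (e ζ ^ (2 * N)) (e (2 * ξ)) = t6 at *
  generalize kappaInv N (e (2 * τ) * e (2 * ξ)) (e ζ) (e (2 * τ)) = k1 at *
  generalize kappaInv N (e (2 * ξ)) (e ζ) (e (2 * τ)) = k2 at *
  generalize e (-(τ + 2 * (ξ + ζ))) = E at *
  generalize th τ (ξ + ζ) = T at *
  generalize e ((1 / N - 1) * ζ) = u
  generalize e ((2 - 2 / N) * ζ) = v
  field_simp
  linear_combination u * v * th τ ζ * hk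

/-- The theta products on the two sides are the numerators of the scalars in
`contract_rGauge_rGauge` and `rGauge_mul_rGauge`. Their agreement is what makes the contraction of
R̂ with its inverse exactly 1. -/
theorem prefactor_crossing (hN : N ≠ 0) (hζ : 0 < ζ.im) (hτ : 0 < τ.im)
    (h : Regular (e ζ) (e (2 * τ)) (e (2 * ξ))) :
    prefactor N (ξ - N * ζ) ζ τ * (th τ ξ * th τ (ξ - N * ζ)) =
      prefactor N ξ ζ τ * (th τ (ξ + ζ) * th τ (ξ - ζ)) := by
  have hq := e_ne_zero ζ
  have hp := e_ne_zero (2 * τ)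
  have hq1 := norm_e_lt_one hζ
  have hp1 := norm_e_two_mul_lt_one hτ
  have hq2 : e ζ ^ 2 ≠ 0 := pow_ne_zero _ hq
  have hQ : e ζ ^ (2 * N) ≠ 0 := pow_ne_zero _ hq
  have hQ1 : ‖e ζ ^ (2 * N)‖ < 1 := norm_pow_two_mul_lt_one hq1 hN
  have h' := h.sub_natCast_mul N
  obtain ⟨η, rfl⟩ : ∃ η, ξ = η + N * ζ := ⟨ξ - N * ζ, by ring⟩
  rw [add_sub_cancel_right] at *
  have hy := e_ne_zero (2 * η)
  have key : ∀ {x : ℂ}, x ≠ 0 → Regular (e ζ) (e (2 * τ)) x → Theta (e ζ ^ (2 * N)) x ≠ 0 :=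
    fun hx0 hx => hx.Theta_q_ne_zero hq hq1 hN hx0
  have hk := kappaInv_q_mul hq hp hq1 hp1 hN hy h'
  have a1 := h.add_natCast_mul 1
  have a2 := h'.add_natCast_mul 1
  rw [Nat.cast_one, one_mul] at a1 a2
  have b1 := a1.th_ne_zero hτ
  have b2 := a2.th_ne_zero hτ
  obtain ⟨C, hC, hth⟩ := exists_th_eq_thProd hτ
  have c1 : Theta (e ζ ^ (2 * N)) (e ζ ^ 2 * (e (2 * η))⁻¹) =
      -(e ζ ^ 2 * (e ζ ^ (2 * N) * e (2 * η))⁻¹)⁻¹ *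
        Theta (e ζ ^ (2 * N)) (e ζ ^ 2 * (e ζ ^ (2 * N) * e (2 * η))⁻¹) := by
    rw [← Theta_mul_self hQ1 hQ (mul_ne_zero hq2 (inv_ne_zero (mul_ne_zero hQ hy)))]
    congr 1
    field_simp
  have c2 := Theta_mul_self hQ1 hQ hy
  have c3 := Theta_inv (a := e (2 * τ)) hp1 hy
  have c4 : Theta (e (2 * τ)) (e ζ ^ 2 * (e ζ ^ (2 * N) * e (2 * η))⁻¹) =
      -(e (2 * (η + N * ζ - ζ)))⁻¹ * Theta (e (2 * τ)) (e (2 * (η + N * ζ - ζ))) := by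
    rw [← Theta_inv hp1 (e_ne_zero _), ← e_two_mul_add_natCast_mul, ← e_two_mul, ← e_neg, ← e_neg,
      ← e_add]
    congr 2
    ring
  have c5 : e ζ ^ 2 * e (2 * η) = e (2 * (η + ζ)) := by
    rw [← e_two_mul, ← e_add]; congr 1; ring
  have d1 : th τ (η + N * ζ) = C * (e (-(η + N * ζ)) *
      Theta (e (2 * τ)) (e (2 * (η + N * ζ)))) := hth _
  have d2 : th τ η = C * (e (-η) * Theta (e (2 * τ)) (e (2 * η))) := hth _
  have d3 : th τ (η + ζ) = C * (e (-(η + ζ)) * Theta (e (2 * τ)) (e (2 * (η + ζ)))) := hth _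
  have d4 : th τ (η + N * ζ - ζ) = C * (e (-(η + N * ζ - ζ)) *
      Theta (e (2 * τ)) (e (2 * (η + N * ζ - ζ)))) := hth _
  have n1 := key hy h'
  have n2 := key (mul_ne_zero hQ hy) (by rwa [e_two_mul_add_natCast_mul] at h)
  have n3 := key (mul_ne_zero hq2 (inv_ne_zero hy)) (h'.inv.q_sq_mul hq hp)
  rw [prefactor, prefactor, e_two_mul_add_natCast_mul, c1]
  have hk2 : kappaInv N (e (2 * η)) (e ζ) (e (2 * τ)) * (th τ (η + N * ζ) * th τ η) *
      (e ζ ^ (2 * N) / e ζ ^ 2) =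
      kappaInv N (e ζ ^ (2 * N) * e (2 * η)) (e ζ) (e (2 * τ)) *
        (th τ (η + ζ) * th τ (η + N * ζ - ζ)) := by
    rw [c3, c4, c5, ← e_two_mul_add_natCast_mul] at hk
    rw [d1, d2, d3, d4, ← e_two_mul_add_natCast_mul]
    have e1 : e (-(η + N * ζ)) = (e ζ ^ N)⁻¹ * (e η)⁻¹ := by
      rw [← e_nat_mul, ← e_neg, ← e_neg, ← e_add]; congr 1; ring
    have e2 : e (-(η + N * ζ - ζ)) = (e ζ ^ N)⁻¹ * (e η)⁻¹ * e ζ := by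
      rw [← e_nat_mul, ← e_neg, ← e_neg, ← e_add, ← e_add]; congr 1; ring
    have e3 : e (-(η + ζ)) = (e η)⁻¹ * (e ζ)⁻¹ := by
      rw [← e_neg, ← e_neg, ← e_add]; congr 1; ring
    have e4 : e (2 * η) = e η ^ 2 := e_two_mul _
    have e5 : e (2 * (η + N * ζ - ζ)) = e η ^ 2 * (e ζ ^ N) ^ 2 * (e ζ ^ 2)⁻¹ := by
      rw [← e_two_mul η, ← e_nat_mul, ← e_two_mul (N * ζ), ← e_two_mul ζ, ← e_neg, ← e_add, ← e_add]
      congr 1; ring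
    have e6 : e ζ ^ (2 * N) = (e ζ ^ N) ^ 2 := by rw [← pow_mul, mul_comm]
    rw [e1, e2, e3, e_neg η, e6]
    have e7 : (e (2 * η))⁻¹ = (e η ^ 2)⁻¹ := by rw [e4]
    have e8 : (e (2 * (η + N * ζ - ζ)))⁻¹ = (e η ^ 2 * (e ζ ^ N) ^ 2 * (e ζ ^ 2)⁻¹)⁻¹ := by
      rw [e5]
    rw [e7, e8] at hk
    have f1 := e_ne_zero η
    have f2 : e ζ ^ N ≠ 0 := pow_ne_zero _ hq
    generalize Theta (e (2 * τ)) (e (2 * (η + N * ζ))) = t1 at *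
    generalize Theta (e (2 * τ)) (e (2 * η)) = t2 at *
    generalize Theta (e (2 * τ)) (e (2 * (η + ζ))) = t3 at *
    generalize Theta (e (2 * τ)) (e (2 * (η + N * ζ - ζ))) = t4 at *
    generalize kappaInv N (e (2 * η)) (e ζ) (e (2 * τ)) = k1 at *
    generalize kappaInv N (e (2 * (η + N * ζ))) (e ζ) (e (2 * τ)) = k2 at *
    generalize e ζ ^ N = r at *
    generalize e ζ = q at *
    generalize e η = s at *
    clear c1 c2 c3 c4 c5 d1 d2 d3 d4 e1 e2 e3 e4 e5 e6 e7 e8 n1 n2 n3 b1 b2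
    field_simp at hk ⊢
    linear_combination -hk
  rw [c2] at n2 ⊢
  have e6 : (e ζ ^ (2 * N) * e (2 * η)) ≠ 0 := mul_ne_zero hQ hy
  generalize Theta (e ζ ^ (2 * N)) (e ζ ^ 2 * (e ζ ^ (2 * N) * e (2 * η))⁻¹) = t1 at *
  generalize Theta (e ζ ^ (2 * N)) (e (2 * η)) = t2 at *
  generalize kappaInv N (e (2 * η)) (e ζ) (e (2 * τ)) = k1 at *
  generalize kappaInv N (e ζ ^ (2 * N) * e (2 * η)) (e ζ) (e (2 * τ)) = k2 at *
  clear d1 d2 d3 d4 c1 c2 c3 c4 c5 hth hk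
  generalize th τ (η + N * ζ + ζ) = T1 at *
  generalize th τ (η + N * ζ - ζ) = T2 at *
  generalize th τ (η + N * ζ) = T3 at *
  generalize th τ (η + ζ) = T4 at *
  generalize th τ η = T5 at *
  generalize e (2 * η) = y at *
  generalize e ζ ^ (2 * N) = Q at *
  generalize e ((1 / N - 1) * ζ) = u
  field_simp at hk2 ⊢
  linear_combination -(u * t1 * th τ ζ * hk2)

end

/-! ### Properties of `R̂` -/

theorem gHalf_mul_inv (N : ℕ) : gHalf N * (gHalf N)⁻¹ = 1 :=
  Matrix.mul_nonsing_inv _ ((Matrix.isUnit_iff_isUnit_det _).1 (isUnit_gHalf N))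

theorem gHalf_inv_mul (N : ℕ) : (gHalf N)⁻¹ * gHalf N = 1 :=
  Matrix.nonsing_inv_mul _ ((Matrix.isUnit_iff_isUnit_det _).1 (isUnit_gHalf N))

theorem gHalf_inv (N : ℕ) :
    (gHalf N)⁻¹ = Matrix.diagonal fun i : Fin N => (e (((i : ℕ) + 1) / N))⁻¹ := by
  refine Matrix.inv_eq_right_inv ?_
  rw [gHalf, Matrix.diagonal_mul_diagonal, ← Matrix.diagonal_one]
  congr 1
  ext i
  exact mul_inv_cancel₀ (e_ne_zero _)

theorem gHalf_kronecker_inv_mul (N : ℕ) :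
    ((gHalf N)⁻¹ ⊗ₖ (gHalf N)⁻¹) * (gHalf N ⊗ₖ gHalf N) = 1 := by
  rw [← Matrix.mul_kronecker_mul, gHalf_inv_mul, Matrix.one_kronecker_one]

theorem gHalf_kronecker_mul_inv (N : ℕ) :
    (gHalf N ⊗ₖ gHalf N) * ((gHalf N)⁻¹ ⊗ₖ (gHalf N)⁻¹) = 1 := by
  rw [← Matrix.mul_kronecker_mul, gHalf_mul_inv, Matrix.one_kronecker_one]

/-- The gauge-transformed `R`-matrix without its scalar prefactor. -/
def rGauge (N : ℕ) (ξ ζ τ : ℂ) : Matrix (Fin N × Fin N) (Fin N × Fin N) ℂ :=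
  (gHalf N ⊗ₖ gHalf N) * rSym N ξ ζ τ * ((gHalf N)⁻¹ ⊗ₖ (gHalf N)⁻¹)

theorem RHat_eq (N : ℕ) (ξ ζ τ : ℂ) :
    RHat N ξ ζ τ = prefactor N ξ ζ τ • rGauge N ξ ζ τ := by
  rw [RHat, RMat, RTilde, Matrix.mul_smul, Matrix.smul_mul, smul_smul, prefactor_eq]
  rfl

theorem rGauge_mul_rGauge {τ : ℂ} (hτ : 0 < τ.im) {N : ℕ} (hN : N ≠ 0) {ξ ζ : ℂ}
    (hξ : th τ ξ ≠ 0) (hζ : th τ ζ ≠ 0) :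
    rGauge N ξ ζ τ * rGauge N ξ (-ζ) τ =
      (th τ (ξ + ζ) * th τ (ξ - ζ) / -th τ ζ ^ 2) • (1 : Matrix _ _ ℂ) := by
  calc _ = (gHalf N ⊗ₖ gHalf N) * rSym N ξ ζ τ *
        (((gHalf N)⁻¹ ⊗ₖ (gHalf N)⁻¹) * (gHalf N ⊗ₖ gHalf N)) * rSym N ξ (-ζ) τ *
        ((gHalf N)⁻¹ ⊗ₖ (gHalf N)⁻¹) := by simp only [rGauge, mul_assoc]
    _ = (gHalf N ⊗ₖ gHalf N) * (rSym N ξ ζ τ * rSym N ξ (-ζ) τ) *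
        ((gHalf N)⁻¹ ⊗ₖ (gHalf N)⁻¹) := by
      rw [gHalf_kronecker_inv_mul, mul_one]; simp only [mul_assoc]
    _ = _ := by
      rw [rSym_mul_rSym hτ hN hξ hζ, Matrix.mul_smul, mul_one, Matrix.smul_mul,
        gHalf_kronecker_mul_inv]

theorem contract_rGauge_rGauge {τ : ℂ} (hτ : 0 < τ.im) {N : ℕ} (hN : N ≠ 0) {ξ ζ : ℂ}
    (hξ : th τ ξ ≠ 0) (hξ' : th τ (ξ - N * ζ) ≠ 0) (hζ : th τ ζ ≠ 0) :
    contract (rGauge N (ξ - N * ζ) ζ τ) (rGauge N ξ (-ζ) τ) =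
      (th τ ξ * th τ (ξ - N * ζ) / -th τ ζ ^ 2) • (1 : Matrix _ _ ℂ) := by
  rw [rGauge, rGauge, gHalf_inv, gHalf]
  exact contract_conj_diagonal (fun i => e_ne_zero _) _ _ (contract_rSym_rSym hτ hN hξ hξ' hζ)

/-- The inverse of `R̂`. -/
def RHatInv (N : ℕ) (ξ ζ τ : ℂ) : Matrix (Fin N × Fin N) (Fin N × Fin N) ℂ :=
  (prefactor N ξ ζ τ * (th τ (ξ + ζ) * th τ (ξ - ζ) / -th τ ζ ^ 2))⁻¹ • rGauge N ξ (-ζ) τ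

section

variable {N : ℕ} {ξ ζ τ : ℂ}

theorem RHat_mul_RHatInv (hN : N ≠ 0) (hζ : 0 < ζ.im) (hτ : 0 < τ.im) (hr : NonResonant ζ τ)
    (h : Regular (e ζ) (e (2 * τ)) (e (2 * ξ))) : RHat N ξ ζ τ * RHatInv N ξ ζ τ = 1 := by
  have h1 := (h.add_natCast_mul 1).th_ne_zero hτ
  have h2 := (h.sub_natCast_mul 1).th_ne_zero hτ
  rw [Nat.cast_one, one_mul] at h1 h2
  have h3 := th_ne_zero_of_nonResonant hτ hr
  have h4 := prefactor_ne_zero hN hζ hτ hr h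
  rw [RHat_eq, RHatInv, Matrix.smul_mul, Matrix.mul_smul,
    rGauge_mul_rGauge hτ hN (h.th_ne_zero hτ) h3, smul_smul, smul_smul]
  convert one_smul ℂ _
  field_simp

theorem RHatInv_mul_RHat (hN : N ≠ 0) (hζ : 0 < ζ.im) (hτ : 0 < τ.im) (hr : NonResonant ζ τ)
    (h : Regular (e ζ) (e (2 * τ)) (e (2 * ξ))) : RHatInv N ξ ζ τ * RHat N ξ ζ τ = 1 :=
  mul_eq_one_comm.1 (RHat_mul_RHatInv hN hζ hτ hr h)

theorem contract_RHat_RHatInv (hN : N ≠ 0) (hζ : 0 < ζ.im) (hτ : 0 < τ.im)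
    (hr : NonResonant ζ τ) (h : Regular (e ζ) (e (2 * τ)) (e (2 * ξ))) :
    contract (RHat N (ξ - N * ζ) ζ τ) (RHatInv N ξ ζ τ) = 1 := by
  have h1 := (h.add_natCast_mul 1).th_ne_zero hτ
  have h2 := (h.sub_natCast_mul 1).th_ne_zero hτ
  rw [Nat.cast_one, one_mul] at h1 h2
  have h3 := th_ne_zero_of_nonResonant hτ hr
  have h4 := prefactor_ne_zero hN hζ hτ hr h
  have h5 := (h.sub_natCast_mul N).th_ne_zero hτ
  have h6 := prefactor_crossing hN hζ hτ h
  rw [RHat_eq, RHatInv, contract_smul_smul, contract_rGauge_rGauge hτ hN (h.th_ne_zero hτ) h5 h3,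
    smul_smul]
  convert one_smul ℂ _
  field_simp
  linear_combination h6

/-! ### Quasi-periodicity and periods of `R̂`. -/

theorem GMat_kronecker_mul_gHalf (N : ℕ) :
    (GMat N ⊗ₖ (1 : Matrix (Fin N) (Fin N) ℂ)) * (gHalf N ⊗ₖ gHalf N) =
      (gHalf N ⊗ₖ gHalf N) * ((hMat N ⊗ₖ (1 : Matrix (Fin N) (Fin N) ℂ)) * (gMat N ⊗ₖ 1)) := by
  rw [← Matrix.mul_kronecker_mul, ← Matrix.mul_kronecker_mul, ← Matrix.mul_kronecker_mul, one_mul,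
    one_mul, mul_one, GMat, ← gHalf_mul_gHalf]
  simp only [mul_assoc]

theorem gHalf_inv_kronecker_mul_GMat (N : ℕ) :
    ((gHalf N)⁻¹ ⊗ₖ (gHalf N)⁻¹) * (GMat N ⊗ₖ (1 : Matrix (Fin N) (Fin N) ℂ)) =
      ((hMat N ⊗ₖ (1 : Matrix (Fin N) (Fin N) ℂ)) * (gMat N ⊗ₖ 1)) *
        ((gHalf N)⁻¹ ⊗ₖ (gHalf N)⁻¹) := by
  have h := congrArg (fun A => ((gHalf N)⁻¹ ⊗ₖ (gHalf N)⁻¹) * A * ((gHalf N)⁻¹ ⊗ₖ (gHalf N)⁻¹))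
    (GMat_kronecker_mul_gHalf N)
  simp only at h
  rw [mul_assoc, mul_assoc, gHalf_kronecker_mul_inv, mul_one, ← mul_assoc,
    gHalf_kronecker_inv_mul, one_mul] at h
  exact h

/-- Moved through the gauge factor, `G` becomes `h g`; here `g` accounts for the shift by 1 and `h`
for the shift by `τ`. -/
theorem GMat_mul_rGauge_add (N : ℕ) (ξ ζ τ : ℂ) :
    (GMat N ⊗ₖ (1 : Matrix (Fin N) (Fin N) ℂ)) * rGauge N (ξ + τ + 1) ζ τ =
      e (-(τ + 2 * ξ + 2 * ζ / N)) •
        (rGauge N ξ ζ τ * (GMat N ⊗ₖ (1 : Matrix (Fin N) (Fin N) ℂ))) := by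
  have h : ((hMat N ⊗ₖ (1 : Matrix (Fin N) (Fin N) ℂ)) * (gMat N ⊗ₖ 1)) *
      rSym N (ξ + τ + 1) ζ τ = e (-(τ + 2 * ξ + 2 * ζ / N)) •
        (rSym N ξ ζ τ * ((hMat N ⊗ₖ (1 : Matrix (Fin N) (Fin N) ℂ)) * (gMat N ⊗ₖ 1))) := by
    rw [mul_assoc, gMat_mul_rSym_add_one, mul_neg, ← mul_assoc, hMat_mul_rSym_add_tau,
      Matrix.smul_mul, neg_smul, neg_neg, mul_assoc]
  rw [rGauge, rGauge, mul_assoc _ _ (GMat N ⊗ₖ (1 : Matrix (Fin N) (Fin N) ℂ)),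
    gHalf_inv_kronecker_mul_GMat, ← mul_assoc, ← mul_assoc, GMat_kronecker_mul_gHalf,
    mul_assoc (gHalf N ⊗ₖ gHalf N) _ (rSym N (ξ + τ + 1) ζ τ), h,
    Matrix.mul_smul, Matrix.smul_mul]
  simp only [mul_assoc]

theorem GMat_mul_RHat_add (hN : N ≠ 0) (hζ : 0 < ζ.im) (hτ : 0 < τ.im)
    (h : Regular (e ζ) (e (2 * τ)) (e (2 * ξ))) :
    (GMat N ⊗ₖ (1 : Matrix (Fin N) (Fin N) ℂ)) * RHat N (ξ + τ + 1) ζ τ =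
      rho N ζ (e (2 * ξ)) •
        (RHat N ξ ζ τ * (GMat N ⊗ₖ (1 : Matrix (Fin N) (Fin N) ℂ))) := by
  rw [RHat_eq, RHat_eq, Matrix.mul_smul, GMat_mul_rGauge_add, smul_smul,
    prefactor_add_tau_add_one hN hζ hτ h, Matrix.smul_mul, smul_smul]

theorem gMat_mul_RHat_add_one (N : ℕ) (ξ ζ τ : ℂ) :
    (gMat N ⊗ₖ (1 : Matrix (Fin N) (Fin N) ℂ)) * RHat N (ξ + 1) ζ τ =
      RHat N ξ ζ τ * (gMat N ⊗ₖ (1 : Matrix (Fin N) (Fin N) ℂ)) := by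
  have h1 : (gMat N ⊗ₖ (1 : Matrix (Fin N) (Fin N) ℂ)) * (gHalf N ⊗ₖ gHalf N) =
      (gHalf N ⊗ₖ gHalf N) * (gMat N ⊗ₖ (1 : Matrix (Fin N) (Fin N) ℂ)) := by
    rw [← Matrix.mul_kronecker_mul, ← Matrix.mul_kronecker_mul, one_mul, mul_one,
      ← gHalf_mul_gHalf, mul_assoc]
  have h2 : ((gHalf N)⁻¹ ⊗ₖ (gHalf N)⁻¹) * (gMat N ⊗ₖ (1 : Matrix (Fin N) (Fin N) ℂ)) =
      (gMat N ⊗ₖ (1 : Matrix (Fin N) (Fin N) ℂ)) * ((gHalf N)⁻¹ ⊗ₖ (gHalf N)⁻¹) := by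
    rw [← Matrix.mul_kronecker_mul, ← Matrix.mul_kronecker_mul, one_mul, mul_one,
      ← gHalf_mul_gHalf, ← mul_assoc, gHalf_inv_mul, one_mul, mul_assoc, gHalf_mul_inv, mul_one]
  rw [RHat_eq, RHat_eq, prefactor_add_one, Matrix.mul_smul, Matrix.smul_mul, neg_smul, ← smul_neg,
    rGauge, rGauge, mul_assoc _ _ (gMat N ⊗ₖ (1 : Matrix (Fin N) (Fin N) ℂ)), h2, ← mul_assoc,
    ← mul_assoc, h1, mul_assoc (gHalf N ⊗ₖ gHalf N) _ (rSym N (ξ + 1) ζ τ), gMat_mul_rSym_add_one]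
  simp only [mul_assoc, mul_neg, neg_mul, neg_neg]

theorem kronecker_one_pow {n : Type*} [Fintype n] [DecidableEq n] (A : Matrix n n ℂ) (k : ℕ) :
    (A ⊗ₖ (1 : Matrix n n ℂ)) ^ k = (A ^ k) ⊗ₖ (1 : Matrix n n ℂ) := by
  induction k with
  | zero => rw [pow_zero, pow_zero, Matrix.one_kronecker_one]
  | succ k ih => rw [pow_succ, pow_succ, ih, ← Matrix.mul_kronecker_mul, one_mul]

/-- A shift by 1 is conjugation by `g ⊗ 1`, and `g ^ N = 1`. This period absorbs the ambiguity of
logarithms in the surface equation. -/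
theorem RHat_add_intCast_mul (N : ℕ) (ξ ζ τ : ℂ) (k : ℤ) :
    RHat N (ξ + k * N) ζ τ = RHat N ξ ζ τ := by
  have h : ∀ (n : ℕ) (ξ : ℂ), (gMat N ⊗ₖ (1 : Matrix (Fin N) (Fin N) ℂ)) ^ n *
      RHat N (ξ + n) ζ τ = RHat N ξ ζ τ * (gMat N ⊗ₖ (1 : Matrix (Fin N) (Fin N) ℂ)) ^ n := by
    intro n
    induction n with
    | zero => simp
    | succ n ih =>
      intro ξ
      rw [pow_succ, mul_assoc, Nat.cast_succ, ← add_assoc, gMat_mul_RHat_add_one, ← mul_assoc, ih,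
        mul_assoc]
  have hp : Function.Periodic (fun x => RHat N x ζ τ) (N : ℂ) := fun x => by
    have := h N x
    rwa [kronecker_one_pow, gMat_pow_self, Matrix.one_kronecker_one, one_mul, mul_one] at this
  exact hp.int_mul k ξ

theorem hMat_mul_gMat_pow (N n : ℕ) :
    (hMat N * gMat N) ^ n = e (n * (n + 1) / N) • (gMat N ^ n * hMat N ^ n) := by
  induction n with
  | zero => simp
  | succ n ih =>
    rw [pow_succ, ih, Matrix.smul_mul, ← mul_assoc, mul_assoc (gMat N ^ n), ← pow_succ,
      mul_assoc, hMat_pow_mul_gMat, Matrix.mul_smul, smul_smul, ← mul_assoc, ← pow_succ, ← e_add]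
    congr 2
    push_cast
    ring

theorem GMat_pow_self (hN : N ≠ 0) : GMat N ^ N = e (N + 1) • (1 : Matrix _ _ ℂ) := by
  have h1 : ∀ n : ℕ, GMat N ^ n * gHalf N = gHalf N * (hMat N * gMat N) ^ n := by
    intro n
    induction n with
    | zero => simp
    | succ n ih =>
      rw [pow_succ, mul_assoc, show GMat N * gHalf N = gHalf N * (hMat N * gMat N) by
        rw [GMat, ← gHalf_mul_gHalf]; simp only [mul_assoc], ← mul_assoc, ih, pow_succ, mul_assoc]
  have h2 : (hMat N * gMat N) ^ N = e (N + 1) • (1 : Matrix (Fin N) (Fin N) ℂ) := by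
    rw [hMat_mul_gMat_pow, gMat_pow_self, hMat_pow_self, mul_one,
      mul_div_cancel_left₀ _ (by exact_mod_cast hN)]
  have h3 : GMat N ^ N * gHalf N * (gHalf N)⁻¹ = _ := congrArg (· * (gHalf N)⁻¹) (h1 N)
  rwa [mul_assoc, gHalf_mul_inv, mul_one, h2, Matrix.mul_smul, mul_one, Matrix.smul_mul,
    gHalf_mul_inv] at h3

theorem e_two_mul_add_natCast_mul_tau (n : ℕ) (ξ τ : ℂ) :
    e (2 * (ξ + n * (τ + 1))) = e (2 * τ) ^ n * e (2 * ξ) := by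
  rw [show 2 * (ξ + n * (τ + 1)) = n * (2 * τ) + 2 * ξ + 2 * ((n : ℤ) : ℂ) by push_cast; ring,
    e_add, e_two_mul_int, mul_one, e_add, e_nat_mul]

/-- After a multiple of `N` steps the power of `G` is scalar and drops out, so the shifted matrix is
proportional to the original one. -/
theorem RHat_add_natCast_mul_tau (hN : N ≠ 0) (hζ : 0 < ζ.im) (hτ : 0 < τ.im) (m : ℕ)
    (h : Regular (e ζ) (e (2 * τ)) (e (2 * ξ))) :
    RHat N (ξ + (N * m : ℕ) * (τ + 1)) ζ τ =
      (∏ k ∈ Finset.range (N * m), rho N ζ (e (2 * τ) ^ k * e (2 * ξ))) • RHat N ξ ζ τ := by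
  have h1 : ∀ (n : ℕ), (GMat N ⊗ₖ (1 : Matrix (Fin N) (Fin N) ℂ)) ^ n *
      RHat N (ξ + n * (τ + 1)) ζ τ =
      (∏ k ∈ Finset.range n, rho N ζ (e (2 * τ) ^ k * e (2 * ξ))) •
        (RHat N ξ ζ τ * (GMat N ⊗ₖ (1 : Matrix (Fin N) (Fin N) ℂ)) ^ n) := by
    intro n
    induction n with
    | zero => simp
    | succ n ih =>
      have hr : Regular (e ζ) (e (2 * τ)) (e (2 * (ξ + n * (τ + 1)))) := by
        rw [e_two_mul_add_natCast_mul_tau]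
        exact_mod_cast h.p_zpow_mul (e_ne_zero _) (e_ne_zero _) n
      rw [pow_succ, mul_assoc, show ξ + ((n + 1 : ℕ) : ℂ) * (τ + 1) =
        ξ + n * (τ + 1) + τ + 1 by push_cast; ring, GMat_mul_RHat_add hN hζ hτ hr,
        Matrix.mul_smul, ← mul_assoc, ih, Matrix.smul_mul, smul_smul, Finset.prod_range_succ,
        e_two_mul_add_natCast_mul_tau, mul_assoc, mul_comm (rho _ _ _)]
  have h2 : (GMat N ⊗ₖ (1 : Matrix (Fin N) (Fin N) ℂ)) ^ (N * m) =
      e (N + 1) ^ m • (1 : Matrix _ _ ℂ) := by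
    rw [pow_mul, kronecker_one_pow, GMat_pow_self hN, Matrix.smul_kronecker,
      Matrix.one_kronecker_one, smul_pow, one_pow]
  have h3 := h1 (N * m)
  rw [h2, Matrix.smul_mul, one_mul, Matrix.mul_smul, mul_one, smul_comm] at h3
  exact smul_right_injective _ (pow_ne_zero m (e_ne_zero _)) h3

end

/-! ### Matrices over an algebra -/

section

variable {n A : Type*} [DecidableEq n] [Ring A]

theorem map_mul_kronecker_one_apply [Fintype n] [Algebra ℂ A] (X : Matrix (n × n) (n × n) ℂ)
    (T : Matrix n n A) (p : n × n) (b l : n) :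
    (X.map (algebraMap ℂ A) * (T ⊗ₖ (1 : Matrix n n A))) p (b, l) =
      ∑ a, X p (a, l) • T a b := by
  simp only [Matrix.mul_apply, Fintype.sum_prod_type, Matrix.kroneckerMap_apply, Matrix.map_apply,
    Matrix.one_apply, mul_ite, mul_one, mul_zero, Finset.sum_ite_eq', Finset.mem_univ, if_true,
    Algebra.smul_def]

theorem map_mul_one_kronecker_apply [Fintype n] [Algebra ℂ A] (Y : Matrix (n × n) (n × n) ℂ)
    (L : Matrix n n A) (p : n × n) (a j : n) :
    (Y.map (algebraMap ℂ A) * ((1 : Matrix n n A) ⊗ₖ L)) p (a, j) =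
      ∑ m, Y p (a, m) • L m j := by
  simp only [Matrix.mul_apply, Fintype.sum_prod_type_right, Matrix.kroneckerMap_apply,
    Matrix.map_apply, Matrix.one_apply, ite_mul, mul_ite, one_mul, zero_mul, mul_zero,
    Finset.sum_ite_eq', Finset.mem_univ, if_true, Algebra.smul_def]

/-- If the contraction of `X` and `Y` is trivial, the partial trace of `X T₁ Y L₂` over the first
tensor factor is `Tr(T) L`. -/
theorem partialTrace_of_contract_eq_one [Fintype n] [Algebra ℂ A]
    {X Y : Matrix (n × n) (n × n) ℂ} (h : contract X Y = 1) (T L : Matrix n n A) (i j : n) :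
    ∑ a, (X.map (algebraMap ℂ A) * (T ⊗ₖ (1 : Matrix n n A)) *
      (Y.map (algebraMap ℂ A) * ((1 : Matrix n n A) ⊗ₖ L))) (a, i) (a, j) = T.trace * L i j := by
  have h1 : ∀ b b' m, ∑ a, ∑ l, X (a, i) (b, l) * Y (b', l) (a, m) =
      if b = b' ∧ i = m then 1 else 0 := fun b b' m => by
    have := congrFun (congrFun h (b, i)) (b', m)
    simpa only [contract, Matrix.of_apply, Matrix.one_apply, Prod.mk.injEq] using this
  calc
    _ = ∑ a, ∑ b', ∑ l, ∑ b, ∑ m,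
        (X (a, i) (b, l) * Y (b', l) (a, m)) • (T b b' * L m j) := by
      refine Finset.sum_congr rfl fun a _ => ?_
      rw [Matrix.mul_apply, Fintype.sum_prod_type]
      refine Finset.sum_congr rfl fun b' _ => Finset.sum_congr rfl fun l _ => ?_
      rw [map_mul_kronecker_one_apply, map_mul_one_kronecker_apply, Finset.sum_mul_sum]
      refine Finset.sum_congr rfl fun b _ => Finset.sum_congr rfl fun m _ => ?_
      rw [smul_mul_smul_comm]
    _ = ∑ b', ∑ b, ∑ m, (∑ a, ∑ l, X (a, i) (b, l) * Y (b', l) (a, m)) • (T b b' * L m j) := by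
      rw [Finset.sum_comm]
      refine Finset.sum_congr rfl fun b' _ => ?_
      simp only [Finset.sum_smul]
      rw [Finset.sum_congr rfl (fun a _ => Finset.sum_comm), Finset.sum_comm]
      refine Finset.sum_congr rfl fun b _ => ?_
      rw [Finset.sum_congr rfl (fun a _ => Finset.sum_comm), Finset.sum_comm]
    _ = _ := by
      simp only [h1, ite_and, ite_smul, one_smul, zero_smul]
      simp [Matrix.trace, Finset.sum_mul]

theorem partialTrace_mul [Fintype n] (T L : Matrix n n A) (i j : n) :
    ∑ a, (((1 : Matrix n n A) ⊗ₖ L) * (T ⊗ₖ (1 : Matrix n n A))) (a, i) (a, j) =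
      L i j * T.trace := by
  have : ∀ a b, (((1 : Matrix n n A) ⊗ₖ L) * (T ⊗ₖ (1 : Matrix n n A))) (a, i) (b, j) =
      L i j * T a b := fun a b => by
    simp [Matrix.mul_apply, Fintype.sum_prod_type, Matrix.kroneckerMap_apply, Matrix.one_apply]
  simp only [this, Matrix.trace, Finset.mul_sum, Matrix.diag_apply]

theorem kronecker_one_mul_kronecker_one [Fintype n] (S T : Matrix n n A) :
    (S ⊗ₖ (1 : Matrix n n A)) * (T ⊗ₖ 1) = (S * T) ⊗ₖ 1 := by
  ext ⟨a, b⟩ ⟨c, d⟩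
  simp only [Matrix.mul_apply, Fintype.sum_prod_type, Matrix.kroneckerMap_apply, Matrix.one_apply,
    mul_ite, mul_one, mul_zero, Finset.sum_ite_eq', Finset.mem_univ, if_true]
  split_ifs <;> simp

theorem map_kronecker_one_mul_one_kronecker [Fintype n] [Algebra ℂ A] (G : Matrix n n ℂ) (L : Matrix n n A) :
    (G.map (algebraMap ℂ A) ⊗ₖ (1 : Matrix n n A)) * ((1 : Matrix n n A) ⊗ₖ L) =
      ((1 : Matrix n n A) ⊗ₖ L) * (G.map (algebraMap ℂ A) ⊗ₖ (1 : Matrix n n A)) := by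
  ext ⟨a, b⟩ ⟨c, d⟩
  simp [Matrix.mul_apply, Fintype.sum_prod_type, Matrix.kroneckerMap_apply, Matrix.one_apply,
    Algebra.commutes]

theorem map_kronecker_one [Algebra ℂ A] (G : Matrix n n ℂ) :
    (G ⊗ₖ (1 : Matrix n n ℂ)).map (algebraMap ℂ A) =
      G.map (algebraMap ℂ A) ⊗ₖ (1 : Matrix n n A) := by
  ext ⟨a, b⟩ ⟨c, d⟩
  simp [Matrix.kroneckerMap_apply, Matrix.one_apply, apply_ite (algebraMap ℂ A)]

theorem map_smul_algebraMap [Algebra ℂ A] {m : Type*} (k : ℂ) (X : Matrix m m ℂ) :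
    (k • X).map (algebraMap ℂ A) = k • X.map (algebraMap ℂ A) := by
  ext a b
  simp [Algebra.smul_def]

end

/-! ### Exchange relations -/

/-- The element `g` acts on the first tensor factor and commutes with `l2`; carrying it across the
exchange relation replaces the shifted matrices by unshifted ones and `l` by its conjugate. -/
theorem exchange_conj {R : Type*} [Ring R] [Algebra ℂ R] {x xt xs xst g gi l l2 : R} {r r' : ℂ}
    (hex : xt * l * l2 = l2 * l * xst) (hg : g * xt = r • (x * g)) (hgs : g * xst = r' • (xs * g))
    (hgi : g * gi = 1) (hig : gi * g = 1) (hgl : g * l2 = l2 * g) :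
    r • (x * (g * l * gi) * l2) = r' • (l2 * (g * l * gi) * xs) := by
  have h1 : gi * l2 = l2 * gi := by
    calc gi * l2 = gi * l2 * (g * gi) := by rw [hgi, mul_one]
      _ = gi * (l2 * g) * gi := by simp only [mul_assoc]
      _ = (gi * g) * l2 * gi := by rw [← hgl]; simp only [mul_assoc]
      _ = l2 * gi := by rw [hig, one_mul]
  have h2 : xst * gi = r' • (gi * xs) := by
    calc xst * gi = (gi * g) * xst * gi := by rw [hig, one_mul]
      _ = gi * (g * xst) * gi := by simp only [mul_assoc]
      _ = r' • (gi * xs * (g * gi)) := by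
        rw [hgs, mul_smul_comm, smul_mul_assoc]; simp only [mul_assoc]
      _ = r' • (gi * xs) := by rw [hgi, mul_one]
  calc r • (x * (g * l * gi) * l2) = (r • (x * g)) * l * (gi * l2) := by
        rw [smul_mul_assoc, smul_mul_assoc]; simp only [mul_assoc]
    _ = g * (xt * l * l2) * gi := by rw [← hg, h1]; simp only [mul_assoc]
    _ = (g * l2) * l * (xst * gi) := by rw [hex]; simp only [mul_assoc]
    _ = _ := by rw [hgl, h2, mul_smul_comm]; simp only [mul_assoc]

/-- Both exchange relations have the same `xs` on the right, so it cancels between `a` and `b =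
m⁻¹`. -/
theorem exchange_ratio {R : Type*} [Ring R] [Algebra ℂ R] {x xi xs xsi x2 a b m l2 : R} {r r' : ℂ}
    (hm : r • (x * m * l2) = r' • (l2 * m * xs)) (ha : x2 * a * l2 = l2 * a * xs)
    (hmb : m * b = 1) (hbm : b * m = 1) (hx : xi * x = 1) (hxs : xs * xsi = 1) (hr' : r' ≠ 0) :
    x2 * (a * b) * (xi * l2) = (r / r') • (l2 * (a * b)) := by
  have h1 : b * (xi * l2) = (r / r') • (l2 * xsi * b) := by
    have h2 : r' • (b * (xi * l2)) = r • (l2 * xsi * b) := by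
      calc r' • (b * (xi * l2)) = r' • (b * xi * l2 * (m * (xs * xsi) * b)) := by
            rw [hxs, mul_one, hmb, mul_one, mul_assoc]
        _ = b * xi * (r' • (l2 * m * xs)) * xsi * b := by
            rw [mul_smul_comm, smul_mul_assoc, smul_mul_assoc]; simp only [mul_assoc]
        _ = r • (b * (xi * x) * m * l2 * xsi * b) := by
            rw [← hm, mul_smul_comm, smul_mul_assoc, smul_mul_assoc]; simp only [mul_assoc]
        _ = r • (l2 * xsi * b) := by rw [hx, mul_one, hbm, one_mul]
    rw [div_eq_inv_mul, mul_smul, ← h2, smul_smul, inv_mul_cancel₀ hr', one_smul]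
  calc x2 * (a * b) * (xi * l2) = x2 * a * (b * (xi * l2)) := by simp only [mul_assoc]
    _ = (r / r') • ((x2 * a * l2) * xsi * b) := by
      rw [h1, mul_smul_comm]; simp only [mul_assoc]
    _ = (r / r') • (l2 * a * (xs * xsi) * b) := by rw [ha]; simp only [mul_assoc]
    _ = _ := by rw [hxs, mul_one]; simp only [mul_assoc]

theorem exchange_L (N : ℕ) (ζ τ c ξ η : ℂ) (h : Generic ζ τ c (ξ - η)) :
    (RHat N (ξ - η) ζ τ).map (algebraMap ℂ (EllipticAlgebra N ζ τ c)) *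
        (L N ζ τ c ξ ⊗ₖ (1 : Matrix (Fin N) (Fin N) (EllipticAlgebra N ζ τ c))) *
        ((1 : Matrix (Fin N) (Fin N) (EllipticAlgebra N ζ τ c)) ⊗ₖ L N ζ τ c η) =
      ((1 : Matrix (Fin N) (Fin N) (EllipticAlgebra N ζ τ c)) ⊗ₖ L N ζ τ c η) *
        (L N ζ τ c ξ ⊗ₖ (1 : Matrix (Fin N) (Fin N) (EllipticAlgebra N ζ τ c))) *
        (RHat N (ξ - η) ζ (tauStar ζ τ c)).map (algebraMap ℂ (EllipticAlgebra N ζ τ c)) := by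
  have hS : ∀ X : Matrix (Fin N × Fin N) (Fin N × Fin N) ℂ,
      X.map (algebraMap ℂ (EllipticAlgebra N ζ τ c)) =
        (X.map (algebraMap ℂ (FreeAlgebra ℂ (Gen N)))).map (RingQuot.mkAlgHom ℂ (Rel N ζ τ c)) := by
    intro X
    ext a b
    simp only [Matrix.map_apply, AlgHom.commutes]
  have h1 : L N ζ τ c ξ ⊗ₖ (1 : Matrix (Fin N) (Fin N) (EllipticAlgebra N ζ τ c)) =
      (freeL₁ N ξ).map (RingQuot.mkAlgHom ℂ (Rel N ζ τ c)) := by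
    ext ⟨a, b⟩ ⟨a', b'⟩
    simp only [L, freeL₁, Matrix.kroneckerMap_apply, Matrix.map_apply, Matrix.one_apply, map_mul,
      apply_ite (RingQuot.mkAlgHom ℂ (Rel N ζ τ c)), map_one, map_zero]
  have h2 : (1 : Matrix (Fin N) (Fin N) (EllipticAlgebra N ζ τ c)) ⊗ₖ L N ζ τ c η =
      (freeL₂ N η).map (RingQuot.mkAlgHom ℂ (Rel N ζ τ c)) := by
    ext ⟨a, b⟩ ⟨a', b'⟩
    simp only [L, freeL₂, Matrix.kroneckerMap_apply, Matrix.map_apply, Matrix.one_apply, map_mul,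
      apply_ite (RingQuot.mkAlgHom ℂ (Rel N ζ τ c)), map_one, map_zero]
  rw [h1, h2, hS, hS, ← Matrix.map_mul, ← Matrix.map_mul, ← Matrix.map_mul, ← Matrix.map_mul]
  ext a b
  exact RingQuot.mkAlgHom_rel ℂ (Rel.exchange ξ η h a b)

theorem Generic.mul {ζ τ c u v : ℂ} (h : Generic ζ τ c u) (a b d : ℤ)
    (hv : e (2 * v) = e ζ ^ (2 * a) * e (2 * τ) ^ b * e (2 * tauStar ζ τ c) ^ d * e (2 * u)) :
    Generic ζ τ c v := fun a' b' d' h' => by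
  refine h (a' - a) (b' - b) (d' - d) ?_
  have h1 := e_ne_zero ζ
  have h2 := e_ne_zero (2 * τ)
  have h3 := e_ne_zero (2 * tauStar ζ τ c)
  rw [mul_sub, zpow_sub₀ h1, zpow_sub₀ h2, zpow_sub₀ h3]
  rw [hv] at h'
  field_simp
  linear_combination h'

theorem Generic.neg {ζ τ c u v : ℂ} (h : Generic ζ τ c u) (hv : v = -u) : Generic ζ τ c v :=
  fun a b d h' => by
    refine h (-a) (-b) (-d) ?_
    rw [show 2 * u = -(2 * v) by rw [hv]; ring, e_neg, h', mul_neg, zpow_neg, zpow_neg, zpow_neg,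
      mul_inv, mul_inv]

theorem Generic.add_central {ζ τ c u v : ℂ} (h : Generic ζ τ c u) (hv : v = u + c * ζ) :
    Generic ζ τ c v := by
  refine h.mul 0 1 (-1) ?_
  rw [mul_zero, zpow_zero, one_mul, zpow_one, zpow_neg_one, ← e_neg, ← e_add, ← e_add, hv, tauStar]
  congr 1
  ring

theorem Generic.add_tau_add_one {ζ τ c u v : ℂ} (h : Generic ζ τ c u) (hv : v = u + τ + 1) :
    Generic ζ τ c v := by
  refine h.mul 0 1 0 ?_
  rw [mul_zero, zpow_zero, one_mul, zpow_one, zpow_zero, mul_one, hv, e_two_mul_add_tau_add_one]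

theorem Generic.regular {ζ τ c u : ℂ} (h : Generic ζ τ c u) :
    Regular (e ζ) (e (2 * τ)) (e (2 * u)) := fun a b => by
  simpa using h a b 0

theorem Generic.regular_star {ζ τ c u : ℂ} (h : Generic ζ τ c u) :
    Regular (e ζ) (e (2 * tauStar ζ τ c)) (e (2 * u)) := fun a b => by
  simpa using h a 0 b

section

variable {N : ℕ} {ζ τ c ξ η : ℂ}

theorem exchange_Lminus (hN : N ≠ 0) (hζ : 0 < ζ.im) (hτ : 0 < τ.im)
    (hτs : 0 < (tauStar ζ τ c).im) (h : Generic ζ τ c (ξ - η)) :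
    rho N ζ (e (2 * (ξ - η))) •
      ((RHat N (ξ - η) ζ τ).map (algebraMap ℂ (EllipticAlgebra N ζ τ c)) *
        (Lminus N ζ τ c ξ ⊗ₖ (1 : Matrix (Fin N) (Fin N) (EllipticAlgebra N ζ τ c))) *
        ((1 : Matrix (Fin N) (Fin N) (EllipticAlgebra N ζ τ c)) ⊗ₖ L N ζ τ c η)) =
    rho N ζ (e (2 * (ξ - η + c * ζ))) •
      (((1 : Matrix (Fin N) (Fin N) (EllipticAlgebra N ζ τ c)) ⊗ₖ L N ζ τ c η) *
        (Lminus N ζ τ c ξ ⊗ₖ (1 : Matrix (Fin N) (Fin N) (EllipticAlgebra N ζ τ c))) *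
        (RHat N (ξ - η + c * ζ) ζ (tauStar ζ τ c)).map
          (algebraMap ℂ (EllipticAlgebra N ζ τ c))) := by
  have hu : ξ + τ + 1 - η = ξ - η + τ + 1 := by ring
  -- For the starred matrix the same shift consists of `q^c` followed by its own quasi-period; hence
  -- `R̂*` ends up at the argument shifted by `c * ζ`.
  have hu' : ξ + τ + 1 - η = ξ - η + c * ζ + tauStar ζ τ c + 1 := by rw [tauStar]; ring
  have hex := exchange_L N ζ τ c (ξ + τ + 1) η (h.add_tau_add_one hu)
  have hg := congrArg (fun X => X.map (algebraMap ℂ (EllipticAlgebra N ζ τ c)))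
    (GMat_mul_RHat_add hN hζ hτ h.regular)
  have hgs := congrArg (fun X => X.map (algebraMap ℂ (EllipticAlgebra N ζ τ c)))
    (GMat_mul_RHat_add hN hζ hτs (h.add_central rfl).regular_star)
  rw [← hu'] at hgs
  rw [← hu] at hg
  simp only [map_smul_algebraMap, Matrix.map_mul, map_kronecker_one] at hg hgs
  have hG1 : scal ζ τ c (GMat N) * scal ζ τ c (GMat N)⁻¹ = 1 := by
    rw [← scal_mul, Matrix.mul_nonsing_inv _ (isUnit_GMat N), scal_one]
  have hG2 : scal ζ τ c (GMat N)⁻¹ * scal ζ τ c (GMat N) = 1 := by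
    rw [← scal_mul, Matrix.nonsing_inv_mul _ (isUnit_GMat N), scal_one]
  have h1 : Lminus N ζ τ c ξ ⊗ₖ (1 : Matrix (Fin N) (Fin N) (EllipticAlgebra N ζ τ c)) =
      (scal ζ τ c (GMat N) ⊗ₖ (1 : Matrix (Fin N) (Fin N) (EllipticAlgebra N ζ τ c))) *
      (L N ζ τ c (ξ + τ + 1) ⊗ₖ (1 : Matrix (Fin N) (Fin N) (EllipticAlgebra N ζ τ c))) *
      (scal ζ τ c (GMat N)⁻¹ ⊗ₖ (1 : Matrix (Fin N) (Fin N) (EllipticAlgebra N ζ τ c))) := by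
    rw [kronecker_one_mul_kronecker_one, kronecker_one_mul_kronecker_one, Lminus]
  rw [h1]
  refine exchange_conj hex hg hgs ?_ ?_ (map_kronecker_one_mul_one_kronecker _ _)
  · change (scal ζ τ c (GMat N) ⊗ₖ 1) * _ = _
    rw [kronecker_one_mul_kronecker_one, hG1, Matrix.one_kronecker_one]
  · change _ * (scal ζ τ c (GMat N) ⊗ₖ 1) = _
    rw [kronecker_one_mul_kronecker_one, hG2, Matrix.one_kronecker_one]

/-- If `R̂(q⁻ᴺ z) = φ R̂(qᶜ z)`, then `t` and `L` commute up to a scalar. -/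
theorem t_mul_L_of_RHat_eq (hN : N ≠ 0) (hζ : 0 < ζ.im) (hτ : 0 < τ.im)
    (hτs : 0 < (tauStar ζ τ c).im) (hr : NonResonant ζ τ) (hrs : NonResonant ζ (tauStar ζ τ c))
    (h : Generic ζ τ c (ξ - η)) {φ : ℂ}
    (hφ : RHat N (ξ - η - N * ζ) ζ τ = φ • RHat N (ξ - η + c * ζ) ζ τ) (i j : Fin N) :
    t N ζ τ c ξ * L N ζ τ c η i j =
      (φ * (rho N ζ (e (2 * (ξ - η))) / rho N ζ (e (2 * (ξ - η + c * ζ))))) •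
        (L N ζ τ c η i j * t N ζ τ c ξ) := by
  have hc := h.add_central rfl
  have ha := exchange_L N ζ τ c (ξ + c * ζ) η (h.add_central (by ring))
  rw [show ξ + c * ζ - η = ξ - η + c * ζ by ring] at ha
  have hm := exchange_Lminus hN hζ hτ hτs h
  have hmap : ∀ {X Y : Matrix (Fin N × Fin N) (Fin N × Fin N) ℂ}, X * Y = 1 →
      X.map (algebraMap ℂ (EllipticAlgebra N ζ τ c)) *
        Y.map (algebraMap ℂ (EllipticAlgebra N ζ τ c)) = 1 := fun hXY => by
    rw [← Matrix.map_mul, hXY]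
    exact Matrix.map_one _ (map_zero _) (map_one _)
  have key := exchange_ratio hm ha
    (b := LminusInv N ζ τ c ξ ⊗ₖ (1 : Matrix (Fin N) (Fin N) (EllipticAlgebra N ζ τ c)))
    (by rw [kronecker_one_mul_kronecker_one, (Lminus_inverse N ζ τ c ξ).1,
      Matrix.one_kronecker_one])
    (by rw [kronecker_one_mul_kronecker_one, (Lminus_inverse N ζ τ c ξ).2,
      Matrix.one_kronecker_one])
    (hmap (RHatInv_mul_RHat hN hζ hτ hr h.regular))
    (hmap (RHat_mul_RHatInv hN hζ hτs hrs hc.regular_star))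
    (rho_ne_zero hN hζ (e_ne_zero _) hc.regular)
  have ht : t N ζ τ c ξ = (L N ζ τ c (ξ + c * ζ) * LminusInv N ζ τ c ξ).trace := by
    rw [t, Lplus, show ξ + c / 2 * ζ + c / 2 * ζ = ξ + c * ζ by ring]
  rw [kronecker_one_mul_kronecker_one] at key
  -- Crossing evaluates the partial trace with R̂ at `ξ - η - N * ζ`; the hypothesis `hφ` trades
  -- that matrix for the one occurring in `key`.
  have htr := partialTrace_of_contract_eq_one
    (contract_RHat_RHatInv hN hζ hτ hr h.regular)
    (L N ζ τ c (ξ + c * ζ) * LminusInv N ζ τ c ξ) (L N ζ τ c η) i j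
  rw [hφ, map_smul_algebraMap, Matrix.smul_mul, Matrix.smul_mul, key, smul_smul] at htr
  rw [ht, ← htr, ← partialTrace_mul, Finset.smul_sum]
  rfl

end

/-! ### The structure functions -/

section

variable {N : ℕ} {M : ℤ} {ζ τ c : ℂ}

/-- Taking the logarithm of the root equation leaves an ambiguity in `Nℤ`, exactly a period of `R̂`.
-/
theorem OnSurface.exists_central_eq (hN : N ≠ 0) (h : OnSurface N M ζ τ c) :
    ∃ k : ℤ, c * ζ = -(N * ζ) - N * M * (τ + 1) + k * N := by
  have hN' : (N : ℂ) ≠ 0 := by exact_mod_cast hN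
  have h1 := h.eqn_root
  rw [← e_int_mul, e_eq_e_iff] at h1
  obtain ⟨k, hk⟩ := h1
  refine ⟨k + M, ?_⟩
  field_simp at hk
  push_cast
  linear_combination hk

theorem OnSurface.e_two_mul_add (hN : N ≠ 0) (h : OnSurface N M ζ τ c) (u : ℂ) :
    e ζ ^ (2 * N) * e (2 * (u + c * ζ)) = e (2 * τ) ^ (-(N * M)) * e (2 * u) := by
  obtain ⟨k, hk⟩ := h.exists_central_eq hN
  rw [hk, ← e_int_mul, ← e_nat_mul, ← e_add, ← e_add, e_eq_e_iff]
  refine ⟨k * N - N * M, ?_⟩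
  push_cast
  ring

theorem rho_inv (N : ℕ) (ζ y : ℂ) : rho N ζ y⁻¹ = rho N ζ y := by
  rw [rho, rho, inv_inv, mul_comm (Theta _ y⁻¹), mul_comm (Theta _ (e ζ ^ 2 * y⁻¹))]

/-- The exchange factor in terms of theta functions of multiples of `y` only. -/
theorem rho_eq (hN : N ≠ 0) (hζ : 0 < ζ.im) {y : ℂ} (hy : y ≠ 0) :
    rho N ζ y = e ((2 - 2 / N) * ζ) * (e ζ ^ 2)⁻¹ * (Theta (e ζ ^ (2 * N)) y ^ 2 /
      (Theta (e ζ ^ (2 * N)) (e ζ ^ 2 * y) * Theta (e ζ ^ (2 * N)) ((e ζ ^ 2)⁻¹ * y))) := by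
  have hq : e ζ ^ 2 ≠ 0 := pow_ne_zero _ (e_ne_zero ζ)
  have hQ1 : ‖e ζ ^ (2 * N)‖ < 1 := norm_pow_two_mul_lt_one (norm_e_lt_one hζ) hN
  have h1 := Theta_inv hQ1 (mul_ne_zero (inv_ne_zero hq) hy)
  rw [mul_inv, inv_inv] at h1
  rw [rho, Theta_inv hQ1 hy, h1]
  field_simp

/-- In the form `rho_eq` the multipliers of numerator and denominator are both `y⁻²`. -/
theorem rho_Q_mul (hN : N ≠ 0) (hζ : 0 < ζ.im) {y : ℂ} (hy : y ≠ 0) :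
    rho N ζ (e ζ ^ (2 * N) * y) = rho N ζ y := by
  have hq : e ζ ^ 2 ≠ 0 := pow_ne_zero _ (e_ne_zero ζ)
  have hQ : e ζ ^ (2 * N) ≠ 0 := pow_ne_zero _ (e_ne_zero ζ)
  have hQ1 : ‖e ζ ^ (2 * N)‖ < 1 := norm_pow_two_mul_lt_one (norm_e_lt_one hζ) hN
  rw [rho_eq hN hζ hy, rho_eq hN hζ (mul_ne_zero hQ hy), mul_left_comm (e ζ ^ 2),
    mul_left_comm (e ζ ^ 2)⁻¹, Theta_mul_self hQ1 hQ hy, Theta_mul_self hQ1 hQ (mul_ne_zero hq hy),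
    Theta_mul_self hQ1 hQ (mul_ne_zero (inv_ne_zero hq) hy)]
  field_simp

/-- The power of `q` in front of `F` is distributed over the `N * M` factors, giving each the
constant of `rho`. -/
theorem F_of_pos (hN : N ≠ 0) (hM : 0 < M) (τ : ℂ) (y x : ℂ) (hx : y = x ^ (-2 : ℤ)) :
    F N M (e ζ) (e (2 * τ)) x =
      ∏ k ∈ Finset.range (N * M.natAbs), rho N ζ (e (2 * τ) ^ (-(k : ℤ)) * y) := by
  have hN' : (N : ℂ) ≠ 0 := by exact_mod_cast hN
  have hxy : x ^ 2 = y⁻¹ := by rw [hx, zpow_neg, inv_inv]; norm_cast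
  have hM' : ((M.natAbs : ℕ) : ℂ) = M := by
    rw [← Int.cast_natCast, Int.natCast_natAbs, abs_of_pos hM]
  have hc : e ζ ^ (2 * M * ((N : ℤ) - 1)) =
      ∏ _k ∈ Finset.range (N * M.natAbs), e ((2 - 2 / N) * ζ) := by
    rw [Finset.prod_const, Finset.card_range, ← e_nat_mul, ← e_int_mul]
    congr 1
    push_cast
    rw [hM']
    field_simp
  rw [F, if_pos hM, hc, ← Finset.prod_mul_distrib, ← hx, hxy]
  refine Finset.prod_congr rfl fun k _ => ?_
  have h1 : (e (2 * τ) ^ (-(k : ℤ)) * y)⁻¹ = y⁻¹ * e (2 * τ) ^ k := by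
    rw [mul_inv, zpow_neg, inv_inv, zpow_natCast, mul_comm]
  have h2 : e ζ ^ 2 * (e (2 * τ) ^ (-(k : ℤ)) * y) = y * e ζ ^ 2 * e (2 * τ) ^ (-(k : ℤ)) := by
    ring
  rw [rho, h1, h2, mul_comm _ y, ← mul_assoc (e ζ ^ 2), mul_comm (e ζ ^ 2) y⁻¹]

theorem F_of_nonpos (hN : N ≠ 0) (hM : ¬ 0 < M) (τ : ℂ) (y x : ℂ) (hx : y = x ^ (-2 : ℤ)) :
    F N M (e ζ) (e (2 * τ)) x =
      ∏ k ∈ Finset.Icc 1 (N * M.natAbs), (rho N ζ (e (2 * τ) ^ k * y))⁻¹ := by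
  have hN' : (N : ℂ) ≠ 0 := by exact_mod_cast hN
  have hxy : x ^ 2 = y⁻¹ := by rw [hx, zpow_neg, inv_inv]; norm_cast
  have hc : e ζ ^ (-2 * (M.natAbs : ℤ) * ((N : ℤ) - 1)) =
      ∏ _k ∈ Finset.Icc 1 (N * M.natAbs), (e ((2 - 2 / N) * ζ))⁻¹ := by
    rw [Finset.prod_const, Nat.card_Icc, ← e_neg, ← e_nat_mul, ← e_int_mul, Nat.add_sub_cancel]
    congr 1
    generalize M.natAbs = m
    push_cast
    field_simp
  rw [F, if_neg hM, hc, ← Finset.prod_mul_distrib, ← hx, hxy]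
  refine Finset.prod_congr rfl fun k _ => ?_
  have h1 : (e (2 * τ) ^ k * y)⁻¹ = y⁻¹ * e (2 * τ) ^ (-(k : ℤ)) := by
    rw [mul_inv, zpow_neg, zpow_natCast, mul_comm]
  have h2 : e ζ ^ 2 * (e (2 * τ) ^ k * y) = y * e ζ ^ 2 * e (2 * τ) ^ k := by
    ring
  rw [rho, h1, h2, mul_inv, inv_div, mul_comm _ y, ← mul_assoc (e ζ ^ 2), mul_comm (e ζ ^ 2) y⁻¹]

theorem Y_eq_prod_rho (hN : N ≠ 0) (hζ : 0 < ζ.im) (M : ℤ) (τ : ℂ) (y x : ℂ) (hy : y ≠ 0)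
    (hx : y = x ^ (-2 : ℤ)) :
    Y N M (e ζ) (e (2 * τ)) x =
      ∏ k ∈ Finset.Icc 1 (if 0 < M then N * M.natAbs else N * M.natAbs - 1),
        rho N ζ (e (2 * τ) ^ k * y) / rho N ζ (e (2 * τ) ^ (-(k : ℤ)) * y) := by
  have hxy : x ^ 2 = y⁻¹ := by rw [hx, zpow_neg, inv_inv]; norm_cast
  have hp := e_ne_zero (2 * τ)
  rw [Y, hxy]
  refine Finset.prod_congr rfl fun k _ => ?_
  have h1 : (e (2 * τ) ^ k * y)⁻¹ = y⁻¹ * e (2 * τ) ^ (-(k : ℤ)) := by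
    rw [mul_inv, zpow_neg, zpow_natCast, mul_comm]
  have h2 : (e (2 * τ) ^ (-(k : ℤ)) * y)⁻¹ = y⁻¹ * e (2 * τ) ^ k := by
    rw [mul_inv, zpow_neg, inv_inv, zpow_natCast, mul_comm]
  have h3 : e ((2 - 2 / N) * ζ) * (e ζ ^ 2)⁻¹ ≠ 0 :=
    mul_ne_zero (e_ne_zero _) (inv_ne_zero (pow_ne_zero _ (e_ne_zero ζ)))
  have hyi := inv_ne_zero hy
  have h4 : e ζ ^ (-2 : ℤ) = (e ζ ^ 2)⁻¹ := by rw [zpow_neg]; norm_cast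
  rw [← rho_inv, ← rho_inv N ζ (e (2 * τ) ^ (-(k : ℤ)) * y), h1, h2,
    rho_eq hN hζ (mul_ne_zero hyi (zpow_ne_zero _ hp)),
    rho_eq hN hζ (mul_ne_zero hyi (pow_ne_zero _ hp)), mul_div_mul_left _ _ h3, h4,
    mul_right_comm y⁻¹ (e ζ ^ 2), mul_right_comm y⁻¹ (e ζ ^ 2), mul_right_comm y⁻¹ (e ζ ^ 2)⁻¹,
    mul_right_comm y⁻¹ (e ζ ^ 2)⁻¹]
  simp only [mul_comm (e ζ ^ 2), mul_comm (e ζ ^ 2)⁻¹, div_div_eq_mul_div, div_mul_eq_mul_div,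
    div_div]
  congr 1 <;> ring

theorem e_sub_zpow_neg_two (ξ η : ℂ) : e (2 * (ξ - η)) = e (η - ξ) ^ (-2 : ℤ) := by
  rw [← e_int_mul]; congr 1; push_cast; ring

theorem F_ne_zero (hN : N ≠ 0) (hζ : 0 < ζ.im) {ξ η : ℂ}
    (h : Regular (e ζ) (e (2 * τ)) (e (2 * (ξ - η)))) :
    F N M (e ζ) (e (2 * τ)) (e (η - ξ)) ≠ 0 := by
  have hp := e_ne_zero (2 * τ)
  have hρ : ∀ k : ℤ, rho N ζ (e (2 * τ) ^ k * e (2 * (ξ - η))) ≠ 0 := fun k =>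
    rho_ne_zero hN hζ (mul_ne_zero (zpow_ne_zero _ hp) (e_ne_zero _))
      (h.p_zpow_mul (e_ne_zero _) hp k)
  by_cases hM : 0 < M
  · rw [F_of_pos hN hM τ _ _ (e_sub_zpow_neg_two ξ η)]
    exact Finset.prod_ne_zero_iff.2 fun k _ => hρ _
  · rw [F_of_nonpos hN hM τ _ _ (e_sub_zpow_neg_two ξ η)]
    exact Finset.prod_ne_zero_iff.2 fun k _ => inv_ne_zero (by exact_mod_cast hρ k)

/-- For `M > 0` the steps lead from `u + c * ζ` up to `u - N * ζ`, modulo periods. For `M ≤ 0` the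
direction is reversed, whence the inverse product in `RHat_sub_eq_of_nonpos`. -/
theorem RHat_sub_eq_of_pos (hN : N ≠ 0) (hζ : 0 < ζ.im) (hτ : 0 < τ.im)
    (hs : OnSurface N M ζ τ c) {u : ℂ} (hM : 0 < M)
    (h : Regular (e ζ) (e (2 * τ)) (e (2 * (u + c * ζ)))) :
    RHat N (u - N * ζ) ζ τ = (∏ k ∈ Finset.range (N * M.natAbs),
      rho N ζ (e (2 * τ) ^ (-(k + 1 : ℤ)) * e (2 * u))) • RHat N (u + c * ζ) ζ τ := by
  have hp := e_ne_zero (2 * τ)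
  obtain ⟨k, hk⟩ := hs.exists_central_eq hN
  have hM' : ((M.natAbs : ℕ) : ℂ) = M := by
    rw [← Int.cast_natCast, Int.natCast_natAbs, abs_of_pos hM]
  have hM'' : ((M.natAbs : ℕ) : ℤ) = M := by rw [Int.natCast_natAbs, abs_of_pos hM]
  have h1 := RHat_add_natCast_mul_tau hN hζ hτ M.natAbs h
  rw [show u + c * ζ + ((N * M.natAbs : ℕ) : ℂ) * (τ + 1) = u - N * ζ + k * N by
    rw [hk]; push_cast; rw [hM']; ring, RHat_add_intCast_mul] at h1
  rw [h1, ← Finset.prod_range_reflect]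
  congr 1
  refine Finset.prod_congr rfl fun j hj => ?_
  have hj := Finset.mem_range.1 hj
  rw [← rho_Q_mul hN hζ (mul_ne_zero (pow_ne_zero _ hp) (e_ne_zero _)), mul_left_comm,
    hs.e_two_mul_add hN, ← mul_assoc, ← zpow_natCast, ← zpow_add₀ hp]
  congr 3
  have : ((N * M.natAbs - 1 - j : ℕ) : ℤ) = N * M.natAbs - 1 - j := by
    rw [Nat.cast_sub (by omega), Nat.cast_sub (by omega)]; push_cast; ring
  rw [this, hM'']
  ring

theorem RHat_sub_eq_of_nonpos (hN : N ≠ 0) (hζ : 0 < ζ.im) (hτ : 0 < τ.im)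
    (hs : OnSurface N M ζ τ c) {u : ℂ} (hM : ¬ 0 < M)
    (h : Regular (e ζ) (e (2 * τ)) (e (2 * u))) :
    RHat N (u - N * ζ) ζ τ = (∏ k ∈ Finset.range (N * M.natAbs),
      rho N ζ (e (2 * τ) ^ k * e (2 * u)))⁻¹ • RHat N (u + c * ζ) ζ τ := by
  have hp := e_ne_zero (2 * τ)
  obtain ⟨k, hk⟩ := hs.exists_central_eq hN
  have hM' : ((M.natAbs : ℕ) : ℂ) = -M := by
    rw [← Int.cast_natCast, Int.natCast_natAbs, abs_of_nonpos (not_lt.1 hM), Int.cast_neg]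
  have hρ : ∀ k : ℕ, rho N ζ (e (2 * τ) ^ k * e (2 * (u - N * ζ))) =
      rho N ζ (e (2 * τ) ^ k * e (2 * u)) := fun k => by
    rw [← rho_Q_mul hN hζ (mul_ne_zero (pow_ne_zero _ hp) (e_ne_zero (2 * (u - N * ζ)))),
      mul_left_comm, ← e_two_mul_add_natCast_mul, sub_add_cancel]
  have h1 := RHat_add_natCast_mul_tau hN hζ hτ M.natAbs (h.sub_natCast_mul N)
  have h2 : u + c * ζ = u - N * ζ + ((N * M.natAbs : ℕ) : ℂ) * (τ + 1) + k * N := by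
    rw [hk]; push_cast; rw [hM']; ring
  rw [h2, RHat_add_intCast_mul, h1, smul_smul]
  simp only [hρ]
  rw [inv_mul_cancel₀, one_smul]
  refine Finset.prod_ne_zero_iff.2 fun k _ =>
    rho_ne_zero (τ := τ) hN hζ (mul_ne_zero (pow_ne_zero _ hp) (e_ne_zero _)) ?_
  exact_mod_cast h.p_zpow_mul (e_ne_zero _) hp k

/-- On the surface `Σ_{N,M}`, `t` commutes with `L` up to the factor `F`. -/
theorem t_mul_L (hN : N ≠ 0) (hζ : 0 < ζ.im) (hτ : 0 < τ.im)
    (hτs : 0 < (tauStar ζ τ c).im) (hr : NonResonant ζ τ) (hrs : NonResonant ζ (tauStar ζ τ c))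
    (hs : OnSurface N M ζ τ c) {ξ η : ℂ} (h : Generic ζ τ c (ξ - η)) (i j : Fin N) :
    t N ζ τ c ξ * L N ζ τ c η i j =
      F N M (e ζ) (e (2 * τ)) (e (η - ξ)) • (L N ζ τ c η i j * t N ζ τ c ξ) := by
  have hp := e_ne_zero (2 * τ)
  have hc := h.add_central rfl
  have hρ : ∀ k : ℤ, rho N ζ (e (2 * τ) ^ k * e (2 * (ξ - η))) ≠ 0 := fun k =>
    rho_ne_zero hN hζ (mul_ne_zero (zpow_ne_zero _ hp) (e_ne_zero _))
      (h.regular.p_zpow_mul (e_ne_zero _) hp k)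
  have hρc : rho N ζ (e (2 * (ξ - η + c * ζ))) =
      rho N ζ (e (2 * τ) ^ (-(N * M)) * e (2 * (ξ - η))) := by
    rw [← rho_Q_mul hN hζ (e_ne_zero _), hs.e_two_mul_add hN]
  by_cases hM : 0 < M
  · rw [t_mul_L_of_RHat_eq hN hζ hτ hτs hr hrs h (RHat_sub_eq_of_pos hN hζ hτ hs hM hc.regular),
      F_of_pos hN hM τ _ _ (e_sub_zpow_neg_two ξ η), hρc]
    congr 1
    -- The proportionality factor runs over `k = 1, …, NM`, while `F` runs over `k = 0, …, NM - 1`;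
    -- the ratio of the two values of `rho` exchanges the end terms.
    rw [mul_div_assoc', div_eq_iff (hρ _)]
    have h1 := Finset.prod_range_succ' (fun k : ℕ =>
      rho N ζ (e (2 * τ) ^ (-(k : ℤ)) * e (2 * (ξ - η)))) (N * M.natAbs)
    rw [Finset.prod_range_succ] at h1
    have hM'' : (((N * M.natAbs : ℕ)) : ℤ) = N * M := by
      rw [Nat.cast_mul, Int.natCast_natAbs, abs_of_pos hM]
    rw [hM''] at h1
    simpa using h1.symm
  · rw [t_mul_L_of_RHat_eq hN hζ hτ hτs hr hrs h (RHat_sub_eq_of_nonpos hN hζ hτ hs hM h.regular),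
      F_of_nonpos hN hM τ _ _ (e_sub_zpow_neg_two ξ η), hρc]
    congr 1
    have hρ' : ∀ k : ℕ, rho N ζ (e (2 * τ) ^ k * e (2 * (ξ - η))) ≠ 0 := fun k => by
      exact_mod_cast hρ k
    have h1 := Finset.prod_range_succ' (fun k : ℕ =>
      rho N ζ (e (2 * τ) ^ k * e (2 * (ξ - η)))) (N * M.natAbs)
    rw [Finset.prod_range_succ] at h1
    have hM'' : -((N : ℤ) * M) = ((N * M.natAbs : ℕ) : ℤ) := by
      rw [Nat.cast_mul, Int.natCast_natAbs, abs_of_nonpos (not_lt.1 hM), mul_neg]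
    have h2 : ∏ k ∈ Finset.Icc 1 (N * M.natAbs), rho N ζ (e (2 * τ) ^ k * e (2 * (ξ - η))) =
        ∏ k ∈ Finset.range (N * M.natAbs), rho N ζ (e (2 * τ) ^ (k + 1) * e (2 * (ξ - η))) := by
      rw [Finset.range_eq_Ico, Finset.prod_Ico_add' (fun k : ℕ =>
        rho N ζ (e (2 * τ) ^ k * e (2 * (ξ - η))))]
      rfl
    rw [Finset.prod_inv_distrib, h2, hM'', zpow_natCast]
    rw [pow_zero, one_mul] at h1
    have n1 : ∏ k ∈ Finset.range (N * M.natAbs), rho N ζ (e (2 * τ) ^ k * e (2 * (ξ - η))) ≠ 0 :=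
      Finset.prod_ne_zero_iff.2 fun k _ => hρ' _
    have n2 : ∏ k ∈ Finset.range (N * M.natAbs),
        rho N ζ (e (2 * τ) ^ (k + 1) * e (2 * (ξ - η))) ≠ 0 :=
      Finset.prod_ne_zero_iff.2 fun k _ => hρ' _
    have n3 := hρ' (N * M.natAbs)
    generalize ∏ k ∈ Finset.range (N * M.natAbs), rho N ζ (e (2 * τ) ^ k * e (2 * (ξ - η))) = P1 at *
    generalize ∏ k ∈ Finset.range (N * M.natAbs),
      rho N ζ (e (2 * τ) ^ (k + 1) * e (2 * (ξ - η))) = P2 at *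
    generalize rho N ζ (e (2 * τ) ^ (N * M.natAbs) * e (2 * (ξ - η))) = P3 at *
    field_simp
    linear_combination -h1

end

theorem prod_Icc_one_eq_prod_range {R : Type*} [CommMonoid R] (f : ℕ → R) (n : ℕ) :
    ∏ k ∈ Finset.Icc 1 n, f k = ∏ k ∈ Finset.range n, f (k + 1) := by
  rw [Finset.range_eq_Ico, Finset.prod_Ico_add']
  rfl

section

variable {N : ℕ} {M : ℤ} {ζ τ c : ℂ}

/-- `𝒴(x) = F(M, q^c x) / F(M, -p^{1/2} x)` on the surface `Σ_{N,M}`. -/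
theorem F_div_F (hN : N ≠ 0) (hζ : 0 < ζ.im) (hs : OnSurface N M ζ τ c) {ξ η : ℂ}
    (h : Regular (e ζ) (e (2 * τ)) (e (2 * (ξ - η)))) :
    F N M (e ζ) (e (2 * τ)) (e (η + c * ζ - ξ)) / F N M (e ζ) (e (2 * τ)) (e (η + τ + 1 - ξ)) =
      Y N M (e ζ) (e (2 * τ)) (e (η - ξ)) := by
  have hp := e_ne_zero (2 * τ)
  have hρ : ∀ k : ℤ, rho N ζ (e (2 * τ) ^ k * e (2 * (ξ - η))) ≠ 0 := fun k =>
    rho_ne_zero hN hζ (mul_ne_zero (zpow_ne_zero _ hp) (e_ne_zero _))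
      (h.p_zpow_mul (e_ne_zero _) hp k)
  have h1 : ∀ k : ℤ, rho N ζ (e (2 * τ) ^ k * e (2 * (ξ - (η + c * ζ)))) =
      rho N ζ (e (2 * τ) ^ (k + N * M) * e (2 * (ξ - η))) := fun k => by
    have := hs.e_two_mul_add hN (ξ - (η + c * ζ))
    rw [show ξ - (η + c * ζ) + c * ζ = ξ - η by ring] at this
    rw [← rho_Q_mul hN hζ (mul_ne_zero (zpow_ne_zero (k + N * M) hp) (e_ne_zero (2 * (ξ - η)))),
      mul_left_comm, this, ← mul_assoc, ← zpow_add₀ hp, add_neg_cancel_right]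
  have h2 : e (2 * (ξ - (η + τ + 1))) = (e (2 * τ))⁻¹ * e (2 * (ξ - η)) := by
    rw [eq_inv_mul_iff_mul_eq₀ hp, ← e_two_mul_add_tau_add_one]
    congr 2
    ring
  by_cases hM : 0 < M
  · have hM' : (((N * M.natAbs : ℕ)) : ℤ) = N * M := by
      rw [Nat.cast_mul, Int.natCast_natAbs, abs_of_pos hM]
    rw [F_of_pos hN hM τ _ _ (e_sub_zpow_neg_two ξ (η + c * ζ)),
      F_of_pos hN hM τ _ _ (e_sub_zpow_neg_two ξ (η + τ + 1)),
      Y_eq_prod_rho hN hζ M τ _ _ (e_ne_zero _) (e_sub_zpow_neg_two ξ η), if_pos hM,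
      prod_Icc_one_eq_prod_range, Finset.prod_div_distrib, ← Finset.prod_range_reflect]
    congr 1
    · refine Finset.prod_congr rfl fun j hj => ?_
      have hj := Finset.mem_range.1 hj
      have : ((N * M.natAbs - 1 - j : ℕ) : ℤ) = (N * M.natAbs : ℕ) - 1 - j := by omega
      rw [h1, this, hM', ← zpow_natCast]
      congr 3
      push_cast
      ring
    · refine Finset.prod_congr rfl fun j _ => ?_
      rw [h2, ← mul_assoc, ← zpow_neg_one, ← zpow_add₀ hp]
      congr 3
      push_cast
      ring
  · have hM' : (((N * M.natAbs : ℕ)) : ℤ) = -(N * M) := by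
      rw [Nat.cast_mul, Int.natCast_natAbs, abs_of_nonpos (not_lt.1 hM), mul_neg]
    rw [F_of_nonpos hN hM τ _ _ (e_sub_zpow_neg_two ξ (η + c * ζ)),
      F_of_nonpos hN hM τ _ _ (e_sub_zpow_neg_two ξ (η + τ + 1)),
      Y_eq_prod_rho hN hζ M τ _ _ (e_ne_zero _) (e_sub_zpow_neg_two ξ η), if_neg hM,
      prod_Icc_one_eq_prod_range, prod_Icc_one_eq_prod_range, prod_Icc_one_eq_prod_range,
      ← Finset.prod_range_reflect]
    have h3 : ∀ j ∈ Finset.range (N * M.natAbs),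
        (rho N ζ (e (2 * τ) ^ (N * M.natAbs - 1 - j + 1) * e (2 * (ξ - (η + c * ζ)))))⁻¹ =
          (rho N ζ (e (2 * τ) ^ (-(j : ℤ)) * e (2 * (ξ - η))))⁻¹ := fun j hj => by
      have hj := Finset.mem_range.1 hj
      have : ((N * M.natAbs - 1 - j + 1 : ℕ) : ℤ) = (N * M.natAbs : ℕ) - j := by omega
      rw [← zpow_natCast, h1, this, hM']
      congr 4
      ring
    have h4 : ∀ j : ℕ, (rho N ζ (e (2 * τ) ^ (j + 1) * e (2 * (ξ - (η + τ + 1)))))⁻¹ =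
          (rho N ζ (e (2 * τ) ^ j * e (2 * (ξ - η))))⁻¹ := fun j => by
      rw [h2, pow_succ, mul_assoc, mul_inv_cancel_left₀ hp]
    rw [Finset.prod_congr rfl h3, Finset.prod_congr rfl fun j _ => h4 j]
    -- The factors with `j = 0` coincide and cancel, which explains the upper limit `N|M| - 1`. The
    -- case of length 0 is separate because there the natural subtraction is truncated.
    rcases hn : N * M.natAbs with _ | n
    · simp
    · have := hρ 0
      rw [zpow_zero, one_mul] at this
      rw [Finset.prod_range_succ', Finset.prod_range_succ', Nat.add_sub_cancel,
        Finset.prod_div_distrib]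
      simp only [Finset.prod_inv_distrib, Nat.cast_zero, neg_zero, zpow_zero, pow_zero, one_mul]
      rw [mul_div_mul_right _ _ (inv_ne_zero this), inv_div_inv]

/-! ### Exchange of two operators `t`. -/

theorem trace_diagonal_mul {n A : Type*} [Fintype n] [DecidableEq n] [Ring A] (a : A)
    (X : Matrix n n A) : (Matrix.diagonal (fun _ => a) * X).trace = a * X.trace := by
  simp [Matrix.trace, Matrix.diagonal_mul, Finset.mul_sum]

theorem trace_mul_diagonal {n A : Type*} [Fintype n] [DecidableEq n] [Ring A] (a : A)
    (X : Matrix n n A) : (X * Matrix.diagonal (fun _ => a)).trace = X.trace * a := by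
  simp [Matrix.trace, Matrix.mul_diagonal, Finset.sum_mul]

theorem scal_commute_diagonal (X : Matrix (Fin N) (Fin N) ℂ) (a : EllipticAlgebra N ζ τ c) :
    Matrix.diagonal (fun _ => a) * scal ζ τ c X = scal ζ τ c X * Matrix.diagonal fun _ => a := by
  ext i j
  rw [Matrix.diagonal_mul, Matrix.mul_diagonal, scal, Matrix.map_apply, Algebra.commutes]

theorem t_mul_t (hN : N ≠ 0) (hζ : 0 < ζ.im) (hτ : 0 < τ.im)
    (hτs : 0 < (tauStar ζ τ c).im) (hr : NonResonant ζ τ) (hrs : NonResonant ζ (tauStar ζ τ c))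
    (hs : OnSurface N M ζ τ c) {ξ η : ℂ} (h : Generic ζ τ c (η - ξ)) :
    t N ζ τ c ξ * t N ζ τ c η =
      Y N M (e ζ) (e (2 * τ)) (e (η - ξ)) • (t N ζ τ c η * t N ζ τ c ξ) := by
  have hu : Generic ζ τ c (ξ - η) := h.neg (neg_sub _ _).symm
  have h1 : Generic ζ τ c (ξ - (η + c * ζ)) :=
    (h.add_central rfl).neg (by ring)
  have h2 : Generic ζ τ c (ξ - (η + τ + 1)) :=
    (h.add_tau_add_one rfl).neg (by ring)
  rw [← F_div_F hN hζ hs hu.regular]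
  have hF2 : F N M (e ζ) (e (2 * τ)) (e (η + τ + 1 - ξ)) ≠ 0 := F_ne_zero hN hζ h2.regular
  set F1 := F N M (e ζ) (e (2 * τ)) (e (η + c * ζ - ξ))
  set F2 := F N M (e ζ) (e (2 * τ)) (e (η + τ + 1 - ξ))
  -- The scalar matrix with entry t(z) turns the entrywise relations into matrix relations; it
  -- commutes with `G`.
  set D : Matrix (Fin N) (Fin N) (EllipticAlgebra N ζ τ c) :=
    Matrix.diagonal fun _ => t N ζ τ c ξ with hD
  have hDL : ∀ {η' : ℂ}, Generic ζ τ c (ξ - η') → D * L N ζ τ c η' =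
      F N M (e ζ) (e (2 * τ)) (e (η' - ξ)) • (L N ζ τ c η' * D) := fun {η'} h' => by
    ext i j
    rw [Matrix.smul_apply, hD, Matrix.diagonal_mul, Matrix.mul_diagonal]
    exact t_mul_L hN hζ hτ hτs hr hrs hs h' i j
  have hL : D * L N ζ τ c (η + c * ζ) = F1 • (L N ζ τ c (η + c * ζ) * D) := hDL h1
  -- Multiplying the relation for L by its inverse on both sides inverts the factor.
  have hLi : D * Linv N ζ τ c (η + τ + 1) = F2⁻¹ • (Linv N ζ τ c (η + τ + 1) * D) := by
    have : Linv N ζ τ c (η + τ + 1) * (D * L N ζ τ c (η + τ + 1)) * Linv N ζ τ c (η + τ + 1) =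
        Linv N ζ τ c (η + τ + 1) * (F2 • (L N ζ τ c (η + τ + 1) * D)) *
          Linv N ζ τ c (η + τ + 1) := by rw [hDL h2]
    rw [mul_assoc, mul_assoc D, L_mul_Linv, mul_one, Matrix.mul_smul, ← mul_assoc, Linv_mul_L,
      one_mul, Matrix.smul_mul] at this
    rw [this, smul_smul, inv_mul_cancel₀ hF2, one_smul]
  have key : D * (L N ζ τ c (η + c * ζ) * LminusInv N ζ τ c η) =
      (F1 / F2) • (L N ζ τ c (η + c * ζ) * LminusInv N ζ τ c η * D) := by
    calc D * (L N ζ τ c (η + c * ζ) * LminusInv N ζ τ c η)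
        = F1 • (L N ζ τ c (η + c * ζ) * (D * scal ζ τ c (GMat N)) *
            Linv N ζ τ c (η + τ + 1) * scal ζ τ c (GMat N)⁻¹) := by
          rw [← mul_assoc, hL, Matrix.smul_mul, LminusInv]
          simp only [mul_assoc]
      _ = F1 • (L N ζ τ c (η + c * ζ) * scal ζ τ c (GMat N) *
            (D * Linv N ζ τ c (η + τ + 1)) * scal ζ τ c (GMat N)⁻¹) := by
          rw [hD, scal_commute_diagonal]
          simp only [mul_assoc]
      _ = (F1 / F2) • (L N ζ τ c (η + c * ζ) * scal ζ τ c (GMat N) *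
            Linv N ζ τ c (η + τ + 1) * (D * scal ζ τ c (GMat N)⁻¹)) := by
          rw [hLi, Matrix.mul_smul, Matrix.smul_mul, smul_smul, div_eq_mul_inv]
          simp only [mul_assoc]
      _ = _ := by
          rw [hD, scal_commute_diagonal, LminusInv]
          simp only [mul_assoc]
  have ht : t N ζ τ c η = (L N ζ τ c (η + c * ζ) * LminusInv N ζ τ c η).trace := by
    rw [t, Lplus, show η + c / 2 * ζ + c / 2 * ζ = η + c * ζ by ring]
  rw [ht, ← trace_diagonal_mul, ← trace_mul_diagonal, ← Matrix.trace_smul]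
  exact congrArg Matrix.trace key

/-! ### Periodicity and product identity for `𝒴`. -/

theorem Y_mul_q_pow (hN : N ≠ 0) (hζ : 0 < ζ.im) (M : ℤ) (τ : ℂ) {x : ℂ} (hx : x ≠ 0) :
    Y N M (e ζ) (e (2 * τ)) (x * e ζ ^ N) = Y N M (e ζ) (e (2 * τ)) x := by
  have hq := e_ne_zero ζ
  have hp := e_ne_zero (2 * τ)
  have hx1 := mul_ne_zero hx (pow_ne_zero N hq)
  have h1 : e ζ ^ (2 * N) * (x * e ζ ^ N) ^ (-2 : ℤ) = x ^ (-2 : ℤ) := by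
    rw [zpow_neg, zpow_neg]
    norm_cast
    field_simp
    ring
  have h2 : ∀ b : ℂ, b ≠ 0 → rho N ζ (b * (x * e ζ ^ N) ^ (-2 : ℤ)) = rho N ζ (b * x ^ (-2 : ℤ)) :=
    fun b hb => by
      rw [← rho_Q_mul hN hζ (mul_ne_zero hb (zpow_ne_zero _ hx1)), mul_left_comm, h1]
  rw [Y_eq_prod_rho hN hζ M τ _ _ (zpow_ne_zero _ hx1) rfl,
    Y_eq_prod_rho hN hζ M τ _ _ (zpow_ne_zero _ hx) rfl]
  exact Finset.prod_congr rfl fun k _ => by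
    rw [h2 _ (pow_ne_zero _ hp), h2 _ (zpow_ne_zero _ hp)]

theorem prod_range_sq_div {K : Type*} [Field K] {f : ℕ → K} (hf : ∀ n, f n ≠ 0) (n : ℕ) :
    ∏ i ∈ Finset.range n, f (i + 1) ^ 2 / (f i * f (i + 2)) = f n / f 0 * (f 1 / f (n + 1)) := by
  induction n with
  | zero => simp [hf]
  | succ n ih =>
    rw [Finset.prod_range_succ, ih]
    have h0 := hf 0
    have h1 := hf n
    have h2 := hf (n + 1)
    have h3 := hf (n + 2)
    field_simp

/-- Along the powers of `q^{-2}`, `rho` is up to a constant a multiplicative second difference of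
theta values, so the product telescopes. The surviving end terms are `N` steps apart and are related
by the quasi-periodicity of theta, so `y` disappears. -/
theorem prod_rho (hN : N ≠ 0) (hζ : 0 < ζ.im) {y : ℂ} (hy : y ≠ 0)
    (h : Regular (e ζ) (e (2 * τ)) y) :
    ∏ i ∈ Finset.range N, rho N ζ (((e ζ ^ 2)⁻¹) ^ i * y) =
      (e ((2 - 2 / N) * ζ) * (e ζ ^ 2)⁻¹) ^ N * e ζ ^ 2 := by
  have hq := e_ne_zero ζ
  have hp := e_ne_zero (2 * τ)
  have hQ : e ζ ^ (2 * N) ≠ 0 := pow_ne_zero _ hq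
  have hQ1 : ‖e ζ ^ (2 * N)‖ < 1 := norm_pow_two_mul_lt_one (norm_e_lt_one hζ) hN
  have hq2 : e ζ ^ 2 ≠ 0 := pow_ne_zero _ hq
  have hr := inv_ne_zero hq2
  set r := (e ζ ^ 2)⁻¹ with hrdef
  have hw : e ζ ^ 2 * y ≠ 0 := mul_ne_zero hq2 hy
  let f : ℕ → ℂ := fun n => Theta (e ζ ^ (2 * N)) (r ^ n * (e ζ ^ 2 * y))
  have hf : ∀ n, f n ≠ 0 := fun n => by
    refine Regular.Theta_q_ne_zero (p := e (2 * τ)) hq (norm_e_lt_one hζ) hN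
      (mul_ne_zero (pow_ne_zero _ hr) hw) ?_
    have := h.mul hq hp (1 - n) 0
    rw [zpow_zero, mul_one, mul_sub, zpow_sub₀ hq, mul_one] at this
    convert this using 1
    rw [hrdef, inv_pow, ← pow_mul, ← mul_assoc, ← div_eq_inv_mul]
    norm_cast
  have h1 : ∀ i, rho N ζ (r ^ i * y) =
      (e ((2 - 2 / N) * ζ) * r) * (f (i + 1) ^ 2 / (f i * f (i + 2))) := fun i => by
    have e1 : r ^ (i + 1) * (e ζ ^ 2 * y) = r ^ i * y := by
      rw [pow_succ, hrdef, mul_assoc, inv_mul_cancel_left₀ hq2]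
    have e2 : r ^ i * (e ζ ^ 2 * y) = e ζ ^ 2 * (r ^ i * y) := by ring
    have e3 : r ^ (i + 2) * (e ζ ^ 2 * y) = r * (r ^ i * y) := by
      rw [pow_succ', mul_assoc, e1]
    rw [rho_eq hN hζ (mul_ne_zero (pow_ne_zero _ hr) hy)]
    simp only [f, e1, e2, e3]
    rfl
  have hQr : ∀ n, e ζ ^ (2 * N) * (r ^ (N + n) * (e ζ ^ 2 * y)) = r ^ n * (e ζ ^ 2 * y) := by
    intro n
    rw [pow_add, hrdef, inv_pow, ← pow_mul, mul_assoc, mul_inv_cancel_left₀ hQ]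
  have h2 : ∀ n, f n = -(r ^ (N + n) * (e ζ ^ 2 * y))⁻¹ * f (N + n) := fun n => by
    simp only [f]
    rw [← Theta_mul_self hQ1 hQ (mul_ne_zero (pow_ne_zero _ hr) hw), hQr]
  rw [Finset.prod_congr rfl fun i _ => h1 i, Finset.prod_mul_distrib, Finset.prod_const,
    Finset.card_range, prod_range_sq_div hf, h2 0, h2 1, add_zero, pow_succ r,
    show e ζ ^ 2 = r⁻¹ from (inv_inv _).symm]
  have h3 := hf N
  have h4 := hf (N + 1)
  have h5 := pow_ne_zero N hr
  generalize r ^ N = R at *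
  field_simp

/-- For each `k`, numerator and denominator both give the constant of `prod_rho`, which does not
depend on the argument. -/
theorem prod_Y (hN : N ≠ 0) (hζ : 0 < ζ.im) (M : ℤ) {x : ℂ} (hx : x ≠ 0)
    (h : Regular (e ζ) (e (2 * τ)) (x ^ 2)) :
    ∏ i ∈ Finset.range N, Y N M (e ζ) (e (2 * τ)) (x * e ζ ^ i) = 1 := by
  have hq := e_ne_zero ζ
  have hp := e_ne_zero (2 * τ)
  have hxi : ∀ i : ℕ, (x * e ζ ^ i) ^ (-2 : ℤ) = ((e ζ ^ 2)⁻¹) ^ i * x ^ (-2 : ℤ) := fun i => by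
    rw [zpow_neg, zpow_neg]
    norm_cast
    rw [mul_pow, mul_inv, inv_pow, ← pow_mul, ← pow_mul, mul_comm i, mul_comm]
  have hy : x ^ (-2 : ℤ) ≠ 0 := zpow_ne_zero _ hx
  have hreg : Regular (e ζ) (e (2 * τ)) (x ^ (-2 : ℤ)) := by
    have := h.inv
    rw [zpow_neg]
    exact_mod_cast this
  have key : ∀ k : ℤ, ∏ i ∈ Finset.range N,
      rho N ζ (e (2 * τ) ^ k * (x * e ζ ^ i) ^ (-2 : ℤ)) =
        (e ((2 - 2 / N) * ζ) * (e ζ ^ 2)⁻¹) ^ N * e ζ ^ 2 := fun k => by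
    rw [← prod_rho hN hζ (mul_ne_zero (zpow_ne_zero k hp) hy) (hreg.p_zpow_mul hq hp k)]
    exact Finset.prod_congr rfl fun i _ => by rw [hxi, mul_left_comm]
  rw [Finset.prod_congr rfl fun i _ => Y_eq_prod_rho hN hζ M τ _ _
    (zpow_ne_zero (-2) (mul_ne_zero hx (pow_ne_zero i hq))) rfl, Finset.prod_comm]
  refine Finset.prod_eq_one fun k _ => ?_
  have := key k
  rw [zpow_natCast] at this
  rw [Finset.prod_div_distrib, this, key]
  exact div_self (mul_ne_zero (pow_ne_zero _ (mul_ne_zero (e_ne_zero _)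
    (inv_ne_zero (pow_ne_zero _ hq)))) (pow_ne_zero _ hq))

end

end EllipticW

end

open EllipticW
theorem theorem3 (N : ℕ) (hN : 2 ≤ N) (M : ℤ) (ζ τ : ℂ) (hζ : 0 < ζ.im) (hτ : 0 < τ.im) :
    (∀ c : ℂ, 0 < (tauStar ζ τ c).im →
      NonResonant ζ τ → NonResonant ζ (tauStar ζ τ c) →
      OnSurface N M ζ τ c →
        (∀ ξ η : ℂ, Generic ζ τ c (η - ξ) → ∀ i j : Fin N,
          t N ζ τ c ξ * L N ζ τ c η i j =
            F N M (e ζ) (e (2 * τ)) (e (η - ξ)) • (L N ζ τ c η i j * t N ζ τ c ξ)) ∧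
        (∀ ξ η : ℂ, Generic ζ τ c (η - ξ) →
          t N ζ τ c ξ * t N ζ τ c η =
            Y N M (e ζ) (e (2 * τ)) (e (η - ξ)) • (t N ζ τ c η * t N ζ τ c ξ))) ∧
    (∀ x : ℂ, x ≠ 0 →
      Y N M (e ζ) (e (2 * τ)) (x * e ζ ^ N) = Y N M (e ζ) (e (2 * τ)) x) ∧
    (∀ x : ℂ, x ≠ 0 → (∀ a b : ℤ, x ^ 2 ≠ e ζ ^ (2 * a) * e (2 * τ) ^ b) →
      ∏ i ∈ Finset.range N, Y N M (e ζ) (e (2 * τ)) (x * e ζ ^ i) = 1) := by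
  have hN0 : N ≠ 0 := by omega
  refine ⟨fun c hτs hr hrs hs => ⟨fun ξ η h i j => ?_, fun ξ η h => ?_⟩, fun x hx => ?_,
    fun x hx h => ?_⟩
  · exact t_mul_L hN0 hζ hτ hτs hr hrs hs (h.neg (neg_sub _ _).symm) i j
  · exact t_mul_t hN0 hζ hτ hτs hr hrs hs h
  · exact Y_mul_q_pow hN0 hζ M τ hx
  · exact prod_Y hN0 hζ M hx h
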